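/- \textbf{Setting.} Let $\gamma,\mu>0$ be constants. Consider linear regression problems $y=X\beta^*+\varepsilon$ with $y,\varepsilon\in\mathbb R^n$, $n\ge 1$, $\beta^*\in\mathbb R^p$, $X\in\mathbb R^{n\times p}$ with rows $x_1,\dots,x_n$, such that the following Assumption 1 holds: $p/n\le\gamma$; the loss $\rho:\mathbb R\to\mathbb R$ is convex with a unique minimizer at $0$ and continuously differentiable, and its derivative $\psi=\rho'$ is $1$-Lipschitz; the rows of $X$ are i.i.d. $N(0,\Sigma)$ for some invertible covariance matrix $\Sigma$; the noise $\varepsilon$ is independent of $X$ and its law is absolutely continuous with respect to Lebesgue measure on $\mathbb R^n$; and the penalty $g:\mathbb R^p\to\mathbb R$ is such that $b\mapsto g(b)-\frac{\mu}{2}b^\top\Sigma b$ is convex. Let $$\hat\beta=\hat\beta(y,X)=\operatorname*{argmin}_{b\in\mathbb R^p}\ \frac1n\sum_{i=1}^n\rho(y_i-x_i^\top b)+g(b),\qquad r=y-X\hat\beta ,$$ and let $\psi$ act componentwise on vectors. For random variables $W$ attached to such problems, $W=O_P(n^{-1/2})$ means: for every $\delta>0$ there is $K$ depending only on $(\delta,\gamma,\mu)$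 such that $\mathbb P(|W|\ge K n^{-1/2})\le\delta$ for all problems as above. \textbf{Theorem.} Almost surely, the map $(y,X)\mapsto\hat\beta(y,X)$ is differentiable at $(y,X)$ and there is a matrix $\hat A\in\mathbb R^{p\times p}$ with $\|\Sigma^{1/2}\hat A\Sigma^{1/2}\|_{op}\le (n\mu)^{-1}$ such that, for all $i\le n$, $j\le p$, $$\frac{\partial\hat\beta}{\partial y_i}=\hat A X^\top e_i\,\psi'(r_i),\qquad \frac{\partial\hat\beta}{\partial x_{ij}}=\hat A e_j\,\psi(r_i)-\hat A X^\top e_i\,\psi'(r_i)\,\hat\beta_j .$$ For any such (random) matrix $\hat A$, almost surely, $$\|\Sigma^{1/2}(\hat\beta-\beta^*)\|^2+\frac{\|\varepsilon\|^2}{n}=\frac{\|r+\operatorname{tr}[\Sigma\hat A]\,\psi(r)\|^2}{n}+O_P(n^{-1/2})\,\mathrm{Rem},$$ where $$\mathrm{Rem}=\|\Sigma^{1/2}(\hat\beta-\beta^*)\|^2+\tfrac1n\|\psi(r)\|^2+\Bigl(\|\Sigma^{1/2}(\hat\beta-\beta^*)\|^2+\tfrac1n\|\psi(r)\|^2\Bigr)^{1/2}\Bigl\|\tfrac1{\sqrt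 n}\varepsilon\Bigr\| .$$ Moreover, almost surely, $$\|\Sigma^{1/2}(\hat\beta-\beta^*)\|^2+\frac{\|\varepsilon\|^2}{n}=\bigl(1+O_P(n^{-1/2})\bigr)\,\frac{\|r+\operatorname{tr}[\Sigma\hat A]\,\psi(r)\|^2}{n}.$$ -/

import Mathlib

open MeasureTheory ProbabilityTheory
open scoped Matrix MatrixOrder Matrix.Norms.L2Operator

namespace RobustReg

/-- `ℝᵏ` with its Euclidean norm. -/
abbrev Vec (k : ℕ) : Type := EuclideanSpace ℝ (Fin k)

/-- An `n × p` design matrix, given by its rows `x₁, …, xₙ ∈ ℝᵖ`. -/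
abbrev Design (n p : ℕ) : Type := Fin n → Vec p

/-- The product `X b ∈ ℝⁿ`, with entries `xᵢᵀ b`. -/
noncomputable def designMul {n p : ℕ} (X : Design n p) (b : Vec p) : Vec n :=
  WithLp.toLp 2 fun i => inner ℝ (X i) b

/-- The matrix-vector product `A v` on `ℝᵖ`. -/
noncomputable def matMul {p : ℕ} (A : Matrix (Fin p) (Fin p) ℝ) (v : Vec p) : Vec p :=
  Matrix.toEuclideanCLM (𝕜 := ℝ) A v

/-- The univariate function `f`, applied to each component of a vector. -/
noncomputable def applyComp {n : ℕ} (f : ℝ → ℝ) (v : Vec n) : Vec n :=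
  WithLp.toLp 2 fun i => f (v i)

/-- The objective `b ↦ n⁻¹ ∑ᵢ ρ(yᵢ - xᵢᵀ b) + g(b)`. -/
noncomputable def objective {n p : ℕ} (ρ : ℝ → ℝ) (g : Vec p → ℝ) (y : Vec n)
    (X : Design n p) (b : Vec p) : ℝ :=
  (1 / (n : ℝ)) * ∑ i, ρ ((y - designMul X b) i) + g b

/-- The regularized M-estimator: a minimizer of the objective. (For a convex differentiable loss
that is minimized at `0` and a penalty that is strongly convex with respect to an invertible
covariance, the minimizer exists and is unique.) -/
noncomputable def mEstimator {n p : ℕ} (ρ : ℝ → ℝ) (g : Vec p → ℝ) (y : Vec n)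
    (X : Design n p) : Vec p :=
  Classical.epsilon fun b => ∀ b', objective ρ g y X b ≤ objective ρ g y X b'

/-- The residual vector `r = y - X β̂(y, X)`. -/
noncomputable def residual {n p : ℕ} (ρ : ℝ → ℝ) (g : Vec p → ℝ) (y : Vec n)
    (X : Design n p) : Vec n :=
  y - designMul X (mEstimator ρ g y X)

/-- The working assumption on one regression problem with constants `γ, μ`: here `ρ` is the loss,
`g` the penalty, `S` the covariance of the rows of the design `X`, and `ε` the noise. -/
structure MainAssumption {n p : ℕ} {Ω : Type*} [MeasurableSpace Ω] (γ μ : ℝ) (P : Measure Ω)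
    (ρ : ℝ → ℝ) (g : Vec p → ℝ) (S : Matrix (Fin p) (Fin p) ℝ)
    (X : Ω → Design n p) (ε : Ω → Vec n) : Prop where
  dim_le : (p : ℝ) / n ≤ γ
  loss_convex : ConvexOn ℝ Set.univ ρ
  loss_min : ∀ u, u ≠ 0 → ρ 0 < ρ u
  loss_contDiff : ContDiff ℝ 1 ρ
  loss_lipschitz : LipschitzWith 1 (deriv ρ)
  cov_posDef : S.PosDef
  design_measurable : Measurable X
  design_law : ∀ i, P.map (fun ω => X ω i) = multivariateGaussian 0 S
  design_indep : iIndepFun (fun i ω => X ω i) P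
  noise_measurable : Measurable ε
  noise_indep : IndepFun ε X P
  noise_continuous : P.map ε ≪ volume
  penalty_convex : ConvexOn ℝ Set.univ fun b : Vec p => g b - μ / 2 * inner ℝ b (matMul S b)

/-- `A` is a matrix of the differentiability structure of the M-estimator at `(y, X)`:
`(y, X) ↦ β̂(y, X)` is differentiable there, `‖Σ^{1/2} A Σ^{1/2}‖_op ≤ (n μ)⁻¹`, and, with
`ψ = ρ'`,
`∂β̂/∂yᵢ = A Xᵀ eᵢ ψ'(rᵢ)` and `∂β̂/∂xᵢⱼ = A eⱼ ψ(rᵢ) - A Xᵀ eᵢ ψ'(rᵢ) β̂ⱼ`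
(note that `Xᵀ eᵢ` is the row `xᵢ`). The matrix norm is the operator norm for Euclidean norms. -/
structure IsDerivMatrix {n p : ℕ} (μ : ℝ) (ρ : ℝ → ℝ) (g : Vec p → ℝ)
    (S : Matrix (Fin p) (Fin p) ℝ) (y : Vec n) (X : Design n p)
    (A : Matrix (Fin p) (Fin p) ℝ) : Prop where
  differentiableAt :
    DifferentiableAt ℝ (fun z : Vec n × Design n p => mEstimator ρ g z.1 z.2) (y, X)
  norm_le : ‖CFC.sqrt S * A * CFC.sqrt S‖ ≤ ((n : ℝ) * μ)⁻¹
  deriv_y : ∀ i : Fin n,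
    fderiv ℝ (fun z : Vec n × Design n p => mEstimator ρ g z.1 z.2) (y, X)
        (EuclideanSpace.single i (1 : ℝ), 0)
      = deriv (deriv ρ) (residual ρ g y X i) • matMul A (X i)
  deriv_x : ∀ (i : Fin n) (j : Fin p),
    fderiv ℝ (fun z : Vec n × Design n p => mEstimator ρ g z.1 z.2) (y, X)
        (0, Pi.single i (EuclideanSpace.single j (1 : ℝ)))
      = deriv ρ (residual ρ g y X i) • matMul A (EuclideanSpace.single j (1 : ℝ))
        - (deriv (deriv ρ) (residual ρ g y X i) * mEstimator ρ g y X j) • matMul A (X i)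

/-- The out-of-sample error `‖Σ^{1/2}(β̂ - β*)‖²`. -/
noncomputable def outOfSample {n p : ℕ} (ρ : ℝ → ℝ) (g : Vec p → ℝ)
    (S : Matrix (Fin p) (Fin p) ℝ) (βstar : Vec p) (y : Vec n) (X : Design n p) : ℝ :=
  ‖matMul (CFC.sqrt S) (mEstimator ρ g y X - βstar)‖ ^ 2

/-- The proxy `‖r + tr[Σ A] ψ(r)‖² / n`. -/
noncomputable def proxy {n p : ℕ} (ρ : ℝ → ℝ) (g : Vec p → ℝ)
    (S A : Matrix (Fin p) (Fin p) ℝ) (y : Vec n) (X : Design n p) : ℝ :=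
  ‖residual ρ g y X + (S * A).trace • applyComp (deriv ρ) (residual ρ g y X)‖ ^ 2 / n

/-- The remainder `D + D^{1/2} ‖n^{-1/2} ε‖`, where `D = ‖Σ^{1/2}(β̂ - β*)‖² + ‖ψ(r)‖² / n`. -/
noncomputable def remainder {n p : ℕ} (ρ : ℝ → ℝ) (g : Vec p → ℝ)
    (S : Matrix (Fin p) (Fin p) ℝ) (βstar : Vec p) (e : Vec n) (y : Vec n)
    (X : Design n p) : ℝ :=
  outOfSample ρ g S βstar y X + 1 / (n : ℝ) * ‖applyComp (deriv ρ) (residual ρ g y X)‖ ^ 2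
    + √(outOfSample ρ g S βstar y X
        + 1 / (n : ℝ) * ‖applyComp (deriv ρ) (residual ρ g y X)‖ ^ 2)
      * ‖(1 / √(n : ℝ)) • e‖

/-- `W = O_P(a)` with constants `K`: `W` is a random variable, and for every `δ > 0`,
`P(|W| ≥ K(δ) a) ≤ δ`. A uniform statement about sequences of random variables is obtained by
choosing the function `K` before the sequence. -/
def IsOP {Ω : Type*} [MeasurableSpace Ω] (P : Measure Ω) (K : ℝ → ℝ) (a : ℝ)
    (W : Ω → ℝ) : Prop :=
  Measurable W ∧ ∀ δ : ℝ, 0 < δ → P {ω | K δ * a ≤ |W ω|} ≤ ENNReal.ofReal δ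

end RobustReg

/-!
# The out-of-sample error of a regularized M-estimator and its observable proxy

**Whitening.** With `G = X S^{-1/2}` and `g̃ b = g (β* + S^{-1/2} b)`, the whitened error
`h = S^{1/2}(β̂ - β*)` is the M-estimator of the data `(ε, G)` with penalty `g̃`. The rows of `G` are
standard Gaussian vectors and `g̃` is `μ`-strongly convex for the Euclidean norm. A derivative matrix
`A` of the original problem corresponds to the derivative matrix `S^{1/2} A S^{1/2}` of the isotropic
one, whose trace is `tr (S A)` (`isDerivMatrix_whiten_iff`). It remains to treat the isotropic
problem, and since the noise and the design are independent the noise may be frozen to a vector `e`.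

**Differentiability.** Strong convexity and the inequality
`(ψ(a) - ψ(b))² ≤ (a - b)(ψ(a) - ψ(b))` show that the estimator and the score `ψ(r)` are Lipschitz on
bounded sets of data (`stability`), hence almost everywhere differentiable by Rademacher's theorem.
Where both are differentiable, the derivative of the estimator is a linear function of norm at most
`(nμ)⁻¹` of the formal derivative of `Gᵀ ψ(r)` (`fderiv_inner_le`, `exists_matrix_factor`); that
function is the matrix `A`.

**The main cancellation.** Put `ξ = G h - tr(A) ψ(r)`, so that `r + tr(A) ψ(r) = e - ξ` and
`n(‖h‖² + ‖e‖²/n - ‖e - ξ‖²/n) = n ‖h‖² - ‖ξ‖² + 2⟨e, ξ⟩`. Let `h⁽ⁱ⁾` be the estimator with row `i` of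
the design replaced by zero; it is independent of the `i`-th row `Gᵢ`. A second-order Stein inequality
(`lintegral_skorohod_sq_le`), applied in row `i` to `h - h⁽ⁱ⁾`, says that `⟨Gᵢ, h - h⁽ⁱ⁾⟩` is close to
the divergence of `h` in row `i`, and this divergence is `tr(A) ψ(rᵢ)` up to a term that is small
after summation over `i` (`IsDerivMatrix.rowDiv_eq`). Hence `ξᵢ` is close to the leave-one-out
prediction `⟨Gᵢ, h⁽ⁱ⁾⟩`. The sums `∑ᵢ (⟨Gᵢ, h⁽ⁱ⁾⟩² - ‖h⁽ⁱ⁾‖²)` and `∑ᵢ eᵢ ⟨Gᵢ, h⁽ⁱ⁾⟩` consist of terms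
that are centered given the other rows and nearly uncorrelated, because deleting one observation
changes the estimator little (`integral_sum_sq_le`, `integral_looBound_le`). This bounds the left side
by `√n · D₀ + √D₀ ‖e‖` up to a constant, where `D₀ = nullSize ρ g e` is the size of the problem with
zero design, which does not depend on the design (`TypicalDesign.abs_sub_proxy_le`).

**Back to observable scales.** All the random quantities involved are controlled, up to a factor `M`,
outside an event of probability `O(1/M)` (`TypicalDesign`, `measure_not_typical_le`). On the
complement, deterministic arguments compare `D₀` with `D = ‖h‖² + ‖ψ(r)‖²/n` (`nullSize_le`), and
`‖h‖² + ‖e‖²/n` with the proxy, using that `tr A ≥ 0` makes the proxy at least `‖r‖²/n`. For large `n`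
these comparisons come from the fluctuation bound itself. For bounded `n` they come from crude bounds
and from the fact that the Gaussian variable `⟨Gᵢ, h₀⟩`, with `h₀` the estimator for the zero design,
is unlikely to be close to `eᵢ` (`target_le_proxy_of_le`).
-/

namespace RobustReg

/-! ### The standard Gaussian measure and its density -/

/-- The density of the standard Gaussian measure on `ℝᵏ` with respect to Lebesgue measure. -/
noncomputable def gaussDensity (k : ℕ) (x : Vec k) : ℝ :=
  ((2 * Real.pi) ^ ((k : ℝ) / 2))⁻¹ * Real.exp (-(1 / 2) * ‖x‖ ^ 2)

theorem gaussDensity_nonneg {k : ℕ} (x : Vec k) : 0 ≤ gaussDensity k x := by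
  unfold gaussDensity; positivity

theorem contDiff_gaussDensity {k : ℕ} {m : WithTop ℕ∞} : ContDiff ℝ m (gaussDensity k) := by
  unfold gaussDensity
  exact contDiff_const.mul ((contDiff_const.mul (contDiff_norm_sq ℝ)).exp)

theorem fderiv_gaussDensity {k : ℕ} (x v : Vec k) :
    fderiv ℝ (gaussDensity k) x v = -(inner ℝ x v) * gaussDensity k x := by
  have h1 : HasFDerivAt (fun x : Vec k => ‖x‖ ^ 2) (2 • (innerSL ℝ x)) x :=
    (hasStrictFDerivAt_norm_sq x).hasFDerivAt
  have h2 := ((h1.const_mul (-(1 / 2))).exp.const_mul ((2 * Real.pi) ^ ((k : ℝ) / 2))⁻¹)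
  have h3 : fderiv ℝ (gaussDensity k) x = _ := h2.fderiv
  rw [h3]
  simp [gaussDensity]
  ring

theorem integrable_gaussDensity (k : ℕ) : Integrable (gaussDensity k) := by
  have h := GaussianFourier.integrable_cexp_neg_mul_sq_norm_add (V := Vec k) (b := 1 / 2)
    (by norm_num) 0 0
  have h2 := h.norm.const_mul ((2 * Real.pi) ^ ((k : ℝ) / 2))⁻¹
  refine h2.congr (Filter.Eventually.of_forall fun x => ?_)
  simp only [gaussDensity, Complex.norm_exp]
  congr 2
  simp [← Complex.ofReal_pow]

/-- The standard Gaussian measure and the measure with the Gaussian density have the same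
characteristic function. -/
theorem stdGaussian_eq_withDensity (k : ℕ) :
    stdGaussian (Vec k) = volume.withDensity fun x => ENNReal.ofReal (gaussDensity k x) := by
  have hfin : IsFiniteMeasure
      ((volume : Measure (Vec k)).withDensity fun x => ENNReal.ofReal (gaussDensity k x)) :=
    isFiniteMeasure_withDensity_ofReal (integrable_gaussDensity k).2
  refine Measure.ext_of_charFun ?_
  ext t
  rw [charFun_stdGaussian, charFun_apply, integral_withDensity_eq_integral_toReal_smul
    (by have := (contDiff_gaussDensity (k := k) (m := 0)).continuous.measurable
        fun_prop) (by simp)]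
  have h := GaussianFourier.integral_cexp_neg_mul_sq_norm_add (V := Vec k) (b := 1 / 2)
    (by norm_num) Complex.I t
  have key : ∀ x : Vec k, (ENNReal.ofReal (gaussDensity k x)).toReal •
      Complex.exp ((inner ℝ x t : ℝ) * Complex.I)
      = (((2 * Real.pi) ^ ((k : ℝ) / 2))⁻¹ : ℝ) *
        Complex.exp (-(1 / 2) * (‖x‖ : ℂ) ^ 2 + Complex.I * (inner ℝ t x : ℝ)) := by
    intro x
    rw [ENNReal.toReal_ofReal (gaussDensity_nonneg x), gaussDensity, Complex.real_smul,
      Complex.ofReal_mul, mul_assoc, Complex.ofReal_exp, ← Complex.exp_add, real_inner_comm]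
    congr 2
    push_cast
    ring
  simp_rw [key]
  rw [integral_const_mul, h, ← mul_assoc]
  have h2 : ((((2 * Real.pi) ^ ((k : ℝ) / 2))⁻¹ : ℝ) : ℂ) *
      ((Real.pi : ℂ) / (1 / 2)) ^ ((Module.finrank ℝ (Vec k) : ℂ) / 2) = 1 := by
    have : ((Real.pi : ℂ) / (1 / 2)) = ((2 * Real.pi : ℝ) : ℂ) := by push_cast; ring
    rw [this, finrank_euclideanSpace_fin]
    have h3 : ((k : ℂ) / 2) = (((k : ℝ) / 2 : ℝ) : ℂ) := by push_cast; ring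
    rw [h3, ← Complex.ofReal_cpow (by positivity), ← Complex.ofReal_mul, inv_mul_cancel₀]
    · simp
    · positivity
  rw [h2, one_mul]
  congr 1
  rw [Complex.I_sq]
  ring

theorem stdGaussian_absolutelyContinuous (k : ℕ) : stdGaussian (Vec k) ≪ volume := by
  rw [stdGaussian_eq_withDensity]
  exact withDensity_absolutelyContinuous _ _

/-- Integration against the standard Gaussian measure, through its density. -/
theorem integral_stdGaussian {k : ℕ} (f : Vec k → ℝ) :
    ∫ x, f x ∂stdGaussian (Vec k) = ∫ x, gaussDensity k x * f x := by
  rw [stdGaussian_eq_withDensity, integral_withDensity_eq_integral_toReal_smul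
    (by have := (contDiff_gaussDensity (k := k) (m := 0)).continuous.measurable
        fun_prop) (by simp)]
  simp_rw [ENNReal.toReal_ofReal (gaussDensity_nonneg _), smul_eq_mul]

theorem pi_absolutelyContinuous {α : Type} [MeasurableSpace α] {μ ν : Measure α} [SigmaFinite μ]
    [SigmaFinite ν] (h : μ ≪ ν) (n : ℕ) :
    Measure.pi (fun _ : Fin n => μ) ≪ Measure.pi (fun _ : Fin n => ν) := by
  induction n with
  | zero =>
    rw [Measure.pi_of_empty, Measure.pi_of_empty]
  | succ n ih =>
    have h1 := (measurePreserving_piFinSuccAbove (fun _ : Fin (n + 1) => μ) 0).symm.map_eq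
    have h2 := (measurePreserving_piFinSuccAbove (fun _ : Fin (n + 1) => ν) 0).symm.map_eq
    rw [← h1, ← h2]
    exact (h.prod ih).map (MeasurableEquiv.measurable _)

/-- The law of a design whose rows are independent standard Gaussian vectors. -/
noncomputable abbrev gaussDesign (n p : ℕ) : Measure (Design n p) :=
  Measure.pi fun _ => stdGaussian (Vec p)

theorem gaussDesign_absolutelyContinuous (n p : ℕ) : gaussDesign n p ≪ volume :=
  pi_absolutelyContinuous (stdGaussian_absolutelyContinuous p) n

/-- Redrawing one row of a Gaussian design does not change its law. -/
theorem measurePreserving_update (n p : ℕ) (i : Fin n) :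
    MeasurePreserving (fun z : Design n p × Vec p => Function.update z.1 i z.2)
      ((gaussDesign n p).prod (stdGaussian (Vec p))) (gaussDesign n p) := by
  have hm : Measurable (fun z : Design n p × Vec p => Function.update z.1 i z.2) := by
    refine measurable_pi_lambda _ fun j => ?_
    by_cases hj : j = i
    · subst hj; simpa using measurable_snd
    · simp only [Function.update_of_ne hj]
      exact (measurable_pi_apply j).comp measurable_fst
  refine ⟨hm, ?_⟩
  symm
  refine Measure.pi_eq fun s hs => ?_
  rw [Measure.map_apply hm (.univ_pi hs)]
  have : (fun z : Design n p × Vec p => Function.update z.1 i z.2) ⁻¹' (Set.univ.pi s)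
      = (Set.univ.pi (Function.update s i Set.univ)) ×ˢ s i := by
    ext z
    simp only [Set.mem_preimage, Set.mem_univ_pi, Set.mem_prod]
    constructor
    · intro h
      refine ⟨fun j => ?_, by simpa using h i⟩
      by_cases hj : j = i
      · subst hj; simp
      · simpa [Function.update_of_ne hj] using h j
    · rintro ⟨h1, h2⟩ j
      by_cases hj : j = i
      · subst hj; simpa using h2
      · simpa [Function.update_of_ne hj] using h1 j
  rw [this, Measure.prod_prod, Measure.pi_pi, ← Finset.prod_erase_mul _ _ (Finset.mem_univ i),
    ← Finset.prod_erase_mul Finset.univ (fun j => stdGaussian (Vec p) (s j)) (Finset.mem_univ i)]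
  simp only [Function.update_self, measure_univ, mul_one]
  congr 1
  refine Finset.prod_congr rfl fun j hj => ?_
  rw [Function.update_of_ne (Finset.ne_of_mem_erase hj)]

theorem lintegral_resample {n p : ℕ} (i : Fin n) {F : Design n p → ENNReal}
    (hF : AEMeasurable F (gaussDesign n p)) :
    ∫⁻ G, F G ∂gaussDesign n p
      = ∫⁻ G, ∫⁻ z, F (Function.update G i z) ∂stdGaussian (Vec p) ∂gaussDesign n p := by
  rw [← (measurePreserving_update n p i).map_eq] at hF
  conv_lhs => rw [← (measurePreserving_update n p i).map_eq]
  rw [lintegral_map' hF (measurePreserving_update n p i).measurable.aemeasurable]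
  exact lintegral_prod _ (hF.comp_measurable (measurePreserving_update n p i).measurable)

theorem integral_resample {n p : ℕ} (i : Fin n) {F : Design n p → ℝ}
    (hF : Integrable F (gaussDesign n p)) :
    ∫ G, F G ∂gaussDesign n p
      = ∫ G, ∫ z, F (Function.update G i z) ∂stdGaussian (Vec p) ∂gaussDesign n p := by
  have h := (measurePreserving_update n p i)
  conv_lhs => rw [← h.map_eq]
  rw [integral_map h.measurable.aemeasurable (by rw [h.map_eq]; exact hF.1)]
  exact integral_prod _ ((h.integrable_comp hF.1).2 hF)

/-! ### A second-order Stein inequality -/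

/-- The partial derivative `∂f/∂x_k` of a scalar function on `ℝᵖ`. -/
noncomputable def pd {p : ℕ} (k : Fin p) (f : Vec p → ℝ) (x : Vec p) : ℝ :=
  fderiv ℝ f x (EuclideanSpace.single k 1)

/-- The Gaussian divergence (Skorohod integral) `xᵀ f(x) - div f(x)` of the vector field with
components `f j`. -/
noncomputable def skorohod {p : ℕ} (f : Fin p → Vec p → ℝ) (x : Vec p) : ℝ :=
  ∑ j, (x j * f j x - pd j (f j) x)

theorem contDiff_pd {p : ℕ} {m n : WithTop ℕ∞} {f : Vec p → ℝ} (hf : ContDiff ℝ n f)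
    (hmn : m + 1 ≤ n) (k : Fin p) : ContDiff ℝ m (pd k f) :=
  (hf.fderiv_right hmn).clm_apply contDiff_const

theorem hasCompactSupport_pd {p : ℕ} {f : Vec p → ℝ} (hf : HasCompactSupport f) (k : Fin p) :
    HasCompactSupport (pd k f) :=
  hf.fderiv_apply ℝ _

theorem pd_mul {p : ℕ} {f g : Vec p → ℝ} {x : Vec p} (hf : DifferentiableAt ℝ f x)
    (hg : DifferentiableAt ℝ g x) (k : Fin p) :
    pd k (fun y => f y * g y) x = f x * pd k g x + g x * pd k f x := by
  simp [pd, fderiv_fun_mul hf hg]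

theorem pd_coord {p : ℕ} (j k : Fin p) (x : Vec p) :
    pd k (fun y : Vec p => y j) x = if j = k then 1 else 0 := by
  have : fderiv ℝ (fun y : Vec p => y j) x = (EuclideanSpace.proj j : Vec p →L[ℝ] ℝ) :=
    (EuclideanSpace.proj j : Vec p →L[ℝ] ℝ).fderiv
  simp [pd, this]

theorem pd_comm {p : ℕ} {f : Vec p → ℝ} (hf : ContDiff ℝ 2 f) (j k : Fin p) (x : Vec p) :
    pd j (pd k f) x = pd k (pd j f) x := by
  have hs : IsSymmSndFDerivAt ℝ f x :=
    hf.contDiffAt.isSymmSndFDerivAt (by simp)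
  have hd : DifferentiableAt ℝ (fderiv ℝ f) x :=
    ((hf.fderiv_right (m := 1) (by norm_num)).differentiable (by norm_num)) x
  have h : ∀ a b : Fin p, pd a (pd b f) x
      = fderiv ℝ (fderiv ℝ f) x (EuclideanSpace.single a 1) (EuclideanSpace.single b 1) := by
    intro a b
    unfold pd
    rw [fderiv_clm_apply hd (differentiableAt_const _)]
    simp
  rw [h, h]
  exact hs _ _

/-- Gaussian integration by parts. -/
theorem integral_coord_mul {p : ℕ} {u : Vec p → ℝ} (hu : ContDiff ℝ 1 u)
    (hc : HasCompactSupport u) (k : Fin p) :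
    ∫ x, x k * u x ∂stdGaussian (Vec p) = ∫ x, pd k u x ∂stdGaussian (Vec p) := by
  have hφ : ContDiff ℝ 1 (gaussDensity p) := contDiff_gaussDensity
  have hφ' : Continuous fun x => fderiv ℝ (gaussDensity p) x (EuclideanSpace.single k 1) :=
    (contDiff_pd hφ (m := 0) (by norm_num) k).continuous
  rw [integral_stdGaussian, integral_stdGaussian]
  have h := integral_mul_fderiv_eq_neg_fderiv_mul_of_integrable (μ := volume)
    (f := gaussDensity p) (g := u) (v := EuclideanSpace.single k (1 : ℝ))
    ((hφ'.mul hu.continuous).integrable_of_hasCompactSupport hc.mul_left)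
    ((hφ.continuous.mul (contDiff_pd hu (m := 0) (by norm_num) k).continuous
      ).integrable_of_hasCompactSupport (hasCompactSupport_pd hc k).mul_left)
    ((hφ.continuous.mul hu.continuous).integrable_of_hasCompactSupport hc.mul_left)
    (fun x _ => hφ.differentiable (by norm_num) x) (fun x _ => hu.differentiable (by norm_num) x)
  unfold pd
  rw [h, ← integral_neg]
  congr 1
  ext x
  rw [fderiv_gaussDensity]
  simp [EuclideanSpace.inner_single_right]
  ring

theorem integrable_stdGaussian_of_hasCompactSupport {p : ℕ} {u : Vec p → ℝ} (hu : Continuous u)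
    (hc : HasCompactSupport u) : Integrable u (stdGaussian (Vec p)) :=
  hu.integrable_of_hasCompactSupport hc

/-- The operator `v ↦ x_k v - ∂v/∂x_k` is the adjoint of `∂/∂x_k`. -/
theorem integral_adjoint_mul {p : ℕ} {u v : Vec p → ℝ} (hu : ContDiff ℝ 1 u)
    (hv : ContDiff ℝ 1 v) (hc : HasCompactSupport v) (k : Fin p) :
    ∫ x, (x k * v x - pd k v x) * u x ∂stdGaussian (Vec p)
      = ∫ x, v x * pd k u x ∂stdGaussian (Vec p) := by
  have h : ∫ x : Vec p, x k * (v x * u x) ∂stdGaussian (Vec p)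
      = ∫ x, pd k (fun y => v y * u y) x ∂stdGaussian (Vec p) :=
    integral_coord_mul (hv.mul hu) hc.mul_right k
  have hpd : ∀ x, pd k (fun y => v y * u y) x = v x * pd k u x + u x * pd k v x := fun x =>
    pd_mul (hv.differentiable (by norm_num) x) (hu.differentiable (by norm_num) x) k
  have hcu := (contDiff_pd hu (m := 0) (by norm_num) k).continuous
  have hcv := (contDiff_pd hv (m := 0) (by norm_num) k).continuous
  have i1 : Integrable (fun x => v x * pd k u x) (stdGaussian (Vec p)) :=
    integrable_stdGaussian_of_hasCompactSupport (hv.continuous.mul hcu) hc.mul_right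
  have i2 : Integrable (fun x => u x * pd k v x) (stdGaussian (Vec p)) :=
    integrable_stdGaussian_of_hasCompactSupport (hu.continuous.mul hcv)
      (hasCompactSupport_pd hc k).mul_left
  have i3 : Integrable (fun x : Vec p => x k * (v x * u x)) (stdGaussian (Vec p)) := by
    refine integrable_stdGaussian_of_hasCompactSupport ?_ (hc.mul_right.mul_left)
    have := hu.continuous
    have := hv.continuous
    fun_prop
  simp_rw [hpd] at h
  rw [integral_add i1 i2] at h
  have e : ∀ x : Vec p, (x k * v x - pd k v x) * u x = x k * (v x * u x) - u x * pd k v x := by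
    intro x; ring
  simp_rw [e]
  rw [integral_sub i3 i2]
  linarith

theorem contDiff_coord {p : ℕ} {m : WithTop ℕ∞} (j : Fin p) :
    ContDiff ℝ m (fun x : Vec p => x j) :=
  (EuclideanSpace.proj j : Vec p →L[ℝ] ℝ).contDiff

theorem contDiff_skorohod {p : ℕ} {f : Fin p → Vec p → ℝ} (hf : ∀ j, ContDiff ℝ 2 (f j)) :
    ContDiff ℝ 1 (skorohod f) := by
  unfold skorohod
  refine ContDiff.sum fun j _ => ?_
  exact ((contDiff_coord j).mul ((hf j).of_le (by norm_num))).sub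
    (contDiff_pd (hf j) (by norm_num) j)

/-- The commutation relation between the gradient and the Gaussian divergence. -/
theorem pd_skorohod {p : ℕ} {f : Fin p → Vec p → ℝ} (hf : ∀ j, ContDiff ℝ 2 (f j)) (j : Fin p)
    (x : Vec p) : pd j (skorohod f) x = f j x + skorohod (fun k => pd j (f k)) x := by
  have hd : ∀ k, DifferentiableAt ℝ (f k) x := fun k => (hf k).differentiable (by norm_num) x
  have hd' : ∀ k, DifferentiableAt ℝ (pd k (f k)) x := fun k =>
    (contDiff_pd (hf k) (m := 1) (by norm_num) k).differentiable (by norm_num) x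
  have hx : ∀ k : Fin p, DifferentiableAt ℝ (fun y : Vec p => y k) x := fun k =>
    (contDiff_coord (m := 1) k).differentiable (by norm_num) x
  have h1 : pd j (skorohod f) x
      = ∑ k, (x k * pd j (f k) x + f k x * (if k = j then 1 else 0) - pd j (pd k (f k)) x) := by
    change fderiv ℝ (fun y => ∑ k, (y k * f k y - pd k (f k) y)) x _ = _
    rw [fderiv_fun_sum (fun k _ => ((hx k).fun_mul (hd k)).fun_sub (hd' k)),
      _root_.sum_apply]
    refine Finset.sum_congr rfl fun k _ => ?_
    rw [fderiv_fun_sub ((hx k).fun_mul (hd k)) (hd' k), _root_.sub_apply]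
    have := pd_mul (hx k) (hd k) j
    rw [pd_coord] at this
    rw [← this]
    rfl
  rw [h1]
  simp only [skorohod, pd_comm (hf _) j]
  simp only [add_sub_right_comm, Finset.sum_add_distrib]
  simp [add_comm]

/-- The Skorohod isometry for smooth compactly supported vector fields. -/
theorem integral_skorohod_sq {p : ℕ} {f : Fin p → Vec p → ℝ} (hf : ∀ j, ContDiff ℝ 2 (f j))
    (hc : ∀ j, HasCompactSupport (f j)) :
    ∫ x, skorohod f x ^ 2 ∂stdGaussian (Vec p)
      = ∫ x, (∑ j, f j x ^ 2 + ∑ j, ∑ k, pd k (f j) x * pd j (f k) x) ∂stdGaussian (Vec p) := by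
  have hf1 : ∀ j, ContDiff ℝ 1 (f j) := fun j => (hf j).of_le (by norm_num)
  have hpd1 : ∀ j k, ContDiff ℝ 1 (pd j (f k)) := fun j k =>
    contDiff_pd (hf k) (by norm_num) j
  have hpdc : ∀ j k, HasCompactSupport (pd j (f k)) := fun j k => hasCompactSupport_pd (hc k) j
  have hs := contDiff_skorohod hf
  have hcont : ∀ (v : Vec p → ℝ) (k : Fin p), ContDiff ℝ 1 v →
      Continuous fun x => x k * v x - pd k v x := fun v k hv =>
    (((contDiff_coord (m := 0) k).continuous).mul hv.continuous).sub
      (contDiff_pd hv (m := 0) (by norm_num) k).continuous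
  have hcs : ∀ (v : Vec p → ℝ) (k : Fin p), HasCompactSupport v →
      HasCompactSupport fun x => x k * v x - pd k v x := fun v k hv =>
    hv.mul_left.sub (hasCompactSupport_pd hv k)
  have e1 : ∫ x, skorohod f x ^ 2 ∂stdGaussian (Vec p)
      = ∑ j, ∫ x, (x j * f j x - pd j (f j) x) * skorohod f x ∂stdGaussian (Vec p) := by
    rw [← integral_finsetSum]
    · congr 1
      ext x
      rw [← Finset.sum_mul, sq, skorohod]
    · intro j _
      exact integrable_stdGaussian_of_hasCompactSupport ((hcont _ _ (hf1 j)).mul hs.continuous)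
        (hcs _ _ (hc j)).mul_right
  -- two integrations by parts, with the commutation relation in between
  have e2 : ∀ j, ∫ x, (x j * f j x - pd j (f j) x) * skorohod f x ∂stdGaussian (Vec p)
      = ∫ x, (f j x ^ 2 + ∑ k, pd k (f j) x * pd j (f k) x) ∂stdGaussian (Vec p) := by
    intro j
    rw [integral_adjoint_mul hs (hf1 j) (hc j) j]
    simp_rw [pd_skorohod hf j, mul_add]
    rw [integral_add, integral_add, ← sub_eq_zero]
    · have i4 : ∫ x, f j x * skorohod (fun k => pd j (f k)) x ∂stdGaussian (Vec p)
          = ∫ x, ∑ k, pd k (f j) x * pd j (f k) x ∂stdGaussian (Vec p) := by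
        have : ∀ x, f j x * skorohod (fun k => pd j (f k)) x
            = ∑ k, (x k * pd j (f k) x - pd k (pd j (f k)) x) * f j x := by
          intro x
          rw [← Finset.sum_mul, skorohod, mul_comm]
        simp_rw [this]
        rw [integral_finsetSum, integral_finsetSum]
        · refine Finset.sum_congr rfl fun k _ => ?_
          rw [integral_adjoint_mul (hf1 j) (hpd1 j k) (hpdc j k) k]
          simp_rw [mul_comm]
        · intro k _
          exact integrable_stdGaussian_of_hasCompactSupport
            ((hpd1 k j).continuous.mul (hpd1 j k).continuous) (hpdc k j).mul_right
        · intro k _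
          exact integrable_stdGaussian_of_hasCompactSupport
            ((hcont _ _ (hpd1 j k)).mul (hf1 j).continuous) (hcs _ _ (hpdc j k)).mul_right
      rw [i4]
      simp_rw [sq]
      ring
    · simp_rw [sq]
      exact integrable_stdGaussian_of_hasCompactSupport
            ((hf1 j).continuous.mul (hf1 j).continuous) (hc j).mul_right
    · refine integrable_finsetSum _ fun k _ => ?_
      exact integrable_stdGaussian_of_hasCompactSupport
            ((hpd1 k j).continuous.mul (hpd1 j k).continuous) (hpdc k j).mul_right
    · exact integrable_stdGaussian_of_hasCompactSupport
            ((hf1 j).continuous.mul (hf1 j).continuous) (hc j).mul_right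
    · refine integrable_stdGaussian_of_hasCompactSupport
            ((hf1 j).continuous.mul ?_) (hc j).mul_right
      unfold skorohod
      exact continuous_finsetSum _ fun k _ => hcont _ _ (hpd1 j k)
  rw [e1]
  simp_rw [e2]
  rw [← integral_finsetSum]
  · simp_rw [Finset.sum_add_distrib]
  · intro j _
    refine Integrable.add ?_ ?_
    · simp_rw [sq]
      exact integrable_stdGaussian_of_hasCompactSupport
            ((hf1 j).continuous.mul (hf1 j).continuous) (hc j).mul_right
    · refine integrable_finsetSum _ fun k _ => ?_
      exact integrable_stdGaussian_of_hasCompactSupport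
            ((hpd1 k j).continuous.mul (hpd1 j k).continuous) (hpdc k j).mul_right

/-- A smooth bump on `ℝᵖ` at scale `1 / (m + 1)`. -/
noncomputable def mollBump (p m : ℕ) : ContDiffBump (0 : Vec p) :=
  ⟨1 / (m + 1), 2 / (m + 1), by positivity, by gcongr; norm_num⟩

open scoped Convolution in
/-- The mollification of a function on `ℝᵖ` by a smooth bump at scale `1 / (m + 1)`. -/
noncomputable def mollify {p : ℕ} (m : ℕ) (f : Vec p → ℝ) : Vec p → ℝ :=
  (mollBump p m).normed volume ⋆[ContinuousLinearMap.lsmul ℝ ℝ, volume] f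

/-- The mollification is an average of translates of the function. -/
theorem mollify_eq {p : ℕ} (m : ℕ) : ∃ φ : Vec p → ℝ, (∀ t, 0 ≤ φ t) ∧ Continuous φ ∧
    HasCompactSupport φ ∧ ∫ t, φ t = 1 ∧
    ∀ (f : Vec p → ℝ) (x : Vec p), mollify m f x = ∫ t, φ t * f (x - t) :=
  ⟨(mollBump p m).normed volume, (mollBump p m).nonneg_normed, (mollBump p m).continuous_normed,
    (mollBump p m).hasCompactSupport_normed, (mollBump p m).integral_normed, fun _ _ => rfl⟩

theorem contDiff_mollify {p : ℕ} (m : ℕ) {f : Vec p → ℝ} (hf : LocallyIntegrable f) :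
    ContDiff ℝ 2 (mollify m f) :=
  HasCompactSupport.contDiff_convolution_left _ (ContDiffBump.hasCompactSupport_normed _)
    (ContDiffBump.contDiff_normed _) hf

theorem hasCompactSupport_mollify {p : ℕ} (m : ℕ) {f : Vec p → ℝ} (hf : HasCompactSupport f) :
    HasCompactSupport (mollify m f) :=
  HasCompactSupport.convolution _ (ContDiffBump.hasCompactSupport_normed _) hf

theorem abs_mollify_le {p : ℕ} (m : ℕ) {f : Vec p → ℝ} {M : ℝ} (hM : ∀ x, |f x| ≤ M)
    (x : Vec p) : |mollify m f x| ≤ M := by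
  obtain ⟨φ, h0, hφ, hcφ, h1, h⟩ := mollify_eq (p := p) m
  rw [h, ← Real.norm_eq_abs]
  have : ∫ t, φ t * M = M := by rw [integral_mul_const, h1, one_mul]
  rw [← this]
  refine norm_integral_le_of_norm_le ((hφ.integrable_of_hasCompactSupport hcφ).mul_const M)
    (Filter.Eventually.of_forall fun t => ?_)
  rw [norm_mul, Real.norm_eq_abs, Real.norm_eq_abs, abs_of_nonneg (h0 t)]
  exact mul_le_mul_of_nonneg_left (hM _) (h0 t)

theorem measurable_pd {p : ℕ} (k : Fin p) (f : Vec p → ℝ) : Measurable (pd k f) :=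
  measurable_fderiv_apply_const ℝ f _

theorem abs_pd_le {p : ℕ} (k : Fin p) {f : Vec p → ℝ} {C : NNReal} (hf : LipschitzWith C f)
    (x : Vec p) : |pd k f x| ≤ C := by
  refine ((fderiv ℝ f x).le_opNorm _).trans ?_
  simpa using norm_fderiv_le_of_lipschitz ℝ hf

theorem pd_mollify {p : ℕ} (m : ℕ) {f : Vec p → ℝ} {C : NNReal} (hf : LipschitzWith C f)
    (k : Fin p) (x : Vec p) : pd k (mollify m f) x = mollify m (pd k f) x := by
  obtain ⟨φ, h0, hφ, hcφ, h1, h⟩ := mollify_eq (p := p) m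
  have hφi : Integrable φ := hφ.integrable_of_hasCompactSupport hcφ
  have hmeas : Measurable (fderiv ℝ f) := measurable_fderiv ℝ f
  have key := hasFDerivAt_integral_of_dominated_loc_of_lip (𝕜 := ℝ) (μ := volume)
    (F := fun y t => φ t * f (y - t)) (F' := fun t => φ t • fderiv ℝ f (x - t)) (x₀ := x)
    (s := Set.univ) (bound := fun t => φ t * C) Filter.univ_mem
    (Filter.Eventually.of_forall fun y => by
      have := hf.continuous
      exact (hφ.mul (by fun_prop)).aestronglyMeasurable)
    ((hφ.mul (hf.continuous.comp (by fun_prop))).integrable_of_hasCompactSupport hcφ.mul_right)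
    (by
      refine Measurable.aestronglyMeasurable ?_
      exact hφ.measurable.smul (hmeas.comp (by fun_prop)))
    (Filter.Eventually.of_forall fun t => by
      refine LipschitzOnWith.of_dist_le_mul fun y _ z _ => ?_
      rw [Real.dist_eq, ← mul_sub, abs_mul, ← Real.dist_eq]
      have := hf.dist_le_mul (y - t) (z - t)
      rw [dist_sub_right] at this
      rw [Real.coe_nnabs, abs_mul, mul_assoc]
      refine mul_le_mul_of_nonneg_left ?_ (abs_nonneg _)
      simpa using this)
    (hφi.mul_const _)
    (by
      have hae : ∀ᵐ t : Vec p, DifferentiableAt ℝ f t := hf.ae_differentiableAt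
      have := (quasiMeasurePreserving_sub_left volume x).ae hae
      filter_upwards [this] with t ht
      have h2 : HasFDerivAt (fun y => f (y - t)) (fderiv ℝ f (x - t)) x := by
        have h3 : HasFDerivAt (fun y : Vec p => y - t) (ContinuousLinearMap.id ℝ _) x :=
          (hasFDerivAt_id x).sub_const t
        exact ht.hasFDerivAt.comp x h3
      exact h2.const_mul (φ t))
  have hfun : mollify m f = fun y => ∫ t, φ t * f (y - t) := funext fun y => h f y
  rw [h, hfun]
  unfold pd
  rw [key.2.fderiv, ContinuousLinearMap.integral_apply key.1]
  rfl

theorem tendsto_mollify_ae {p : ℕ} {f : Vec p → ℝ} (hf : LocallyIntegrable f) :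
    ∀ᵐ x, Filter.Tendsto (fun m => mollify m f x) Filter.atTop (nhds (f x)) := by
  refine ContDiffBump.ae_convolution_tendsto_right_of_locallyIntegrable (K := 2) ?_ ?_ hf
  · have h := (tendsto_const_div_atTop_nhds_zero_nat (2 : ℝ)).comp
      (Filter.tendsto_add_atTop_nat 1)
    refine h.congr fun m => ?_
    simp [mollBump]
  · refine Filter.Eventually.of_forall fun m => ?_
    change (2 : ℝ) / (m + 1) ≤ 2 * (1 / (m + 1))
    rw [mul_one_div]

theorem sum_mul_swap_le {ι : Type*} [Fintype ι] (a : ι → ι → ℝ) :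
    ∑ j, ∑ k, a j k * a k j ≤ ∑ j, ∑ k, a j k ^ 2 := by
  have h : ∑ j, ∑ k, a j k * a k j ≤ ∑ j, ∑ k, (a j k ^ 2 / 2 + a k j ^ 2 / 2) :=
    Finset.sum_le_sum fun j _ => Finset.sum_le_sum fun k _ => by
      nlinarith [sq_nonneg (a j k - a k j)]
  refine h.trans (le_of_eq ?_)
  simp_rw [Finset.sum_add_distrib]
  rw [Finset.sum_comm (f := fun j k => a k j ^ 2 / 2)]
  simp_rw [← Finset.sum_div]
  ring

/-- The second-order Stein inequality for smooth fields: in the Skorohod isometry, the product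
`∂ₖfⱼ ∂ⱼfₖ` is bounded by squares. -/
theorem lintegral_skorohod_sq_le_of_contDiff {p : ℕ} {f : Fin p → Vec p → ℝ}
    (hf : ∀ j, ContDiff ℝ 2 (f j)) (hc : ∀ j, HasCompactSupport (f j)) :
    ∫⁻ x, ENNReal.ofReal (skorohod f x ^ 2) ∂stdGaussian (Vec p)
      ≤ ENNReal.ofReal
        (∫ x, (∑ j, f j x ^ 2 + ∑ j, ∑ k, pd k (f j) x ^ 2) ∂stdGaussian (Vec p)) := by
  have hsc : HasCompactSupport (skorohod f) := by
    have hz : ∀ s : Finset (Fin p),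
        HasCompactSupport fun x => ∑ j ∈ s, (x j * f j x - pd j (f j) x) := by
      intro s
      induction s using Finset.induction_on with
      | empty =>
        simp only [Finset.sum_empty]
        exact HasCompactSupport.zero (α := Vec p) (β := ℝ)
      | insert a s ha ih =>
        simp_rw [Finset.sum_insert ha]
        exact ((hc a).mul_left.sub (hasCompactSupport_pd (hc a) a)).add ih
    exact hz _
  have hcs := (contDiff_skorohod hf).continuous
  have hpdc : ∀ j k, Continuous (pd k (f j)) := fun j k =>
    (contDiff_pd (hf j) (m := 1) (by norm_num) k).continuous
  rw [← ofReal_integral_eq_lintegral_ofReal _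
    (Filter.Eventually.of_forall fun x => sq_nonneg _), integral_skorohod_sq hf hc]
  · refine ENNReal.ofReal_le_ofReal (integral_mono ?_ ?_ fun x => ?_)
    · refine (integrable_finsetSum _ fun j _ => ?_).add (integrable_finsetSum _ fun j _ =>
        integrable_finsetSum _ fun k _ => ?_)
      · simp_rw [sq]
        exact integrable_stdGaussian_of_hasCompactSupport
          ((hf j).continuous.mul (hf j).continuous) (hc j).mul_right
      · exact integrable_stdGaussian_of_hasCompactSupport
          ((hpdc j k).mul (hpdc k j)) (hasCompactSupport_pd (hc j) k).mul_right
    · refine (integrable_finsetSum _ fun j _ => ?_).add (integrable_finsetSum _ fun j _ =>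
        integrable_finsetSum _ fun k _ => ?_)
      · simp_rw [sq]
        exact integrable_stdGaussian_of_hasCompactSupport
          ((hf j).continuous.mul (hf j).continuous) (hc j).mul_right
      · simp_rw [sq]
        exact integrable_stdGaussian_of_hasCompactSupport
          ((hpdc j k).mul (hpdc j k)) (hasCompactSupport_pd (hc j) k).mul_right
    · exact add_le_add le_rfl (sum_mul_swap_le fun j k => pd k (f j) x)
  · simp_rw [sq]
    exact integrable_stdGaussian_of_hasCompactSupport (hcs.mul hcs) hsc.mul_right

/-- The second-order Stein inequality for compactly supported Lipschitz fields, by mollification: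
the right side converges by dominated convergence, the left side is handled by Fatou's lemma. -/
theorem lintegral_skorohod_sq_le_of_lipschitz {p : ℕ} {f : Fin p → Vec p → ℝ} {C : NNReal}
    (hf : ∀ j, LipschitzWith C (f j)) (hc : ∀ j, HasCompactSupport (f j)) :
    ∫⁻ x, ENNReal.ofReal (skorohod f x ^ 2) ∂stdGaussian (Vec p)
      ≤ ∫⁻ x, ENNReal.ofReal (∑ j, f j x ^ 2 + ∑ j, ∑ k, pd k (f j) x ^ 2)
          ∂stdGaussian (Vec p) := by
  have hbd : ∃ M : ℝ, ∀ j x, |f j x| ≤ M := by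
    have : ∀ j, ∃ M : ℝ, ∀ x, |f j x| ≤ M := fun j =>
      (hc j).exists_bound_of_continuous (hf j).continuous
    choose M hM using this
    exact ⟨∑ j, |M j|, fun j x => (hM j x).trans ((le_abs_self _).trans
      (Finset.single_le_sum (f := fun j => |M j|) (fun _ _ => abs_nonneg _) (Finset.mem_univ j)))⟩
  obtain ⟨M, hM⟩ := hbd
  have hli : ∀ j, LocallyIntegrable (f j) := fun j => (hf j).continuous.locallyIntegrable
  have hlip : ∀ j k, LocallyIntegrable (pd k (f j)) := fun j k => by
    refine (locallyIntegrable_const (C : ℝ)).mono (measurable_pd k (f j)).aestronglyMeasurable ?_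
    refine Filter.Eventually.of_forall fun x => ?_
    simpa using abs_pd_le k (hf j) x
  have hac := stdGaussian_absolutelyContinuous p
  have t1 : ∀ᵐ x ∂stdGaussian (Vec p), ∀ j,
      Filter.Tendsto (fun m => mollify m (f j) x) Filter.atTop (nhds (f j x)) :=
    ae_all_iff.2 fun j => hac.ae_le (tendsto_mollify_ae (hli j))
  have t2 : ∀ᵐ x ∂stdGaussian (Vec p), ∀ j k, Filter.Tendsto (fun m => pd k (mollify m (f j)) x)
      Filter.atTop (nhds (pd k (f j) x)) :=
    ae_all_iff.2 fun j => ae_all_iff.2 fun k => by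
      simp_rw [fun m => pd_mollify m (hf j) k]
      exact hac.ae_le (tendsto_mollify_ae (hlip j k))
  have hcd : ∀ m j, ContDiff ℝ 2 (mollify m (f j)) := fun m j => contDiff_mollify m (hli j)
  have hF : Filter.Tendsto (fun m => ∫ x, (∑ j, mollify m (f j) x ^ 2
      + ∑ j, ∑ k, pd k (mollify m (f j)) x ^ 2) ∂stdGaussian (Vec p)) Filter.atTop
      (nhds (∫ x, (∑ j, f j x ^ 2 + ∑ j, ∑ k, pd k (f j) x ^ 2) ∂stdGaussian (Vec p))) := by
    refine tendsto_integral_of_dominated_convergence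
      (fun _ => ∑ _j : Fin p, M ^ 2 + ∑ _j : Fin p, ∑ _k : Fin p, (C : ℝ) ^ 2) ?_
      (integrable_const _) ?_ ?_
    · intro m
      refine Measurable.aestronglyMeasurable ?_
      refine (Finset.measurable_sum _ fun j _ => ?_).add (Finset.measurable_sum _ fun j _ =>
        Finset.measurable_sum _ fun k _ => ?_)
      · exact ((hcd m j).continuous.measurable).pow_const 2
      · exact (measurable_pd _ _).pow_const 2
    · intro m
      refine Filter.Eventually.of_forall fun x => ?_
      rw [Real.norm_eq_abs, abs_of_nonneg (by positivity)]
      refine add_le_add (Finset.sum_le_sum fun j _ => ?_) (Finset.sum_le_sum fun j _ =>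
        Finset.sum_le_sum fun k _ => ?_)
      · exact sq_le_sq' (abs_le.1 (abs_mollify_le m (hM j) x)).1
          (abs_le.1 (abs_mollify_le m (hM j) x)).2
      · rw [pd_mollify m (hf j)]
        have := abs_mollify_le m (fun x => abs_pd_le k (hf j) x) x
        exact sq_le_sq' (abs_le.1 this).1 (abs_le.1 this).2
    · filter_upwards [t1, t2] with x h1 h2
      exact (tendsto_finsetSum _ fun j _ => (h1 j).pow 2).add (tendsto_finsetSum _ fun j _ =>
        tendsto_finsetSum _ fun k _ => (h2 j k).pow 2)
  have hint : Integrable (fun x => ∑ j, f j x ^ 2 + ∑ j, ∑ k, pd k (f j) x ^ 2)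
      (stdGaussian (Vec p)) := by
    refine Integrable.mono' (integrable_const
      (∑ _j : Fin p, M ^ 2 + ∑ _j : Fin p, ∑ _k : Fin p, (C : ℝ) ^ 2)) ?_ ?_
    · refine Measurable.aestronglyMeasurable ?_
      refine (Finset.measurable_sum _ fun j _ => ?_).add (Finset.measurable_sum _ fun j _ =>
        Finset.measurable_sum _ fun k _ => ?_)
      · exact ((hf j).continuous.measurable).pow_const 2
      · exact (measurable_pd _ _).pow_const 2
    · refine Filter.Eventually.of_forall fun x => ?_
      rw [Real.norm_eq_abs, abs_of_nonneg (by positivity)]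
      refine add_le_add (Finset.sum_le_sum fun j _ => ?_) (Finset.sum_le_sum fun j _ =>
        Finset.sum_le_sum fun k _ => ?_)
      · exact sq_le_sq' (abs_le.1 (hM j x)).1 (abs_le.1 (hM j x)).2
      · have := abs_pd_le k (hf j) x
        exact sq_le_sq' (abs_le.1 this).1 (abs_le.1 this).2
  rw [← ofReal_integral_eq_lintegral_ofReal hint
    (Filter.Eventually.of_forall fun x => by positivity)]
  have hlim : ∀ᵐ x ∂stdGaussian (Vec p), ENNReal.ofReal (skorohod f x ^ 2)
      = Filter.liminf (fun m => ENNReal.ofReal (skorohod (fun j => mollify m (f j)) x ^ 2))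
        Filter.atTop := by
    filter_upwards [t1, t2] with x h1 h2
    refine (Filter.Tendsto.liminf_eq ?_).symm
    refine ENNReal.tendsto_ofReal (Filter.Tendsto.pow ?_ 2)
    exact tendsto_finsetSum _ fun j _ => ((h1 j).const_mul _).sub (h2 j j)
  rw [lintegral_congr_ae hlim]
  refine (lintegral_liminf_le fun m => ?_).trans ?_
  · refine ENNReal.measurable_ofReal.comp ?_
    exact ((contDiff_skorohod (hcd m)).continuous.measurable).pow_const 2
  · refine (Filter.liminf_le_liminf (Filter.Eventually.of_forall fun m =>
      lintegral_skorohod_sq_le_of_contDiff (hcd m)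
        (fun j => hasCompactSupport_mollify m (hc j)))).trans ?_
    exact (ENNReal.tendsto_ofReal hF).liminf_eq.le

/-- A cutoff function, equal to `1` on the ball of radius `R` and to `0` outside the ball of
radius `2 R`. -/
noncomputable def cutoff {p : ℕ} (R : ℝ) (x : Vec p) : ℝ := max 0 (min 1 (2 - ‖x‖ / R))

theorem cutoff_nonneg {p : ℕ} (R : ℝ) (x : Vec p) : 0 ≤ cutoff R x := le_max_left _ _

theorem cutoff_le_one {p : ℕ} (R : ℝ) (x : Vec p) : cutoff R x ≤ 1 :=
  max_le zero_le_one (min_le_left _ _)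

theorem cutoff_eq_one {p : ℕ} {R : ℝ} (hR : 0 < R) {x : Vec p} (hx : ‖x‖ ≤ R) :
    cutoff R x = 1 := by
  have : ‖x‖ / R ≤ 1 := (div_le_one hR).2 hx
  rw [cutoff, min_eq_left (by linarith), max_eq_right zero_le_one]

theorem cutoff_eq_zero {p : ℕ} {R : ℝ} (hR : 0 < R) {x : Vec p} (hx : 2 * R ≤ ‖x‖) :
    cutoff R x = 0 := by
  have : 2 ≤ ‖x‖ / R := (le_div_iff₀ hR).2 hx
  rw [cutoff, max_eq_left ((min_le_right _ _).trans (by linarith))]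

theorem lipschitzWith_cutoff {p : ℕ} {R : ℝ} (hR : 1 ≤ R) :
    LipschitzWith (Real.toNNReal (1 / R)) (cutoff (p := p) R) := by
  have hR0 : 0 < R := by linarith
  have h1 : LipschitzWith (Real.toNNReal (1 / R)) fun x : Vec p => 2 - ‖x‖ / R := by
    refine LipschitzWith.of_dist_le_mul fun x y => ?_
    rw [Real.dist_eq, Real.coe_toNNReal _ (by positivity), dist_eq_norm]
    have : 2 - ‖x‖ / R - (2 - ‖y‖ / R) = (1 / R) * (‖y‖ - ‖x‖) := by ring
    rw [this, abs_mul, abs_of_nonneg (by positivity : (0 : ℝ) ≤ 1 / R)]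
    gcongr
    rw [abs_sub_comm]
    exact abs_norm_sub_norm_le x y
  exact (h1.const_min 1).const_max 0

theorem hasCompactSupport_mul_cutoff {p : ℕ} {R : ℝ} (hR : 1 ≤ R) (f : Vec p → ℝ) :
    HasCompactSupport fun x => cutoff R x * f x := by
  refine HasCompactSupport.of_support_subset_isCompact
    (isCompact_closedBall (0 : Vec p) (2 * R)) fun x hx => ?_
  rw [mem_closedBall_zero_iff]
  by_contra h
  exact hx (by simp [cutoff_eq_zero (by linarith : (0 : ℝ) < R) (not_le.1 h).le])

/-- Multiplying by a cutoff turns a locally Lipschitz function into a globally Lipschitz one. -/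
theorem exists_lipschitzWith_mul_cutoff {p : ℕ} {R : ℝ} (hR : 1 ≤ R) {f : Vec p → ℝ} {C : NNReal}
    (hf : LipschitzOnWith C f (Metric.closedBall 0 (2 * R))) :
    ∃ C' : NNReal, LipschitzWith C' fun x => cutoff R x * f x := by
  have hR0 : 0 < R := by linarith
  obtain ⟨M, hM⟩ := (isCompact_closedBall (0 : Vec p) (2 * R)).exists_bound_of_continuousOn
    hf.continuousOn
  have hM0 : 0 ≤ M := (norm_nonneg _).trans (hM 0 (by simp; linarith))
  refine ⟨C + Real.toNNReal M, LipschitzWith.of_dist_le_mul ?_⟩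
  have hχ : ∀ x y : Vec p, |cutoff R x - cutoff R y| ≤ ‖x - y‖ := fun x y => by
    have := (lipschitzWith_cutoff (p := p) hR).dist_le_mul x y
    rw [Real.dist_eq, Real.coe_toNNReal _ (by positivity), dist_eq_norm] at this
    refine this.trans (mul_le_of_le_one_left (norm_nonneg _) ?_)
    rw [div_le_one hR0]
    exact hR
  have main : ∀ x y : Vec p, ‖x‖ ≤ 2 * R →
      |cutoff R x * f x - cutoff R y * f y| ≤ (C + M) * ‖x - y‖ := by
    intro x y hx
    have hfx := hM x (by simpa using hx)
    rw [Real.norm_eq_abs] at hfx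
    by_cases hy : ‖y‖ ≤ 2 * R
    · have h1 : cutoff R x * f x - cutoff R y * f y
          = (cutoff R x - cutoff R y) * f x + cutoff R y * (f x - f y) := by ring
      have h2 := hf.dist_le_mul x (by simpa using hx) y (by simpa using hy)
      rw [Real.dist_eq, dist_eq_norm] at h2
      rw [h1]
      refine (abs_add_le _ _).trans ?_
      rw [abs_mul, abs_mul, abs_of_nonneg (cutoff_nonneg R y)]
      have h3 : |cutoff R x - cutoff R y| * |f x| ≤ ‖x - y‖ * M :=
        mul_le_mul (hχ x y) hfx (abs_nonneg _) (norm_nonneg _)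
      have h4 : cutoff R y * |f x - f y| ≤ 1 * (C * ‖x - y‖) :=
        mul_le_mul (cutoff_le_one R y) h2 (abs_nonneg _) zero_le_one
      linarith
    · have h0 := cutoff_eq_zero hR0 (not_le.1 hy).le
      have h3 : |cutoff R x - cutoff R y| * |f x| ≤ ‖x - y‖ * M :=
        mul_le_mul (hχ x y) hfx (abs_nonneg _) (norm_nonneg _)
      rw [h0, sub_zero] at h3
      rw [h0, zero_mul, sub_zero, abs_mul]
      nlinarith [mul_nonneg C.coe_nonneg (norm_nonneg (x - y))]
  intro x y
  rw [Real.dist_eq, dist_eq_norm, NNReal.coe_add, Real.coe_toNNReal _ hM0]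
  by_cases hx : ‖x‖ ≤ 2 * R
  · exact main x y hx
  · by_cases hy : ‖y‖ ≤ 2 * R
    · rw [abs_sub_comm, norm_sub_rev]
      exact main y x hy
    · rw [cutoff_eq_zero hR0 (not_le.1 hx).le, cutoff_eq_zero hR0 (not_le.1 hy).le]
      simp
      positivity

theorem pd_congr {p : ℕ} {f g : Vec p → ℝ} {x : Vec p} (h : f =ᶠ[nhds x] g) (k : Fin p) :
    pd k f x = pd k g x := by
  rw [pd, h.fderiv_eq, pd]

/-- **Second-order Stein inequality**: for a vector field `f` on `ℝᵖ` that is Lipschitz on bounded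
sets and a standard Gaussian vector `z`,
`E (zᵀ f(z) - div f(z))² ≤ 3 E ‖f(z)‖² + 2 E ‖∇f(z)‖²`. -/
theorem lintegral_skorohod_sq_le {p : ℕ} {f : Fin p → Vec p → ℝ}
    (hf : ∀ j (R : ℝ), ∃ C : NNReal, LipschitzOnWith C (f j) (Metric.closedBall 0 R)) :
    ∫⁻ x, ENNReal.ofReal (skorohod f x ^ 2) ∂stdGaussian (Vec p)
      ≤ ∫⁻ x, ENNReal.ofReal (3 * ∑ j, f j x ^ 2 + 2 * ∑ j, ∑ k, pd k (f j) x ^ 2)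
          ∂stdGaussian (Vec p) := by
  -- the radius `m + p + 1` makes the squared gradient of the cutoff at most one
  set R : ℕ → ℝ := fun m => (m : ℝ) + p + 1 with hRdef
  have hR1 : ∀ m, 1 ≤ R m := fun m => by
    have h1 : (0 : ℝ) ≤ m := m.cast_nonneg
    have h2 : (0 : ℝ) ≤ p := p.cast_nonneg
    simp only [hRdef]
    linarith
  set F : ℕ → Fin p → Vec p → ℝ := fun m j x => cutoff (R m) x * f j x with hF
  have hlip : ∀ m, ∃ C : NNReal, ∀ j, LipschitzWith C (F m j) := fun m => by
    have : ∀ j, ∃ C : NNReal, LipschitzWith C (F m j) := fun j => by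
      obtain ⟨C, hC⟩ := hf j (2 * R m)
      exact exists_lipschitzWith_mul_cutoff (hR1 m) hC
    choose C hC using this
    exact ⟨∑ j, C j, fun j => (hC j).weaken
      (Finset.single_le_sum (fun _ _ => zero_le) (Finset.mem_univ j))⟩
  -- inside the ball of radius `2 R m` the product rule applies; outside it the field vanishes
  have hFm : ∀ m, ∫⁻ x, ENNReal.ofReal (skorohod (F m) x ^ 2) ∂stdGaussian (Vec p)
      ≤ ∫⁻ x, ENNReal.ofReal (3 * ∑ j, f j x ^ 2 + 2 * ∑ j, ∑ k, pd k (f j) x ^ 2)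
          ∂stdGaussian (Vec p) := by
    intro m
    obtain ⟨C, hC⟩ := hlip m
    refine (lintegral_skorohod_sq_le_of_lipschitz hC
      (fun j => hasCompactSupport_mul_cutoff (hR1 m) (f j))).trans ?_
    refine lintegral_mono_ae ?_
    have hχd : ∀ᵐ x ∂stdGaussian (Vec p), DifferentiableAt ℝ (cutoff (p := p) (R m)) x :=
      (stdGaussian_absolutelyContinuous p).ae_le (lipschitzWith_cutoff (hR1 m)).ae_differentiableAt
    have hfd : ∀ᵐ x ∂stdGaussian (Vec p), ‖x‖ < 2 * R m → ∀ j, DifferentiableAt ℝ (f j) x := by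
      refine (stdGaussian_absolutelyContinuous p).ae_le ?_
      have : ∀ j, ∀ᵐ x : Vec p, ‖x‖ < 2 * R m → DifferentiableAt ℝ (f j) x := fun j => by
        obtain ⟨C, hC⟩ := hf j (2 * R m)
        filter_upwards [hC.ae_differentiableWithinAt_of_mem] with x hx hlt
        refine (hx (by simpa using hlt.le)).differentiableAt ?_
        exact Filter.mem_of_superset (Metric.isOpen_ball.mem_nhds (by simpa using hlt))
          Metric.ball_subset_closedBall
      filter_upwards [ae_all_iff.2 this] with x hx hlt j using hx j hlt
    have hout : ∀ᵐ x ∂stdGaussian (Vec p), ‖x‖ ≠ 2 * R m := by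
      refine (stdGaussian_absolutelyContinuous p).ae_le ?_
      have := Measure.addHaar_sphere_of_ne_zero (volume : Measure (Vec p)) 0
        (r := 2 * R m) (by linarith [hR1 m])
      change volume {x : Vec p | ‖x‖ ≠ 2 * R m}ᶜ = 0
      convert this using 2
      ext x
      simp
    filter_upwards [hχd, hfd, hout] with x h1 h2 h3
    refine ENNReal.ofReal_le_ofReal ?_
    have hb : ∀ j k, pd k (F m j) x ^ 2 ≤ 2 * pd k (f j) x ^ 2 + 2 * (f j x ^ 2 * (1 / R m) ^ 2) := by
      intro j k
      rcases lt_or_gt_of_ne h3 with hlt | hgt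
      · rw [pd_mul h1 (h2 hlt j)]
        have hc := abs_pd_le k (lipschitzWith_cutoff (p := p) (hR1 m)) x
        rw [Real.coe_toNNReal _ (by have := hR1 m; positivity)] at hc
        have hc2 : pd k (cutoff (R m)) x ^ 2 ≤ (1 / R m) ^ 2 := sq_le_sq' (abs_le.1 hc).1 (abs_le.1 hc).2
        have h01 : cutoff (R m) x ^ 2 ≤ 1 := by
          nlinarith [cutoff_nonneg (R m) x, cutoff_le_one (R m) x]
        have e1 := mul_le_mul_of_nonneg_right h01 (sq_nonneg (pd k (f j) x))
        have e2 := mul_le_mul_of_nonneg_left hc2 (sq_nonneg (f j x))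
        nlinarith [sq_nonneg (cutoff (R m) x * pd k (f j) x - f j x * pd k (cutoff (R m)) x)]
      · have : F m j =ᶠ[nhds x] fun _ => 0 := by
          filter_upwards [(continuous_norm.isOpen_preimage _ isOpen_Ioi).mem_nhds hgt] with y hy
          simp only [hF]
          rw [cutoff_eq_zero (by linarith [hR1 m]) (le_of_lt hy), zero_mul]
        rw [pd_congr this]
        have h0 : pd k (fun _ : Vec p => (0 : ℝ)) x = 0 := by simp [pd]
        rw [h0, zero_pow two_ne_zero]
        positivity
    have hsum : ∑ j, F m j x ^ 2 ≤ ∑ j, f j x ^ 2 := Finset.sum_le_sum fun j _ => by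
      simp only [hF, mul_pow]
      refine mul_le_of_le_one_left (sq_nonneg _) ?_
      nlinarith [cutoff_nonneg (R m) x, cutoff_le_one (R m) x]
    have hsum2 : ∑ j, ∑ k, pd k (F m j) x ^ 2
        ≤ 2 * ∑ j, ∑ k, pd k (f j) x ^ 2 + 2 * ∑ j, f j x ^ 2 := by
      refine (Finset.sum_le_sum fun j _ => Finset.sum_le_sum fun k _ => hb j k).trans ?_
      simp_rw [Finset.sum_add_distrib, ← Finset.mul_sum]
      gcongr with j
      rw [Finset.sum_const, Finset.card_univ, Fintype.card_fin, nsmul_eq_mul]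
      have hp : (p : ℝ) * (1 / R m) ^ 2 ≤ 1 := by
        rw [div_pow, one_pow, mul_one_div, div_le_one (by have := hR1 m; positivity)]
        have : (p : ℝ) ≤ R m := by
          have h1 : (0 : ℝ) ≤ m := m.cast_nonneg
          simp only [hRdef]
          linarith
        nlinarith [hR1 m]
      nlinarith [sq_nonneg (f j x)]
    linarith
  -- near a given point the cutoff is eventually equal to one
  have hlim : ∀ x, Filter.Tendsto (fun m => ENNReal.ofReal (skorohod (F m) x ^ 2)) Filter.atTop
      (nhds (ENNReal.ofReal (skorohod f x ^ 2))) := by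
    intro x
    refine tendsto_const_nhds.congr' ?_
    obtain ⟨N, hN⟩ := exists_nat_gt ‖x‖
    filter_upwards [Filter.eventually_ge_atTop N] with m hm
    have hxm : ‖x‖ < R m := by
      have : (N : ℝ) ≤ m := by exact_mod_cast hm
      have h2 : (0 : ℝ) ≤ p := p.cast_nonneg
      simp only [hRdef]
      linarith
    have hev : ∀ j, F m j =ᶠ[nhds x] f j := fun j => by
      filter_upwards [(continuous_norm.isOpen_preimage _ isOpen_Iio).mem_nhds hxm] with y hy
      simp only [hF]
      rw [cutoff_eq_one (by linarith [hR1 m]) (le_of_lt hy), one_mul]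
    unfold skorohod
    simp_rw [fun j => pd_congr (hev j) j, fun j => (hev j).eq_of_nhds]
  have hmeas : ∀ m, Measurable fun x => ENNReal.ofReal (skorohod (F m) x ^ 2) := by
    intro m
    obtain ⟨C, hC⟩ := hlip m
    refine ENNReal.measurable_ofReal.comp (Measurable.pow_const ?_ 2)
    refine Finset.measurable_sum _ fun j _ => ?_
    exact (((contDiff_coord (m := 0) j).continuous.measurable).mul
      (hC j).continuous.measurable).sub (measurable_pd _ _)
  calc ∫⁻ x, ENNReal.ofReal (skorohod f x ^ 2) ∂stdGaussian (Vec p)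
      = ∫⁻ x, Filter.liminf (fun m => ENNReal.ofReal (skorohod (F m) x ^ 2)) Filter.atTop
          ∂stdGaussian (Vec p) := by simp_rw [fun x => (hlim x).liminf_eq]
    _ ≤ Filter.liminf (fun m => ∫⁻ x, ENNReal.ofReal (skorohod (F m) x ^ 2)
          ∂stdGaussian (Vec p)) Filter.atTop := lintegral_liminf_le hmeas
    _ ≤ _ := (Filter.liminf_le_liminf (Filter.Eventually.of_forall hFm)).trans (by simp)

/-! ### The estimator under an isotropic strongly convex penalty -/

/-- A loss and a penalty satisfying the standing assumptions after whitening: the covariance is the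
identity, so that the penalty is `μ`-strongly convex for the Euclidean norm. -/
structure IsotropicProblem {p : ℕ} (μ : ℝ) (ρ : ℝ → ℝ) (g : Vec p → ℝ) : Prop where
  mu_pos : 0 < μ
  loss_convex : ConvexOn ℝ Set.univ ρ
  loss_min : ∀ u, u ≠ 0 → ρ 0 < ρ u
  loss_contDiff : ContDiff ℝ 1 ρ
  loss_lipschitz : LipschitzWith 1 (deriv ρ)
  penalty_convex : StrongConvexOn Set.univ μ g

/-- The components `ψ(r_i)` of the score at the estimator. -/
noncomputable def score {n p : ℕ} (ρ : ℝ → ℝ) (g : Vec p → ℝ) (e : Vec n) (G : Design n p)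
    (i : Fin n) : ℝ :=
  deriv ρ (residual ρ g e G i)

theorem residual_apply {n p : ℕ} (ρ : ℝ → ℝ) (g : Vec p → ℝ) (e : Vec n) (G : Design n p)
    (i : Fin n) : residual ρ g e G i = e i - inner ℝ (G i) (mEstimator ρ g e G) := rfl

theorem objective_eq {n p : ℕ} (ρ : ℝ → ℝ) (g : Vec p → ℝ) (e : Vec n) (G : Design n p)
    (b : Vec p) :
    objective ρ g e G b = (1 / (n : ℝ)) * ∑ i, ρ (e i - inner ℝ (G i) b) + g b := rfl

namespace IsotropicProblem

variable {p : ℕ} {μ : ℝ} {ρ : ℝ → ℝ} {g : Vec p → ℝ}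

theorem differentiableAt_loss (H : IsotropicProblem μ ρ g) (u : ℝ) : DifferentiableAt ℝ ρ u :=
  H.loss_contDiff.differentiable (by norm_num) u

theorem monotone_deriv (H : IsotropicProblem μ ρ g) : Monotone (deriv ρ) := by
  have := H.loss_convex.monotoneOn_deriv fun x _ => H.differentiableAt_loss x
  exact monotoneOn_univ.1 this

theorem tangent_le (H : IsotropicProblem μ ρ g) (a b : ℝ) : ρ a + deriv ρ a * (b - a) ≤ ρ b := by
  rcases lt_trichotomy a b with h | h | h
  · have := H.loss_convex.le_slope_of_hasDerivAt (Set.mem_univ a) (Set.mem_univ b) h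
      (H.differentiableAt_loss a).hasDerivAt
    rw [slope_def_field, le_div_iff₀ (by linarith)] at this
    linarith
  · subst h; simp
  · have := H.loss_convex.slope_le_of_hasDerivAt (Set.mem_univ b) (Set.mem_univ a) h
      (H.differentiableAt_loss a).hasDerivAt
    rw [slope_def_field, div_le_iff₀ (by linarith)] at this
    linarith

theorem deriv_zero (H : IsotropicProblem μ ρ g) : deriv ρ 0 = 0 := by
  refine IsLocalMin.deriv_eq_zero (Filter.Eventually.of_forall fun u => ?_)
  by_cases h : u = 0
  · rw [h]
  · exact (H.loss_min u h).le

theorem deriv_eq_zero_iff (H : IsotropicProblem μ ρ g) {u : ℝ} : deriv ρ u = 0 ↔ u = 0 := by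
  refine ⟨fun h => ?_, fun h => h ▸ H.deriv_zero⟩
  by_contra hu
  have h1 := H.tangent_le u 0
  have h2 := H.loss_min u hu
  rw [h, zero_mul, add_zero] at h1
  linarith

theorem abs_deriv_sub_le (H : IsotropicProblem μ ρ g) (a b : ℝ) :
    |deriv ρ a - deriv ρ b| ≤ |a - b| := by
  simpa [Real.dist_eq] using H.loss_lipschitz.dist_le_mul a b

theorem abs_deriv_le (H : IsotropicProblem μ ρ g) (a : ℝ) : |deriv ρ a| ≤ |a| := by
  simpa [H.deriv_zero] using H.abs_deriv_sub_le a 0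

theorem sq_deriv_sub_le (H : IsotropicProblem μ ρ g) (a b : ℝ) :
    (deriv ρ a - deriv ρ b) ^ 2 ≤ (a - b) * (deriv ρ a - deriv ρ b) := by
  have h1 := H.abs_deriv_sub_le a b
  rcases le_total a b with h | h
  · have h2 := H.monotone_deriv h
    rw [abs_of_nonpos (by linarith), abs_of_nonpos (by linarith)] at h1
    nlinarith
  · have h2 := H.monotone_deriv h
    rw [abs_of_nonneg (by linarith), abs_of_nonneg (by linarith)] at h1
    nlinarith

theorem deriv_deriv_nonneg (H : IsotropicProblem μ ρ g) (u : ℝ) : 0 ≤ deriv (deriv ρ) u :=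
  H.monotone_deriv.deriv_nonneg

/-- The penalty is bounded below by a quadratic function, hence the objective is coercive. -/
theorem exists_minimizer (H : IsotropicProblem μ ρ g) {n : ℕ} (e : Vec n) (G : Design n p) :
    ∃ b, ∀ b', objective ρ g e G b ≤ objective ρ g e G b' := by
  have hμ := H.mu_pos
  set k : Vec p → ℝ := fun b => g b - μ / 2 * ‖b‖ ^ 2 with hk
  have hkc : ConvexOn ℝ Set.univ k := strongConvexOn_iff_convex.1 H.penalty_convex
  have hkcont : Continuous k := hkc.locallyLipschitz.continuous
  have hgk : ∀ b, g b = k b + μ / 2 * ‖b‖ ^ 2 := fun b => by simp [hk]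
  have hgc : Continuous g := by
    have : g = fun b => k b + μ / 2 * ‖b‖ ^ 2 := funext hgk
    rw [this]
    fun_prop
  obtain ⟨M, hM⟩ := (isCompact_closedBall (0 : Vec p) 1).exists_bound_of_continuousOn
    hkcont.continuousOn
  have hM0 : 0 ≤ M := (norm_nonneg _).trans (hM 0 (by simp))
  -- convexity on rays from the origin gives a lower bound that is linear in the norm
  have hlow : ∀ b, -(3 * M) - 2 * M * ‖b‖ ≤ k b := by
    intro b
    by_cases hb : ‖b‖ ≤ 1
    · have h1 := (abs_le.1 (hM b (by simpa using hb))).1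
      nlinarith [mul_nonneg hM0 (norm_nonneg b)]
    · rw [not_le] at hb
      have hb0 : 0 < ‖b‖ := by linarith
      have hinv : ‖b‖⁻¹ ≤ 1 := inv_le_one_of_one_le₀ hb.le
      have h1 := hkc.2 (Set.mem_univ (0 : Vec p)) (Set.mem_univ b)
        (show 0 ≤ 1 - ‖b‖⁻¹ by linarith) (show 0 ≤ ‖b‖⁻¹ by positivity) (by ring)
      rw [smul_zero, zero_add, smul_eq_mul, smul_eq_mul] at h1
      have h2 := (abs_le.1 (hM (‖b‖⁻¹ • b) (by simp [norm_smul, hb0.ne']))).1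
      have h3 := (abs_le.1 (hM 0 (by simp))).2
      have h4 := mul_le_mul_of_nonneg_left (h2.trans h1) hb0.le
      have h5 : ‖b‖ * ((1 - ‖b‖⁻¹) * k 0 + ‖b‖⁻¹ * k b) = (‖b‖ - 1) * k 0 + k b := by
        field_simp
      rw [h5] at h4
      nlinarith
  have hcont : Continuous (objective ρ g e G) := by
    have hρ := H.loss_contDiff.continuous
    have : objective ρ g e G
      = fun b => (1 / (n : ℝ)) * ∑ i, ρ (e i - inner ℝ (G i) b) + g b := rfl
    rw [this]
    fun_prop
  refine hcont.exists_forall_le ?_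
  have hmin : ∀ u, ρ 0 ≤ ρ u := fun u => by
    by_cases h : u = 0
    · rw [h]
    · exact (H.loss_min u h).le
  have hobj : ∀ b, (1 / (n : ℝ)) * (n * ρ 0) - 3 * M + ‖b‖ * (μ / 2 * ‖b‖ - 2 * M)
      ≤ objective ρ g e G b := by
    intro b
    rw [objective_eq, hgk]
    have h1 : (n : ℝ) * ρ 0 ≤ ∑ i, ρ (e i - inner ℝ (G i) b) := by
      have := Finset.card_nsmul_le_sum Finset.univ (fun i => ρ (e i - inner ℝ (G i) b)) (ρ 0)
        fun i _ => hmin _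
      simpa using this
    have h2 := mul_le_mul_of_nonneg_left h1 (by positivity : (0 : ℝ) ≤ 1 / n)
    nlinarith [hlow b]
  refine Filter.tendsto_atTop_mono hobj ?_
  refine Filter.tendsto_atTop_add_const_left _ _ ?_
  have hn := tendsto_norm_cocompact_atTop (E := Vec p)
  exact hn.atTop_mul_atTop₀ (Filter.tendsto_atTop_add_const_right _ _
    (hn.const_mul_atTop (by positivity)))

theorem mEstimator_isMin (H : IsotropicProblem μ ρ g) {n : ℕ} (e : Vec n) (G : Design n p)
    (b : Vec p) : objective ρ g e G (mEstimator ρ g e G) ≤ objective ρ g e G b :=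
  Classical.epsilon_spec (H.exists_minimizer e G) b

/-- The first-order condition at a minimizer `h`, in variational form. -/
theorem variational (H : IsotropicProblem μ ρ g) {n : ℕ} (hn : 1 ≤ n) (e : Vec n) (G : Design n p)
    {h : Vec p} (hmin : ∀ b, objective ρ g e G h ≤ objective ρ g e G b) (b : Vec p) :
    ∑ i, deriv ρ (e i - inner ℝ (G i) h) * inner ℝ (G i) (b - h) + n * μ / 2 * ‖b - h‖ ^ 2
      ≤ n * (g b - g h) := by
  have hn0 : (0 : ℝ) < n := by exact_mod_cast hn
  -- the inequality holds with `ψ` evaluated at a point of the segment, at relative position `t`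
  have key : ∀ t : ℝ, 0 < t → t < 1 →
      ∑ i, deriv ρ (e i - inner ℝ (G i) h - t * inner ℝ (G i) (b - h)) * inner ℝ (G i) (b - h)
        + (1 - t) * (n * μ / 2 * ‖b - h‖ ^ 2) ≤ n * (g b - g h) := by
    intro t ht ht1
    have h1 := hmin ((1 - t) • h + t • b)
    rw [objective_eq, objective_eq] at h1
    have h2 := H.penalty_convex.2 (Set.mem_univ h) (Set.mem_univ b)
      (show 0 ≤ 1 - t by linarith) ht.le (by ring)
    simp only [smul_eq_mul] at h2
    rw [norm_sub_rev] at h2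
    have h3 : ∑ i, ρ (e i - inner ℝ (G i) ((1 - t) • h + t • b)) ≤ ∑ i, (ρ (e i - inner ℝ (G i) h)
        - t * (deriv ρ (e i - inner ℝ (G i) h - t * inner ℝ (G i) (b - h))
          * inner ℝ (G i) (b - h))) := by
      refine Finset.sum_le_sum fun i _ => ?_
      have e1 : e i - inner ℝ (G i) ((1 - t) • h + t • b)
          = e i - inner ℝ (G i) h - t * inner ℝ (G i) (b - h) := by
        rw [inner_add_right, inner_smul_right, inner_smul_right, inner_sub_right]; ring
      rw [e1]
      have := H.tangent_le (e i - inner ℝ (G i) h - t * inner ℝ (G i) (b - h))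
        (e i - inner ℝ (G i) h)
      linarith
    rw [Finset.sum_sub_distrib, ← Finset.mul_sum] at h3
    set s := ∑ i, deriv ρ (e i - inner ℝ (G i) h - t * inner ℝ (G i) (b - h))
      * inner ℝ (G i) (b - h)
    have h4 : (n : ℝ) * (1 / n * ∑ i, ρ (e i - inner ℝ (G i) h) + g h)
        = ∑ i, ρ (e i - inner ℝ (G i) h) + n * g h := by field_simp
    have h5 : (n : ℝ) * (1 / n * ∑ i, ρ (e i - inner ℝ (G i) ((1 - t) • h + t • b))
        + g ((1 - t) • h + t • b))
        = ∑ i, ρ (e i - inner ℝ (G i) ((1 - t) • h + t • b)) + n * g ((1 - t) • h + t • b) := by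
      field_simp
    have h6 := mul_le_mul_of_nonneg_left h1 hn0.le
    rw [h4, h5] at h6
    have h7 := mul_le_mul_of_nonneg_left h2 hn0.le
    have h8 : t * (s + (1 - t) * (n * μ / 2 * ‖b - h‖ ^ 2)) ≤ t * (n * (g b - g h)) := by
      nlinarith
    exact le_of_mul_le_mul_left h8 ht
  have hc : Continuous fun t : ℝ =>
      ∑ i, deriv ρ (e i - inner ℝ (G i) h - t * inner ℝ (G i) (b - h)) * inner ℝ (G i) (b - h)
        + (1 - t) * (n * μ / 2 * ‖b - h‖ ^ 2) := by
    have := H.loss_lipschitz.continuous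
    fun_prop
  have ht := (hc.tendsto 0).mono_left (nhdsWithin_le_nhds (s := Set.Ioi 0))
  have hev : ∀ᶠ t : ℝ in nhdsWithin 0 (Set.Ioi 0),
      ∑ i, deriv ρ (e i - inner ℝ (G i) h - t * inner ℝ (G i) (b - h)) * inner ℝ (G i) (b - h)
        + (1 - t) * (n * μ / 2 * ‖b - h‖ ^ 2) ≤ n * (g b - g h) := by
    filter_upwards [Ioo_mem_nhdsGT (zero_lt_one (α := ℝ))] with t ht using key t ht.1 ht.2
  have := le_of_tendsto ht hev
  simpa using this

/-- Comparison of the minimizers of two problems with the same loss and penalty. -/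
theorem compare_of_isMin (H : IsotropicProblem μ ρ g) {n : ℕ} (hn : 1 ≤ n) {e e' : Vec n}
    {G G' : Design n p} {h h' : Vec p} (hmin : ∀ b, objective ρ g e G h ≤ objective ρ g e G b)
    (hmin' : ∀ b, objective ρ g e' G' h' ≤ objective ρ g e' G' b) :
    n * μ * ‖h - h'‖ ^ 2 + ∑ i, ((e i - inner ℝ (G i) h) - (e' i - inner ℝ (G' i) h'))
        * (deriv ρ (e i - inner ℝ (G i) h) - deriv ρ (e' i - inner ℝ (G' i) h'))
      ≤ ∑ i, ((e i - e' i - inner ℝ (G i - G' i) h')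
          * (deriv ρ (e i - inner ℝ (G i) h) - deriv ρ (e' i - inner ℝ (G' i) h'))
        + deriv ρ (e' i - inner ℝ (G' i) h') * inner ℝ (G i - G' i) (h - h')) := by
  have h1 := H.variational hn e G hmin h'
  have h2 := H.variational hn e' G' hmin' h
  rw [norm_sub_rev] at h1
  rw [← sub_nonneg]
  have e1 : ∀ i, (e i - e' i - inner ℝ (G i - G' i) h')
          * (deriv ρ (e i - inner ℝ (G i) h) - deriv ρ (e' i - inner ℝ (G' i) h'))
        + deriv ρ (e' i - inner ℝ (G' i) h') * inner ℝ (G i - G' i) (h - h')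
      = ((e i - inner ℝ (G i) h) - (e' i - inner ℝ (G' i) h'))
        * (deriv ρ (e i - inner ℝ (G i) h) - deriv ρ (e' i - inner ℝ (G' i) h'))
        - (deriv ρ (e i - inner ℝ (G i) h) * inner ℝ (G i) (h' - h)
        + deriv ρ (e' i - inner ℝ (G' i) h') * inner ℝ (G' i) (h - h')) := by
    intro i
    simp only [inner_sub_left, inner_sub_right]
    ring
  simp_rw [e1]
  rw [Finset.sum_sub_distrib, Finset.sum_add_distrib]
  linarith

theorem isMin_unique (H : IsotropicProblem μ ρ g) {n : ℕ} (hn : 1 ≤ n) {e : Vec n}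
    {G : Design n p} {h : Vec p} (hmin : ∀ b, objective ρ g e G h ≤ objective ρ g e G b) :
    h = mEstimator ρ g e G := by
  have h1 := H.compare_of_isMin hn hmin (H.mEstimator_isMin e G)
  have hn0 : (0 : ℝ) < n := by exact_mod_cast hn
  have h2 : 0 ≤ ∑ i, ((e i - inner ℝ (G i) h) - (e i - inner ℝ (G i) (mEstimator ρ g e G)))
        * (deriv ρ (e i - inner ℝ (G i) h)
          - deriv ρ (e i - inner ℝ (G i) (mEstimator ρ g e G))) :=
    Finset.sum_nonneg fun i _ => (sq_nonneg _).trans (H.sq_deriv_sub_le _ _)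
  simp only [sub_self, inner_zero_left, zero_mul, mul_zero, add_zero, Finset.sum_const_zero] at h1
  have h3 : n * μ * ‖h - mEstimator ρ g e G‖ ^ 2 ≤ 0 := by linarith
  have h4 : ‖h - mEstimator ρ g e G‖ ^ 2 ≤ 0 := by
    have := mul_pos hn0 H.mu_pos
    by_contra hc
    rw [not_le] at hc
    have := mul_pos this hc
    linarith
  have h5 : ‖h - mEstimator ρ g e G‖ = 0 := by
    have := sq_nonneg ‖h - mEstimator ρ g e G‖
    exact pow_eq_zero_iff two_ne_zero |>.1 (le_antisymm h4 this)
  exact sub_eq_zero.1 (norm_eq_zero.1 h5)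

/-- The comparison inequality for the estimators; its right side only involves the differences of
the data. -/
theorem compare (H : IsotropicProblem μ ρ g) {n : ℕ} (hn : 1 ≤ n) (e e' : Vec n)
    (G G' : Design n p) :
    n * μ * ‖mEstimator ρ g e G - mEstimator ρ g e' G'‖ ^ 2
        + ∑ i, (residual ρ g e G i - residual ρ g e' G' i)
          * (score ρ g e G i - score ρ g e' G' i)
      ≤ ∑ i, ((e i - e' i - inner ℝ (G i - G' i) (mEstimator ρ g e' G'))
          * (score ρ g e G i - score ρ g e' G' i)
        + score ρ g e' G' i
          * inner ℝ (G i - G' i) (mEstimator ρ g e G - mEstimator ρ g e' G')) :=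
  H.compare_of_isMin hn (H.mEstimator_isMin e G) (H.mEstimator_isMin e' G')

/-- The quantitative stability estimate behind all perturbation bounds for the estimator. -/
theorem stability (H : IsotropicProblem μ ρ g) {n : ℕ} (hn : 1 ≤ n) (e e' : Vec n)
    (G G' : Design n p) :
    n * μ * ‖mEstimator ρ g e G - mEstimator ρ g e' G'‖ ^ 2
        + ∑ i, (score ρ g e G i - score ρ g e' G' i) ^ 2
      ≤ ∑ i, (e i - e' i - inner ℝ (G i - G' i) (mEstimator ρ g e' G')) ^ 2
        + ‖∑ i, score ρ g e' G' i • (G i - G' i)‖ ^ 2 / (n * μ) := by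
  have hn0 : (0 : ℝ) < n := by exact_mod_cast hn
  have hnμ : 0 < n * μ := mul_pos hn0 H.mu_pos
  have h1 := H.compare hn e e' G G'
  set d := mEstimator ρ g e G - mEstimator ρ g e' G'
  have h2 : ∑ i, (score ρ g e G i - score ρ g e' G' i) ^ 2
      ≤ ∑ i, (residual ρ g e G i - residual ρ g e' G' i)
          * (score ρ g e G i - score ρ g e' G' i) :=
    Finset.sum_le_sum fun i _ => H.sq_deriv_sub_le _ _
  have h3 : ∑ i, (e i - e' i - inner ℝ (G i - G' i) (mEstimator ρ g e' G'))
          * (score ρ g e G i - score ρ g e' G' i)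
      ≤ (∑ i, (e i - e' i - inner ℝ (G i - G' i) (mEstimator ρ g e' G')) ^ 2) / 2
        + (∑ i, (score ρ g e G i - score ρ g e' G' i) ^ 2) / 2 := by
    rw [Finset.sum_div, Finset.sum_div, ← Finset.sum_add_distrib]
    refine Finset.sum_le_sum fun i _ => ?_
    nlinarith [sq_nonneg (e i - e' i - inner ℝ (G i - G' i) (mEstimator ρ g e' G')
      - (score ρ g e G i - score ρ g e' G' i))]
  have h4 : ∑ i, score ρ g e' G' i * inner ℝ (G i - G' i) d
      = inner ℝ (∑ i, score ρ g e' G' i • (G i - G' i)) d := by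
    rw [sum_inner]
    simp_rw [real_inner_smul_left]
  have h5 : inner ℝ (∑ i, score ρ g e' G' i • (G i - G' i)) d
      ≤ ‖∑ i, score ρ g e' G' i • (G i - G' i)‖ ^ 2 / (n * μ) / 2 + n * μ * ‖d‖ ^ 2 / 2 := by
    refine (real_inner_le_norm _ _).trans ?_
    set a := ‖∑ i, score ρ g e' G' i • (G i - G' i)‖
    have : 0 ≤ (a - n * μ * ‖d‖) ^ 2 / (n * μ) / 2 := by positivity
    have hμ := H.mu_pos.ne'
    have e2 : (a - n * μ * ‖d‖) ^ 2 / (n * μ) / 2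
        = a ^ 2 / (n * μ) / 2 + n * μ * ‖d‖ ^ 2 / 2 - a * ‖d‖ := by
      field_simp
      ring
    linarith
  rw [Finset.sum_add_distrib, h4] at h1
  linarith

end IsotropicProblem

/-! ### Differentiability of the estimator -/

theorem continuous_of_lipschitzOn_balls {E F : Type*} [NormedAddCommGroup E]
    [NormedAddCommGroup F] {f : E → F}
    (hf : ∀ R : ℝ, ∃ C : NNReal, LipschitzOnWith C f (Metric.closedBall 0 R)) : Continuous f := by
  refine continuous_iff_continuousAt.2 fun x => ?_
  obtain ⟨C, hC⟩ := hf (‖x‖ + 1)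
  refine hC.continuousOn.continuousAt (Filter.mem_of_superset
    (Metric.closedBall_mem_nhds x one_pos) (Metric.closedBall_subset_closedBall' ?_))
  rw [dist_zero_right, add_comm]

theorem ae_differentiableAt_of_lipschitzOn_balls {E F : Type*} [NormedAddCommGroup E]
    [NormedSpace ℝ E] [FiniteDimensional ℝ E] [MeasurableSpace E] [BorelSpace E]
    [NormedAddCommGroup F] [NormedSpace ℝ F] [FiniteDimensional ℝ F] (ν : Measure E)
    [ν.IsAddHaarMeasure] {f : E → F}
    (hf : ∀ R : ℝ, ∃ C : NNReal, LipschitzOnWith C f (Metric.closedBall 0 R)) :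
    ∀ᵐ x ∂ν, DifferentiableAt ℝ f x := by
  have : ∀ m : ℕ, ∀ᵐ x ∂ν, ‖x‖ < m → DifferentiableAt ℝ f x := fun m => by
    obtain ⟨C, hC⟩ := hf m
    filter_upwards [hC.ae_differentiableWithinAt_of_mem] with x hx hlt
    refine (hx (by simpa using hlt.le)).differentiableAt ?_
    exact Filter.mem_of_superset (Metric.isOpen_ball.mem_nhds (by simpa using hlt))
      Metric.ball_subset_closedBall
  filter_upwards [ae_all_iff.2 this] with x hx
  obtain ⟨m, hm⟩ := exists_nat_gt ‖x‖
  exact hx m hm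

/-- A continuous curve with positive derivative covers a neighborhood of its base point. -/
theorem nhds_le_map_of_hasDerivAt_pos {κ : ℝ → ℝ} (hκ : Continuous κ) {c : ℝ} (hc : 0 < c)
    (hd : HasDerivAt κ c 0) : nhds (κ 0) ≤ Filter.map κ (nhds 0) := by
  intro U hU
  rw [Filter.mem_map] at hU
  obtain ⟨δ, hδ, hball⟩ := Metric.mem_nhds_iff.1 hU
  rw [Real.ball_eq_Ioo, zero_sub, zero_add] at hball
  have hslope := hasDerivAt_iff_tendsto_slope_zero.1 hd
  have hpos : ∀ᶠ t in nhdsWithin (0 : ℝ) {0}ᶜ, 0 < t⁻¹ • (κ (0 + t) - κ 0) :=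
    hslope.eventually (lt_mem_nhds hc)
  have hgt : ∀ᶠ t in nhdsWithin (0 : ℝ) (Set.Ioi 0), κ 0 < κ t := by
    filter_upwards [hpos.filter_mono (nhdsWithin_mono 0 fun x (hx : 0 < x) => hx.ne'),
      self_mem_nhdsWithin] with t ht ht0
    have ht0 : 0 < t := ht0
    rw [zero_add, smul_eq_mul] at ht
    have := (mul_pos_iff_of_pos_left (inv_pos.2 ht0)).1 ht
    linarith
  have hlt : ∀ᶠ t in nhdsWithin (0 : ℝ) (Set.Iio 0), κ t < κ 0 := by
    filter_upwards [hpos.filter_mono (nhdsWithin_mono 0 fun x (hx : x < 0) => hx.ne),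
      self_mem_nhdsWithin] with t ht ht0
    have ht0 : t < 0 := ht0
    rw [zero_add, smul_eq_mul] at ht
    have := inv_lt_zero.2 ht0
    nlinarith
  obtain ⟨b, hb, hbδ⟩ := (hgt.and (Ioo_mem_nhdsGT hδ)).exists
  obtain ⟨a, ha, haδ⟩ := (hlt.and (Ioo_mem_nhdsLT (neg_lt_zero.2 hδ))).exists
  have hab : a ≤ b := by linarith [haδ.2, hbδ.1]
  have hsub := intermediate_value_Icc hab hκ.continuousOn
  refine Filter.mem_of_superset (Icc_mem_nhds ha hb) (hsub.trans ?_)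
  rintro _ ⟨t, ht, rfl⟩
  have : t ∈ κ ⁻¹' U := hball ⟨by linarith [ht.1, haδ.1], by linarith [ht.2, hbδ.2]⟩
  exact this

/-- The chain rule for the composition with a `1`-Lipschitz function `ψ`, valid without assuming
that `ψ` is differentiable at the point: if it is not, then the inner derivative must vanish,
because otherwise the derivative of `ψ` could be read off along a curve. -/
theorem fderiv_comp_of_lipschitz {E : Type*} [NormedAddCommGroup E] [NormedSpace ℝ E]
    {ψ : ℝ → ℝ} (hψ : LipschitzWith 1 ψ) {r : E → ℝ} (hrc : Continuous r) {z : E}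
    (hr : DifferentiableAt ℝ r z) (hψr : DifferentiableAt ℝ (fun x => ψ (r x)) z) (v : E) :
    fderiv ℝ (fun x => ψ (r x)) z v = deriv ψ (r z) * fderiv ℝ r z v := by
  by_cases hd : DifferentiableAt ℝ ψ (r z)
  · have h1 : HasDerivAt ψ (deriv ψ (r z)) (r z) := hd.hasDerivAt
    have := h1.comp_hasFDerivAt z hr.hasFDerivAt
    have h2 : fderiv ℝ (fun x => ψ (r x)) z = deriv ψ (r z) • fderiv ℝ r z := this.fderiv
    rw [h2]
    simp
  · have hline : ∀ w : E, HasDerivAt (fun t : ℝ => r (z + t • w)) (fderiv ℝ r z w) 0 := fun w => by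
      have := hr.hasFDerivAt.hasLineDerivAt w
      exact this
    have hline' : ∀ w : E, HasDerivAt (fun t : ℝ => ψ (r (z + t • w)))
        (fderiv ℝ (fun x => ψ (r x)) z w) 0 := fun w => hψr.hasFDerivAt.hasLineDerivAt w
    -- if `r` had a positive derivative `c` along `w`, then `ψ` would have the derivative `d / c`
    have hnp : ∀ w : E, ¬ 0 < fderiv ℝ r z w := by
      intro w hw
      refine hd ?_
      set c := fderiv ℝ r z w with hc
      set d := fderiv ℝ (fun x => ψ (r x)) z w with hd'
      set κ : ℝ → ℝ := fun t => r (z + t • w) with hκ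
      have hκ0 : κ 0 = r z := by simp [hκ]
      have hmap := nhds_le_map_of_hasDerivAt_pos (κ := κ) (hrc.comp (by fun_prop)) hw (hline w)
      have o1 := (hasDerivAt_iff_isLittleO.1 (hline w))
      have o2 := (hasDerivAt_iff_isLittleO.1 (hline' w))
      have o3 : (fun t : ℝ => ψ (κ t) - ψ (κ 0) - (κ t - κ 0) • (d / c))
          =o[nhds 0] fun t : ℝ => t - 0 := by
        refine (o2.sub (o1.const_mul_left (d / c))).congr_left fun t => ?_
        simp only [smul_eq_mul, hκ0]
        change ψ (κ t) - ψ (r (z + (0 : ℝ) • w)) - (t - 0) * d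
          - d / c * (κ t - r (z + (0 : ℝ) • w) - (t - 0) * c) = _
        rw [zero_smul, add_zero]
        field_simp
        ring
      have o4 : (fun t : ℝ => t - 0) =O[nhds 0] fun t => κ t - κ 0 := by
        have hO : (fun t : ℝ => (t - 0) * c) =O[nhds 0] fun t => κ t - κ 0 := by
          have o5 : (fun t : ℝ => κ t - κ 0 - (t - 0) * c) =o[nhds 0] fun t : ℝ => (t - 0) * c :=
            o1.trans_isBigO ((Asymptotics.isBigO_const_mul_self (c⁻¹) (fun t : ℝ => (t - 0) * c)
              _).congr_left fun t => by field_simp)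
          exact o5.right_isBigO_add.congr_right fun t => by ring
        exact ((hO.const_mul_left c⁻¹)).congr_left fun t => by field_simp
      have o5 := o3.trans_isBigO o4
      have o6 : (fun s => ψ s - ψ (r z) - (s - r z) • (d / c)) =o[nhds (r z)]
          fun s => s - r z := by
        rw [← hκ0]
        exact Asymptotics.IsLittleO.mono (Asymptotics.isLittleO_map.2 o5) hmap
      exact (hasDerivAt_iff_isLittleO.2 o6).differentiableAt
    have h0 : ∀ w, fderiv ℝ r z w = 0 := fun w => by
      have h1 := hnp w
      have h2 := hnp (-w)
      rw [map_neg] at h2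
      linarith
    rw [h0 v, mul_zero]
    -- the slopes of `ψ ∘ r` are bounded by those of `r`, which tend to zero
    have hsl := hasDerivAt_iff_tendsto_slope_zero.1 (hline v)
    have hsl' := hasDerivAt_iff_tendsto_slope_zero.1 (hline' v)
    rw [h0 v] at hsl
    have : Filter.Tendsto (fun t : ℝ => t⁻¹ • (ψ (r (z + (0 + t) • v)) - ψ (r (z + (0 : ℝ) • v))))
        (nhdsWithin 0 {0}ᶜ) (nhds 0) := by
      refine squeeze_zero_norm (fun t => ?_) (norm_zero (E := ℝ) ▸ hsl.norm)
      rw [norm_smul, norm_smul]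
      refine mul_le_mul_of_nonneg_left ?_ (norm_nonneg _)
      simpa [Real.dist_eq] using hψ.dist_le_mul (r (z + (0 + t) • v)) (r (z + (0 : ℝ) • v))
    exact tendsto_nhds_unique hsl' this

instance isAddHaarMeasure_volume_data (n p : ℕ) :
    (volume : Measure (Vec n × Design n p)).IsAddHaarMeasure :=
  Measure.prod.instIsAddHaarMeasure (volume : Measure (Vec n)) (volume : Measure (Design n p))

namespace IsotropicProblem

variable {p : ℕ} {μ : ℝ} {ρ : ℝ → ℝ} {g : Vec p → ℝ}

/-- The estimator and its score are Lipschitz on bounded sets of data. -/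
theorem exists_lipschitzOn (H : IsotropicProblem μ ρ g) {n : ℕ} (hn : 1 ≤ n) (R : ℝ) :
    ∃ C : NNReal, LipschitzOnWith C (fun z : Vec n × Design n p => mEstimator ρ g z.1 z.2)
        (Metric.closedBall 0 R) ∧
      ∀ i, LipschitzOnWith C (fun z : Vec n × Design n p => score ρ g z.1 z.2 i)
        (Metric.closedBall 0 R) := by
  have hn0 : (0 : ℝ) < n := by exact_mod_cast hn
  have hμ := H.mu_pos
  have hnμ : 0 < n * μ := mul_pos hn0 hμ
  -- boundedness, by comparison with zero data
  set m := ‖mEstimator ρ g (0 : Vec n) (0 : Design n p)‖ with hm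
  have hm0 : 0 ≤ m := norm_nonneg _
  have hcoord : ∀ (z : Vec n) (i : Fin n), |z i| ≤ ‖z‖ := fun z i => by
    simpa using EuclideanSpace.norm_eq z ▸ PiLp.norm_apply_le z i
  have hbd : ∀ z ∈ Metric.closedBall (0 : Vec n × Design n p) R,
      n * μ * ‖mEstimator ρ g z.1 z.2 - mEstimator ρ g (0 : Vec n) (0 : Design n p)‖ ^ 2
        + ∑ i, score ρ g z.1 z.2 i ^ 2
        ≤ n * (R + R * m) ^ 2 := by
    intro z hz
    have hzR : ‖z‖ ≤ R := by simpa using hz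
    have h1 := H.stability hn z.1 0 z.2 0
    have hs0 : ∀ i, score ρ g (0 : Vec n) (0 : Design n p) i = 0 := fun i => by
      rw [score, residual_apply]
      simp [H.deriv_zero]
    simp only [hs0, sub_zero, zero_smul, Finset.sum_const_zero, norm_zero] at h1
    refine h1.trans ?_
    rw [zero_pow two_ne_zero, zero_div, add_zero]
    have : ∀ i ∈ (Finset.univ : Finset (Fin n)), (z.1 i - (0 : Vec n) i
        - inner ℝ (z.2 i - (0 : Design n p) i) (mEstimator ρ g (0 : Vec n) (0 : Design n p))) ^ 2
          ≤ (R + R * m) ^ 2 := by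
      intro i _
      refine sq_le_sq' ?_ ?_ <;>
      · have e1 := abs_le.1 ((hcoord z.1 i).trans ((norm_fst_le z).trans hzR))
        have e2 : ‖z.2 i‖ ≤ R := (norm_le_pi_norm z.2 i).trans ((norm_snd_le z).trans hzR)
        have e3 := abs_le.1 ((abs_real_inner_le_norm (z.2 i) (mEstimator ρ g (0 : Vec n) (0 : Design n p))).trans
          (mul_le_mul_of_nonneg_right e2 (norm_nonneg _)))
        have e4 : (0 : Vec n) i = 0 := rfl
        have e5 : z.2 i - (0 : Design n p) i = z.2 i := sub_zero _
        rw [e4, e5]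
        linarith [e1.1, e1.2, e3.1, e3.2]
    have := Finset.sum_le_card_nsmul _ _ _ this
    simpa using this
  obtain ⟨M, hM1, hMh, hMs⟩ : ∃ M : ℝ, 0 ≤ M ∧
      (∀ z ∈ Metric.closedBall (0 : Vec n × Design n p) R, ‖mEstimator ρ g z.1 z.2‖ ≤ M) ∧
      (∀ z ∈ Metric.closedBall (0 : Vec n × Design n p) R, ∀ i, |score ρ g z.1 z.2 i| ≤ M) := by
    set B := n * (R + R * m) ^ 2 with hB
    have hB0 : 0 ≤ B := by positivity
    have hBμ : 0 ≤ B / (n * μ) := by positivity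
    refine ⟨m + B / (n * μ) + B + 1, by positivity, fun z hz => ?_, fun z hz i => ?_⟩
    · have h1 := hbd z hz
      have h2 : 0 ≤ ∑ i, score ρ g z.1 z.2 i ^ 2 := Finset.sum_nonneg fun i _ => sq_nonneg _
      have h3 : ‖mEstimator ρ g z.1 z.2 - mEstimator ρ g (0 : Vec n) (0 : Design n p)‖ ^ 2 ≤ B / (n * μ) := by
        rw [le_div_iff₀ hnμ]; linarith
      have h4 := norm_sub_norm_le (mEstimator ρ g z.1 z.2) (mEstimator ρ g (0 : Vec n) (0 : Design n p))
      nlinarith [sq_nonneg (‖mEstimator ρ g z.1 z.2 - mEstimator ρ g (0 : Vec n) (0 : Design n p)‖ - 1)]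
    · have h1 := hbd z hz
      have h2 : score ρ g z.1 z.2 i ^ 2 ≤ ∑ i, score ρ g z.1 z.2 i ^ 2 :=
        Finset.single_le_sum (f := fun i => score ρ g z.1 z.2 i ^ 2) (fun i _ => sq_nonneg _)
          (Finset.mem_univ i)
      have h3 : 0 ≤ n * μ * ‖mEstimator ρ g z.1 z.2 - mEstimator ρ g (0 : Vec n) (0 : Design n p)‖ ^ 2 := by positivity
      have h4 : |score ρ g z.1 z.2 i| ^ 2 ≤ B := by rw [sq_abs]; linarith
      nlinarith [sq_nonneg (|score ρ g z.1 z.2 i| - 1)]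
  -- the Lipschitz estimate
  set K := n * (1 + M) ^ 2 + (n * M) ^ 2 / (n * μ) with hK
  have hK0 : 0 ≤ K := by positivity
  have hpair : ∀ z ∈ Metric.closedBall (0 : Vec n × Design n p) R,
      ∀ z' ∈ Metric.closedBall (0 : Vec n × Design n p) R,
      n * μ * ‖mEstimator ρ g z.1 z.2 - mEstimator ρ g z'.1 z'.2‖ ^ 2
        + ∑ i, (score ρ g z.1 z.2 i - score ρ g z'.1 z'.2 i) ^ 2 ≤ K * ‖z - z'‖ ^ 2 := by
    intro z hz z' hz'
    refine (H.stability hn z.1 z'.1 z.2 z'.2).trans ?_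
    rw [hK, add_mul]
    have hG : ∀ i, ‖z.2 i - z'.2 i‖ ≤ ‖z - z'‖ := fun i =>
      (norm_le_pi_norm (z.2 - z'.2) i).trans (norm_snd_le (z - z'))
    refine add_le_add ?_ ?_
    · have : ∀ i ∈ (Finset.univ : Finset (Fin n)), (z.1 i - z'.1 i
          - inner ℝ (z.2 i - z'.2 i) (mEstimator ρ g z'.1 z'.2)) ^ 2
            ≤ ((1 + M) * ‖z - z'‖) ^ 2 := by
        intro i _
        have e1 := abs_le.1 ((hcoord (z.1 - z'.1) i).trans (norm_fst_le (z - z')))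
        have e3 := abs_le.1 ((abs_real_inner_le_norm (z.2 i - z'.2 i)
          (mEstimator ρ g z'.1 z'.2)).trans
          (mul_le_mul (hG i) (hMh z' hz') (norm_nonneg _) (norm_nonneg _)))
        have e4 : (z.1 - z'.1) i = z.1 i - z'.1 i := rfl
        rw [e4] at e1
        refine sq_le_sq' ?_ ?_ <;> linarith [e1.1, e1.2, e3.1, e3.2]
      have := Finset.sum_le_card_nsmul _ _ _ this
      simp only [Finset.card_univ, Fintype.card_fin, nsmul_eq_mul, mul_pow] at this
      linarith
    · rw [div_mul_eq_mul_div]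
      refine div_le_div_of_nonneg_right ?_ hnμ.le
      rw [← mul_pow]
      refine pow_le_pow_left₀ (norm_nonneg _) ?_ 2
      refine (norm_sum_le _ _).trans ?_
      have : ∀ i ∈ (Finset.univ : Finset (Fin n)), ‖score ρ g z'.1 z'.2 i • (z.2 i - z'.2 i)‖
          ≤ M * ‖z - z'‖ := fun i _ => by
        rw [norm_smul]
        exact mul_le_mul (hMs z' hz' i) (hG i) (norm_nonneg _) hM1
      have := Finset.sum_le_card_nsmul _ _ _ this
      simp only [Finset.card_univ, Fintype.card_fin, nsmul_eq_mul] at this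
      linarith
  have hsq : ∀ a b c : ℝ, 0 ≤ b → 0 ≤ c → a ^ 2 ≤ c * b ^ 2 → a ≤ (c + 1) * b := by
    intro a b c hb hc h
    refine le_of_sq_le_sq ?_ (by positivity)
    nlinarith [sq_nonneg b, mul_nonneg hc (sq_nonneg b), mul_nonneg (mul_nonneg hc hc) (sq_nonneg b)]
  refine ⟨Real.toNNReal (K / (n * μ) + 1 + (K + 1)), ?_, fun i => ?_⟩
  · refine LipschitzOnWith.of_dist_le_mul fun z hz z' hz' => ?_
    rw [Real.coe_toNNReal _ (by positivity), dist_eq_norm, dist_eq_norm]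
    have h1 := hpair z hz z' hz'
    have h2 : 0 ≤ ∑ i, (score ρ g z.1 z.2 i - score ρ g z'.1 z'.2 i) ^ 2 :=
      Finset.sum_nonneg fun i _ => sq_nonneg _
    have h3 : ‖mEstimator ρ g z.1 z.2 - mEstimator ρ g z'.1 z'.2‖ ^ 2
        ≤ K / (n * μ) * ‖z - z'‖ ^ 2 := by
      rw [div_mul_eq_mul_div, le_div_iff₀ hnμ]; linarith
    refine (hsq _ _ _ (norm_nonneg _) (by positivity) h3).trans ?_
    nlinarith [norm_nonneg (z - z')]
  · refine LipschitzOnWith.of_dist_le_mul fun z hz z' hz' => ?_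
    rw [Real.coe_toNNReal _ (by positivity), Real.dist_eq, dist_eq_norm]
    have h1 := hpair z hz z' hz'
    have h2 : (score ρ g z.1 z.2 i - score ρ g z'.1 z'.2 i) ^ 2
        ≤ ∑ i, (score ρ g z.1 z.2 i - score ρ g z'.1 z'.2 i) ^ 2 :=
      Finset.single_le_sum (f := fun i => (score ρ g z.1 z.2 i - score ρ g z'.1 z'.2 i) ^ 2)
        (fun i _ => sq_nonneg _) (Finset.mem_univ i)
    have h3 : 0 ≤ n * μ * ‖mEstimator ρ g z.1 z.2 - mEstimator ρ g z'.1 z'.2‖ ^ 2 := by positivity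
    have h4 : |score ρ g z.1 z.2 i - score ρ g z'.1 z'.2 i| ^ 2 ≤ K * ‖z - z'‖ ^ 2 := by
      rw [sq_abs]; linarith
    refine (hsq _ _ _ (norm_nonneg _) hK0 h4).trans ?_
    have : 0 ≤ K / (n * μ) := by positivity
    nlinarith [norm_nonneg (z - z')]

theorem continuous_mEstimator (H : IsotropicProblem μ ρ g) {n : ℕ} (hn : 1 ≤ n) :
    Continuous fun z : Vec n × Design n p => mEstimator ρ g z.1 z.2 :=
  continuous_of_lipschitzOn_balls fun R => (H.exists_lipschitzOn hn R).imp fun _ h => h.1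

theorem continuous_score (H : IsotropicProblem μ ρ g) {n : ℕ} (hn : 1 ≤ n) (i : Fin n) :
    Continuous fun z : Vec n × Design n p => score ρ g z.1 z.2 i :=
  continuous_of_lipschitzOn_balls fun R => (H.exists_lipschitzOn hn R).imp fun _ h => h.2 i

/-- By Rademacher's theorem, the estimator and its score are almost everywhere differentiable. -/
theorem ae_differentiableAt (H : IsotropicProblem μ ρ g) {n : ℕ} (hn : 1 ≤ n) :
    ∀ᵐ z : Vec n × Design n p,
      DifferentiableAt ℝ (fun z : Vec n × Design n p => mEstimator ρ g z.1 z.2) z ∧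
      ∀ i, DifferentiableAt ℝ (fun z : Vec n × Design n p => score ρ g z.1 z.2 i) z := by
  have h1 := ae_differentiableAt_of_lipschitzOn_balls (volume : Measure (Vec n × Design n p))
    (f := fun z => mEstimator ρ g z.1 z.2)
    fun R => (H.exists_lipschitzOn hn R).imp fun _ h => h.1
  have h2 : ∀ i, ∀ᵐ z : Vec n × Design n p,
      DifferentiableAt ℝ (fun z : Vec n × Design n p => score ρ g z.1 z.2 i) z := fun i =>
    ae_differentiableAt_of_lipschitzOn_balls (volume : Measure (Vec n × Design n p))
    fun R => (H.exists_lipschitzOn hn R).imp fun _ h => h.2 i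
  filter_upwards [h1, ae_all_iff.2 h2] with z h1 h2 using ⟨h1, h2⟩

end IsotropicProblem

/-- The linear map `(ẏ, Ẋ) ↦ Ẋᵀ ψ(r) + Xᵀ D (ẏ - Ẋ β̂)`, with `D = diag ψ'(r)`. The derivative of the
estimator factors through this map, and the factor is the matrix `A`. -/
noncomputable def scoreDeriv {n p : ℕ} (ρ : ℝ → ℝ) (g : Vec p → ℝ) (e : Vec n) (G : Design n p) :
    Vec n × Design n p →ₗ[ℝ] Vec p where
  toFun v := ∑ i, (score ρ g e G i • v.2 i
    + (deriv (deriv ρ) (residual ρ g e G i)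
      * (v.1 i - inner ℝ (v.2 i) (mEstimator ρ g e G))) • G i)
  map_add' v w := by
    rw [← Finset.sum_add_distrib]
    refine Finset.sum_congr rfl fun i _ => ?_
    simp only [Prod.fst_add, Prod.snd_add, Pi.add_apply, PiLp.add_apply, inner_add_left, smul_add]
    module
  map_smul' c v := by
    rw [RingHom.id_apply, Finset.smul_sum]
    refine Finset.sum_congr rfl fun i _ => ?_
    simp only [Prod.smul_fst, Prod.smul_snd, Pi.smul_apply, PiLp.smul_apply, inner_smul_left,
      smul_eq_mul, conj_trivial]
    module

theorem scoreDeriv_apply {n p : ℕ} (ρ : ℝ → ℝ) (g : Vec p → ℝ) (e : Vec n) (G : Design n p)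
    (v : Vec n × Design n p) : scoreDeriv ρ g e G v = ∑ i, (score ρ g e G i • v.2 i
    + (deriv (deriv ρ) (residual ρ g e G i)
      * (v.1 i - inner ℝ (v.2 i) (mEstimator ρ g e G))) • G i) := rfl

theorem scoreDeriv_noise {n p : ℕ} (ρ : ℝ → ℝ) (g : Vec p → ℝ) (e : Vec n) (G : Design n p)
    (i : Fin n) : scoreDeriv ρ g e G (EuclideanSpace.single i 1, 0)
      = deriv (deriv ρ) (residual ρ g e G i) • G i := by
  rw [scoreDeriv_apply, Finset.sum_eq_single i]
  · simp
  · intro j _ hj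
    simp [hj]
  · simp

theorem scoreDeriv_row {n p : ℕ} (ρ : ℝ → ℝ) (g : Vec p → ℝ) (e : Vec n) (G : Design n p)
    (i : Fin n) (w : Vec p) : scoreDeriv ρ g e G (0, Pi.single i w)
      = score ρ g e G i • w - (deriv (deriv ρ) (residual ρ g e G i)
        * inner ℝ w (mEstimator ρ g e G)) • G i := by
  rw [scoreDeriv_apply, Finset.sum_eq_single i]
  · simp [sub_eq_add_neg]
  · intro j _ hj
    simp [hj]
  · simp

theorem matMul_add {p : ℕ} (A : Matrix (Fin p) (Fin p) ℝ) (v w : Vec p) :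
    matMul A (v + w) = matMul A v + matMul A w := map_add _ _ _

theorem matMul_smul {p : ℕ} (A : Matrix (Fin p) (Fin p) ℝ) (c : ℝ) (v : Vec p) :
    matMul A (c • v) = c • matMul A v := map_smul _ _ _

/-- A linear map on data space is determined by its values on the coordinate directions. -/
theorem data_linearMap_ext {n p : ℕ} {F : Type*} [AddCommGroup F] [Module ℝ F]
    {L M : Vec n × Design n p →ₗ[ℝ] F}
    (h1 : ∀ i : Fin n, L (EuclideanSpace.single i 1, 0) = M (EuclideanSpace.single i 1, 0))
    (h2 : ∀ (i : Fin n) (j : Fin p), L (0, Pi.single i (EuclideanSpace.single j 1))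
      = M (0, Pi.single i (EuclideanSpace.single j 1))) : L = M := by
  refine LinearMap.prod_ext ?_ ?_
  · refine (EuclideanSpace.basisFun (Fin n) ℝ).toBasis.ext fun i => ?_
    simpa using h1 i
  · refine LinearMap.pi_ext' fun i => ?_
    refine (EuclideanSpace.basisFun (Fin p) ℝ).toBasis.ext fun j => ?_
    simpa using h2 i j

/-- The coordinate-free form of the derivative formulas. -/
theorem IsDerivMatrix.fderiv_eq {n p : ℕ} {μ : ℝ} {ρ : ℝ → ℝ} {g : Vec p → ℝ}
    {S : Matrix (Fin p) (Fin p) ℝ} {e : Vec n} {G : Design n p} {A : Matrix (Fin p) (Fin p) ℝ}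
    (hA : IsDerivMatrix μ ρ g S e G A) (v : Vec n × Design n p) :
    fderiv ℝ (fun z : Vec n × Design n p => mEstimator ρ g z.1 z.2) (e, G) v
      = matMul A (scoreDeriv ρ g e G v) := by
  have key : (fderiv ℝ (fun z : Vec n × Design n p => mEstimator ρ g z.1 z.2) (e, G) :
        Vec n × Design n p →ₗ[ℝ] Vec p)
      = (Matrix.toEuclideanCLM (𝕜 := ℝ) A : Vec p →ₗ[ℝ] Vec p) ∘ₗ scoreDeriv ρ g e G := by
    refine data_linearMap_ext (fun i => ?_) (fun i j => ?_)
    · change fderiv ℝ (fun z : Vec n × Design n p => mEstimator ρ g z.1 z.2) (e, G) _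
        = matMul A (scoreDeriv ρ g e G _)
      rw [hA.deriv_y i, scoreDeriv_noise, matMul_smul]
    · change fderiv ℝ (fun z : Vec n × Design n p => mEstimator ρ g z.1 z.2) (e, G) _
        = matMul A (scoreDeriv ρ g e G _)
      rw [hA.deriv_x i j, scoreDeriv_row, sub_eq_add_neg, ← neg_smul, sub_eq_add_neg, ← neg_smul,
        matMul_add, matMul_smul, matMul_smul, EuclideanSpace.inner_single_left]
      simp [score]
  exact LinearMap.congr_fun key v

theorem isDerivMatrix_of_fderiv_eq {n p : ℕ} {μ : ℝ} {ρ : ℝ → ℝ} {g : Vec p → ℝ}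
    {S : Matrix (Fin p) (Fin p) ℝ} {e : Vec n} {G : Design n p} {A : Matrix (Fin p) (Fin p) ℝ}
    (hd : DifferentiableAt ℝ (fun z : Vec n × Design n p => mEstimator ρ g z.1 z.2) (e, G))
    (hn : ‖CFC.sqrt S * A * CFC.sqrt S‖ ≤ ((n : ℝ) * μ)⁻¹)
    (h : ∀ v, fderiv ℝ (fun z : Vec n × Design n p => mEstimator ρ g z.1 z.2) (e, G) v
      = matMul A (scoreDeriv ρ g e G v)) : IsDerivMatrix μ ρ g S e G A where
  differentiableAt := hd
  norm_le := hn
  deriv_y i := by rw [h, scoreDeriv_noise, matMul_smul]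
  deriv_x i j := by
    rw [h, scoreDeriv_row, sub_eq_add_neg, ← neg_smul, matMul_add, matMul_smul, matMul_smul,
      EuclideanSpace.inner_single_left]
    simp [sub_eq_add_neg, score]

/-- A linear map `L` with `c ‖L v‖² ≤ ⟪L v, U v⟫` factors through `U`, with a factor of norm at
most `c⁻¹`. -/
theorem exists_matrix_factor {V : Type*} [AddCommGroup V] [Module ℝ V] {p : ℕ} {c : ℝ}
    (hc : 0 < c) (L U : V →ₗ[ℝ] Vec p) (h : ∀ v, c * ‖L v‖ ^ 2 ≤ inner ℝ (L v) (U v)) :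
    ∃ A : Matrix (Fin p) (Fin p) ℝ, ‖A‖ ≤ c⁻¹ ∧ ∀ v, L v = matMul A (U v) := by
  have hle : ∀ v, ‖L v‖ ≤ c⁻¹ * ‖U v‖ := by
    intro v
    have h1 := (h v).trans (real_inner_le_norm _ _)
    by_cases h0 : ‖L v‖ = 0
    · rw [h0]; positivity
    · have hpos : 0 < ‖L v‖ := lt_of_le_of_ne (norm_nonneg _) (Ne.symm h0)
      rw [inv_mul_eq_div, le_div_iff₀ hc]
      nlinarith
  obtain ⟨s, hs⟩ := U.rangeRestrict.exists_rightInverse_of_surjective U.range_rangeRestrict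
  have hs' : ∀ w : LinearMap.range U, U (s w) = w := fun w => by
    have := LinearMap.congr_fun hs w
    simpa using congrArg Subtype.val this
  -- `L` vanishes where `U` does, so it descends to the range of `U`; it is extended to the whole
  -- space by the orthogonal projection, which keeps the norm bound
  set T : Vec p →ₗ[ℝ] Vec p :=
    (L ∘ₗ s) ∘ₗ ((LinearMap.range U).orthogonalProjectionOnto : Vec p →ₗ[ℝ] LinearMap.range U) with hT
  have hTb : ∀ w, ‖T w‖ ≤ c⁻¹ * ‖w‖ := by
    intro w
    refine (hle _).trans ?_
    rw [hs']
    exact mul_le_mul_of_nonneg_left (Submodule.norm_orthogonalProjectionOnto_apply_le _ w)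
      (inv_nonneg.2 hc.le)
  have hTU : ∀ v, T (U v) = L v := by
    intro v
    have e0 : (LinearMap.range U).orthogonalProjectionOnto (U v) = ⟨U v, v, rfl⟩ :=
      Submodule.orthogonalProjectionOnto_mem_subspace_eq_self (⟨U v, v, rfl⟩ : LinearMap.range U)
    have e1 : T (U v) = L (s ⟨U v, v, rfl⟩) := by
      change L (s ((LinearMap.range U).orthogonalProjectionOnto (U v))) = _
      rw [e0]
    have e2 : U (s ⟨U v, v, rfl⟩ - v) = 0 := by rw [map_sub, hs', sub_self]
    have e3 := hle (s ⟨U v, v, rfl⟩ - v)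
    rw [e2, norm_zero, mul_zero, map_sub] at e3
    rw [e1]
    exact sub_eq_zero.1 (norm_le_zero_iff.1 e3)
  set Tc : Vec p →L[ℝ] Vec p := LinearMap.toContinuousLinearMap T with hTc
  refine ⟨(Matrix.toEuclideanCLM (𝕜 := ℝ)).symm Tc, ?_, fun v => ?_⟩
  · rw [← Matrix.l2_opNorm_toEuclideanCLM, StarAlgEquiv.apply_symm_apply]
    exact ContinuousLinearMap.opNorm_le_bound _ (inv_nonneg.2 hc.le) hTb
  · rw [matMul, StarAlgEquiv.apply_symm_apply]
    exact (hTU v).symm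

namespace IsotropicProblem

variable {p : ℕ} {μ : ℝ} {ρ : ℝ → ℝ} {g : Vec p → ℝ}

/-- The infinitesimal form of the comparison inequality. -/
theorem fderiv_inner_le (H : IsotropicProblem μ ρ g) {n : ℕ} (hn : 1 ≤ n) {e : Vec n}
    {G : Design n p}
    (hh : DifferentiableAt ℝ (fun z : Vec n × Design n p => mEstimator ρ g z.1 z.2) (e, G))
    (hs : ∀ i, DifferentiableAt ℝ (fun z : Vec n × Design n p => score ρ g z.1 z.2 i) (e, G))
    (v : Vec n × Design n p) :
    n * μ * ‖fderiv ℝ (fun z : Vec n × Design n p => mEstimator ρ g z.1 z.2) (e, G) v‖ ^ 2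
      ≤ inner ℝ (fderiv ℝ (fun z : Vec n × Design n p => mEstimator ρ g z.1 z.2) (e, G) v)
        (scoreDeriv ρ g e G v) := by
  set hd := fderiv ℝ (fun z : Vec n × Design n p => mEstimator ρ g z.1 z.2) (e, G) v with hhd
  set D : Fin n → ℝ := fun i => deriv (deriv ρ) (residual ρ g e G i) with hD
  have hcr : ∀ i, Continuous fun z : Vec n × Design n p => residual ρ g z.1 z.2 i := fun i => by
    have := H.continuous_mEstimator hn (n := n)
    simp only [residual_apply]
    fun_prop
  have hres : ∀ i, HasFDerivAt (fun z : Vec n × Design n p => residual ρ g z.1 z.2 i)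
      ((EuclideanSpace.proj i : Vec n →L[ℝ] ℝ) ∘L ContinuousLinearMap.fst ℝ _ _
        - ((fderivInnerCLM ℝ (G i, mEstimator ρ g e G)) ∘L
          (((ContinuousLinearMap.proj i : Design n p →L[ℝ] Vec p) ∘L
            ContinuousLinearMap.snd ℝ _ _).prod
          (fderiv ℝ (fun z : Vec n × Design n p => mEstimator ρ g z.1 z.2) (e, G))))) (e, G) := by
    intro i
    have h1 : HasFDerivAt (fun z : Vec n × Design n p => z.1 i)
        ((EuclideanSpace.proj i : Vec n →L[ℝ] ℝ) ∘L ContinuousLinearMap.fst ℝ _ _) (e, G) := by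
      have := ((EuclideanSpace.proj i : Vec n →L[ℝ] ℝ) ∘L
        ContinuousLinearMap.fst ℝ (Vec n) (Design n p)).hasFDerivAt (x := (e, G))
      exact this
    have h2 : HasFDerivAt (fun z : Vec n × Design n p => z.2 i)
        ((ContinuousLinearMap.proj i : Design n p →L[ℝ] Vec p) ∘L
            ContinuousLinearMap.snd ℝ _ _) (e, G) := by
      have := ((ContinuousLinearMap.proj i : Design n p →L[ℝ] Vec p) ∘L
            ContinuousLinearMap.snd ℝ (Vec n) (Design n p)).hasFDerivAt (x := (e, G))
      exact this
    exact h1.sub (h2.inner ℝ hh.hasFDerivAt)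
  have hresv : ∀ i, fderiv ℝ (fun z : Vec n × Design n p => residual ρ g z.1 z.2 i) (e, G) v
      = v.1 i - inner ℝ (v.2 i) (mEstimator ρ g e G) - inner ℝ (G i) hd := by
    intro i
    rw [(hres i).fderiv]
    simp [fderivInnerCLM_apply, hhd]
    ring
  have hsv : ∀ i, fderiv ℝ (fun z : Vec n × Design n p => score ρ g z.1 z.2 i) (e, G) v
      = D i * (v.1 i - inner ℝ (v.2 i) (mEstimator ρ g e G) - inner ℝ (G i) hd) := by
    intro i
    rw [← hresv]
    exact fderiv_comp_of_lipschitz H.loss_lipschitz (hcr i) (hres i).differentiableAt (hs i) v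
  -- the comparison inequality is divided by `t²` along the line `(e, G) + t v`
  have lh : Filter.Tendsto (fun t : ℝ => t⁻¹ • (mEstimator ρ g (e + t • v.1) (G + t • v.2)
      - mEstimator ρ g e G)) (nhdsWithin 0 {0}ᶜ) (nhds hd) := by
    have h1 : HasDerivAt (fun t : ℝ => mEstimator ρ g ((e, G) + t • v).1 ((e, G) + t • v).2) hd 0 :=
      hh.hasFDerivAt.hasLineDerivAt v
    simpa using hasDerivAt_iff_tendsto_slope_zero.1 h1
  have ls : ∀ i, Filter.Tendsto (fun t : ℝ => t⁻¹ • (score ρ g (e + t • v.1) (G + t • v.2) i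
      - score ρ g e G i)) (nhdsWithin 0 {0}ᶜ)
      (nhds (D i * (v.1 i - inner ℝ (v.2 i) (mEstimator ρ g e G) - inner ℝ (G i) hd))) := fun i => by
    have h1 : HasDerivAt (fun t : ℝ => score ρ g ((e, G) + t • v).1 ((e, G) + t • v).2 i) _ 0 :=
      (hs i).hasFDerivAt.hasLineDerivAt v
    rw [← hsv]
    simpa using hasDerivAt_iff_tendsto_slope_zero.1 h1
  have lr : ∀ i, Filter.Tendsto (fun t : ℝ => t⁻¹ • (residual ρ g (e + t • v.1) (G + t • v.2) i
      - residual ρ g e G i)) (nhdsWithin 0 {0}ᶜ)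
      (nhds (v.1 i - inner ℝ (v.2 i) (mEstimator ρ g e G) - inner ℝ (G i) hd)) := fun i => by
    have h1 : HasDerivAt (fun t : ℝ => residual ρ g ((e, G) + t • v).1 ((e, G) + t • v).2 i) _ 0 :=
      (hres i).hasLineDerivAt v
    rw [← (hres i).fderiv] at h1
    rw [← hresv]
    simpa using hasDerivAt_iff_tendsto_slope_zero.1 h1
  have hineq : ∀ᶠ t : ℝ in nhdsWithin 0 {0}ᶜ,
      n * μ * ‖t⁻¹ • (mEstimator ρ g (e + t • v.1) (G + t • v.2) - mEstimator ρ g e G)‖ ^ 2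
        + ∑ i, (t⁻¹ • (residual ρ g (e + t • v.1) (G + t • v.2) i - residual ρ g e G i))
          * (t⁻¹ • (score ρ g (e + t • v.1) (G + t • v.2) i - score ρ g e G i))
      ≤ ∑ i, ((v.1 i - inner ℝ (v.2 i) (mEstimator ρ g e G))
          * (t⁻¹ • (score ρ g (e + t • v.1) (G + t • v.2) i - score ρ g e G i))
        + score ρ g e G i * inner ℝ (v.2 i)
          (t⁻¹ • (mEstimator ρ g (e + t • v.1) (G + t • v.2) - mEstimator ρ g e G))) := by
    filter_upwards [self_mem_nhdsWithin] with t ht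
    have ht0 : t ≠ 0 := ht
    have h1 := H.compare hn (e + t • v.1) e (G + t • v.2) G
    have h2 := mul_le_mul_of_nonneg_left h1 (sq_nonneg t⁻¹)
    rw [mul_add, Finset.mul_sum, Finset.mul_sum] at h2
    refine (le_of_eq ?_).trans (h2.trans (le_of_eq ?_))
    · rw [norm_smul, mul_pow, Real.norm_eq_abs, sq_abs]
      congr 1
      · ring
      · refine Finset.sum_congr rfl fun i _ => ?_
        simp only [smul_eq_mul]
        ring
    · refine Finset.sum_congr rfl fun i _ => ?_
      have e1 : (e + t • v.1) i - e i = t * v.1 i := by simp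
      have e2 : (G + t • v.2) i - G i = t • v.2 i := by simp
      rw [e1, e2, inner_smul_left, inner_smul_left, inner_smul_right]
      simp only [smul_eq_mul, conj_trivial]
      field_simp
  have hlim := le_of_tendsto_of_tendsto
    (((lh.norm.pow 2).const_mul (n * μ)).add (tendsto_finsetSum _ fun i _ => (lr i).mul (ls i)))
    (tendsto_finsetSum _ fun i _ => ((ls i).const_mul _).add
      ((tendsto_const_nhds.inner lh).const_mul _)) hineq
  -- the two sides differ by the nonnegative terms `ψ'(rᵢ) ⟨Gᵢ, hd⟩²`
  have hfin : inner ℝ hd (scoreDeriv ρ g e G v)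
      = ∑ i, ((v.1 i - inner ℝ (v.2 i) (mEstimator ρ g e G))
          * (D i * (v.1 i - inner ℝ (v.2 i) (mEstimator ρ g e G) - inner ℝ (G i) hd))
        + score ρ g e G i * inner ℝ (v.2 i) hd)
        - ∑ i, (v.1 i - inner ℝ (v.2 i) (mEstimator ρ g e G) - inner ℝ (G i) hd)
          * (D i * (v.1 i - inner ℝ (v.2 i) (mEstimator ρ g e G) - inner ℝ (G i) hd))
        + ∑ i, D i * inner ℝ (G i) hd ^ 2 := by
    rw [scoreDeriv_apply, inner_sum, ← Finset.sum_sub_distrib, ← Finset.sum_add_distrib]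
    refine Finset.sum_congr rfl fun i _ => ?_
    rw [inner_add_right, inner_smul_right, inner_smul_right, real_inner_comm hd (v.2 i),
      real_inner_comm hd (G i)]
    simp only [hD]
    ring
  have hnn : 0 ≤ ∑ i, D i * inner ℝ (G i) hd ^ 2 := Finset.sum_nonneg fun i _ =>
    mul_nonneg (H.deriv_deriv_nonneg _) (sq_nonneg _)
  rw [hfin]
  linarith

/-- At a point where the estimator and the score are differentiable, the matrix of the
differentiability structure exists. -/
theorem exists_isDerivMatrix (H : IsotropicProblem μ ρ g) {n : ℕ} (hn : 1 ≤ n) {e : Vec n}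
    {G : Design n p}
    (hh : DifferentiableAt ℝ (fun z : Vec n × Design n p => mEstimator ρ g z.1 z.2) (e, G))
    (hs : ∀ i, DifferentiableAt ℝ (fun z : Vec n × Design n p => score ρ g z.1 z.2 i) (e, G)) :
    ∃ A, IsDerivMatrix μ ρ g 1 e G A := by
  have hn0 : (0 : ℝ) < n := by exact_mod_cast hn
  obtain ⟨A, hA, hfac⟩ := exists_matrix_factor (mul_pos hn0 H.mu_pos)
    (fderiv ℝ (fun z : Vec n × Design n p => mEstimator ρ g z.1 z.2) (e, G) :
        Vec n × Design n p →ₗ[ℝ] Vec p) (scoreDeriv ρ g e G) (H.fderiv_inner_le hn hh hs)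
  refine ⟨A, isDerivMatrix_of_fderiv_eq hh ?_ hfac⟩
  simpa [CFC.sqrt_one] using hA

end IsotropicProblem

/-! ### Moments of Gaussian vectors and designs -/

/-- The fourth moment of the standard Gaussian distribution on the line. -/
noncomputable def fourthMoment : ℝ := ∫ x, x ^ 4 ∂gaussianReal 0 1

theorem fourthMoment_nonneg : 0 ≤ fourthMoment :=
  integral_nonneg fun x => by positivity

theorem map_inner_stdGaussian {p : ℕ} (w : Vec p) :
    (stdGaussian (Vec p)).map (fun z => inner ℝ z w) = (gaussianReal 0 1).map (fun x => ‖w‖ * x) := by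
  rw [gaussianReal_map_const_mul]
  have : IsFiniteMeasure ((stdGaussian (Vec p)).map fun z => inner ℝ z w) :=
    Measure.isFiniteMeasure_map _ _
  refine Measure.ext_of_charFun ?_
  ext t
  have hm : Measurable fun z : Vec p => inner ℝ z w := by fun_prop
  rw [charFun_gaussianReal, charFun_apply_real, integral_map hm.aemeasurable (by fun_prop)]
  have h := charFun_stdGaussian (E := Vec p) (t • w)
  rw [charFun_apply] at h
  simp_rw [inner_smul_right, Complex.ofReal_mul] at h
  rw [h, norm_smul]
  congr 1
  simp [mul_pow, ← Complex.ofReal_pow]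
  ring

theorem map_sum_inner_gaussDesign {n p : ℕ} (a : Fin n → Vec p) :
    (gaussDesign n p).map (fun G => ∑ i, inner ℝ (G i) (a i))
      = (gaussianReal 0 1).map (fun x => √(∑ i, ‖a i‖ ^ 2) * x) := by
  rw [gaussianReal_map_const_mul]
  have hm : Measurable fun G : Design n p => ∑ i, inner ℝ (G i) (a i) := by fun_prop
  have : IsFiniteMeasure ((gaussDesign n p).map fun G => ∑ i, inner ℝ (G i) (a i)) :=
    Measure.isFiniteMeasure_map _ _
  refine Measure.ext_of_charFun ?_
  ext t
  rw [charFun_gaussianReal, charFun_apply_real, integral_map hm.aemeasurable (by fun_prop)]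
  have h : ∀ G : Design n p, Complex.exp (t * ((∑ i, inner ℝ (G i) (a i) : ℝ) : ℂ) * Complex.I)
      = ∏ i, Complex.exp ((inner ℝ (G i) (t • a i) : ℝ) * Complex.I) := by
    intro G
    rw [← Complex.exp_sum, ← Finset.sum_mul]
    simp_rw [inner_smul_right]
    push_cast
    rw [Finset.mul_sum]
  simp_rw [h]
  rw [integral_fintype_prod_eq_prod
    (f := fun i (z : Vec p) => Complex.exp ((inner ℝ z (t • a i) : ℝ) * Complex.I))]
  have h2 : ∀ i, ∫ z, Complex.exp ((inner ℝ z (t • a i) : ℝ) * Complex.I) ∂stdGaussian (Vec p)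
      = Complex.exp (-(‖t • a i‖ ^ 2) / 2) := fun i => by
    rw [← charFun_stdGaussian, charFun_apply]
  simp_rw [h2]
  rw [← Complex.exp_sum]
  congr 1
  have h3 : (0 : ℝ) ≤ ∑ i, ‖a i‖ ^ 2 := by positivity
  simp only [norm_smul, Complex.ofReal_mul, mul_pow, mul_zero, zero_mul, Complex.ofReal_zero,
    NNReal.coe_mk, Real.sq_sqrt h3, mul_one, zero_sub]
  rw [← Finset.sum_div, Finset.sum_neg_distrib, ← Finset.mul_sum]
  push_cast
  simp [← Complex.ofReal_pow]
  ring

theorem integral_pow_two_gaussianReal : ∫ x, x ^ 2 ∂gaussianReal 0 1 = 1 := by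
  have h := variance_id_gaussianReal (μ := 0) (v := 1)
  rw [variance_eq_integral (by fun_prop)] at h
  simpa using h

theorem integral_inner_pow {p : ℕ} (w : Vec p) (k : ℕ) :
    ∫ z, inner ℝ z w ^ k ∂stdGaussian (Vec p) = ‖w‖ ^ k * ∫ x, x ^ k ∂gaussianReal 0 1 := by
  have hm : Measurable fun z : Vec p => inner ℝ z w := by fun_prop
  have h1 := integral_map (μ := stdGaussian (Vec p)) hm.aemeasurable
    (f := fun x : ℝ => x ^ k) (by fun_prop)
  have h2 := integral_map (μ := gaussianReal 0 1) (φ := fun x => ‖w‖ * x) (by fun_prop)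
    (f := fun x : ℝ => x ^ k) (by fun_prop)
  rw [← h1, map_inner_stdGaussian, h2, ← integral_const_mul]
  simp_rw [mul_pow]

theorem integral_inner {p : ℕ} (w : Vec p) : ∫ z, inner ℝ z w ∂stdGaussian (Vec p) = 0 := by
  have := integral_inner_pow w 1
  simpa [integral_id_gaussianReal] using this

theorem integral_inner_sq {p : ℕ} (w : Vec p) :
    ∫ z, inner ℝ z w ^ 2 ∂stdGaussian (Vec p) = ‖w‖ ^ 2 := by
  rw [integral_inner_pow, integral_pow_two_gaussianReal, mul_one]

theorem integral_inner_pow_four {p : ℕ} (w : Vec p) :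
    ∫ z, inner ℝ z w ^ 4 ∂stdGaussian (Vec p) = fourthMoment * ‖w‖ ^ 4 := by
  rw [integral_inner_pow, fourthMoment, mul_comm]

/-- A sum `∑ᵢ ⟨Gᵢ, aᵢ⟩` is Gaussian with variance `∑ᵢ ‖aᵢ‖²`. -/
theorem integral_sum_inner_pow_four {n p : ℕ} (a : Fin n → Vec p) :
    ∫ G, (∑ i, inner ℝ (G i) (a i)) ^ 4 ∂gaussDesign n p
      = fourthMoment * (∑ i, ‖a i‖ ^ 2) ^ 2 := by
  have hm : Measurable fun G : Design n p => ∑ i, inner ℝ (G i) (a i) := by fun_prop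
  have h1 := integral_map (μ := gaussDesign n p) hm.aemeasurable
    (f := fun x : ℝ => x ^ 4) (by fun_prop)
  have h2 := integral_map (μ := gaussianReal 0 1) (φ := fun x => √(∑ i, ‖a i‖ ^ 2) * x)
    (by fun_prop) (f := fun x : ℝ => x ^ 4) (by fun_prop)
  rw [← h1, map_sum_inner_gaussDesign, h2]
  simp_rw [mul_pow]
  rw [integral_const_mul, fourthMoment, mul_comm]
  congr 1
  have : √(∑ i, ‖a i‖ ^ 2) ^ 4 = (√(∑ i, ‖a i‖ ^ 2) ^ 2) ^ 2 := by ring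
  rw [this, Real.sq_sqrt (by positivity)]

/-! ### Functions of polynomial growth -/

/-- Continuous functions of polynomial growth; they are integrable for every Gaussian measure. -/
def PolyGrowth {E : Type*} [NormedAddCommGroup E] (F : E → ℝ) : Prop :=
  Continuous F ∧ ∃ (C : ℝ) (k : ℕ), ∀ x, |F x| ≤ C * (1 + ‖x‖) ^ k

namespace PolyGrowth

variable {E : Type*} [NormedAddCommGroup E] {F F' : E → ℝ}

theorem continuous (h : PolyGrowth F) : Continuous F := h.1

theorem exists_nonneg (h : PolyGrowth F) :
    ∃ (C : ℝ) (k : ℕ), 0 ≤ C ∧ ∀ x, |F x| ≤ C * (1 + ‖x‖) ^ k := by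
  obtain ⟨-, C, k, hC⟩ := h
  refine ⟨C, k, ?_, hC⟩
  simpa using (abs_nonneg (F 0)).trans (hC 0)

theorem of_le (h : PolyGrowth F) (hc : Continuous F') (hle : ∀ x, |F' x| ≤ F x) :
    PolyGrowth F' := by
  obtain ⟨-, C, k, hC⟩ := h
  exact ⟨hc, C, k, fun x => ((hle x).trans (le_abs_self _)).trans (hC x)⟩

theorem const (c : ℝ) : PolyGrowth fun _ : E => c :=
  ⟨continuous_const, |c|, 0, fun x => by simp⟩

theorem norm : PolyGrowth fun x : E => ‖x‖ :=
  ⟨continuous_norm, 1, 1, fun x => by simp⟩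

theorem mul (h : PolyGrowth F) (h' : PolyGrowth F') : PolyGrowth fun x => F x * F' x := by
  obtain ⟨C, k, hC0, hC⟩ := h.exists_nonneg
  obtain ⟨C', k', hC0', hC'⟩ := h'.exists_nonneg
  refine ⟨h.1.mul h'.1, C * C', k + k', fun x => ?_⟩
  rw [abs_mul]
  refine (mul_le_mul (hC x) (hC' x) (abs_nonneg _) (by positivity)).trans (le_of_eq ?_)
  ring

theorem add (h : PolyGrowth F) (h' : PolyGrowth F') : PolyGrowth fun x => F x + F' x := by
  obtain ⟨C, k, hC0, hC⟩ := h.exists_nonneg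
  obtain ⟨C', k', hC0', hC'⟩ := h'.exists_nonneg
  refine ⟨h.1.add h'.1, C + C', k + k', fun x => ?_⟩
  have h1 : (1 : ℝ) ≤ 1 + ‖x‖ := by linarith [norm_nonneg x]
  refine (abs_add_le _ _).trans ?_
  rw [add_mul]
  refine add_le_add ((hC x).trans ?_) ((hC' x).trans ?_)
  · exact mul_le_mul_of_nonneg_left (pow_le_pow_right₀ h1 (by omega)) hC0
  · exact mul_le_mul_of_nonneg_left (pow_le_pow_right₀ h1 (by omega)) hC0'

theorem const_mul (h : PolyGrowth F) (c : ℝ) : PolyGrowth fun x => c * F x := (const c).mul h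

theorem div_const (h : PolyGrowth F) (c : ℝ) : PolyGrowth fun x => F x / c := by
  simpa only [div_eq_inv_mul] using h.const_mul c⁻¹

theorem sub (h : PolyGrowth F) (h' : PolyGrowth F') : PolyGrowth fun x => F x - F' x := by
  simpa [sub_eq_add_neg] using h.add (h'.const_mul (-1))

theorem pow (h : PolyGrowth F) (m : ℕ) : PolyGrowth fun x => F x ^ m := by
  induction m with
  | zero => simpa using const (E := E) 1
  | succ m ih => simpa only [pow_succ] using ih.mul h

theorem sum {ι : Type*} {f : ι → E → ℝ} (s : Finset ι) (h : ∀ i ∈ s, PolyGrowth (f i)) :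
    PolyGrowth fun x => ∑ i ∈ s, f i x := by
  classical
  induction s using Finset.induction_on with
  | empty => simpa using const (E := E) 0
  | insert a s ha ih =>
    simp_rw [Finset.sum_insert ha]
    exact (h a (Finset.mem_insert_self _ _)).add
      (ih fun i hi => h i (Finset.mem_insert_of_mem hi))

theorem comp (h : PolyGrowth F) {E' : Type*} [NormedAddCommGroup E'] {φ : E' → E}
    (hφ : Continuous φ) (hle : ∀ x, ‖φ x‖ ≤ ‖x‖) : PolyGrowth fun x => F (φ x) := by
  obtain ⟨C, k, hC0, hC⟩ := h.exists_nonneg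
  refine ⟨h.1.comp hφ, C, k, fun x => (hC _).trans ?_⟩
  have := hle x
  gcongr

theorem inner {p : ℕ} {V W : E → Vec p} (hV : PolyGrowth fun x => ‖V x‖)
    (hW : PolyGrowth fun x => ‖W x‖) (hVc : Continuous V) (hWc : Continuous W) :
    PolyGrowth fun x => inner ℝ (V x) (W x) :=
  (hV.mul hW).of_le (hVc.inner hWc) fun _ => abs_real_inner_le_norm _ _

theorem integrable [NormedSpace ℝ E] [CompleteSpace E] [SecondCountableTopology E]
    [MeasurableSpace E] [BorelSpace E] (h : PolyGrowth F) (ν : Measure E) [IsGaussian ν] :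
    Integrable F ν := by
  obtain ⟨C, k, hC0, hC⟩ := h.exists_nonneg
  have h0 : MemLp (fun x : E => ‖x‖) (k : ENNReal) ν :=
    MemLp.norm (IsGaussian.memLp_id ν (k : ENNReal) (ENNReal.natCast_ne_top k))
  have h1 : MemLp (fun x : E => 1 + ‖x‖) (k : ENNReal) ν :=
    MemLp.add (f := fun _ : E => (1 : ℝ)) (memLp_const (1 : ℝ)) h0
  have h3 : Integrable (fun x : E => ‖1 + ‖x‖‖ ^ k) ν := h1.integrable_norm_pow'
  have h2 : Integrable (fun x : E => C * ‖1 + ‖x‖‖ ^ k) ν := h3.const_mul C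
  refine h2.mono' h.1.aestronglyMeasurable (Filter.Eventually.of_forall fun x => ?_)
  have h4 : ‖1 + ‖x‖‖ = 1 + ‖x‖ := Real.norm_of_nonneg (by positivity)
  rw [h4, Real.norm_eq_abs]
  exact hC x

end PolyGrowth

instance isGaussian_gaussDesign (n p : ℕ) : IsGaussian (gaussDesign n p) := by
  have h1 : iIndepFun (fun (i : Fin n) (G : Design n p) => G i) (gaussDesign n p) :=
    iIndepFun_pi (X := fun _ x => x) fun i => aemeasurable_id
  have h2 : ∀ i : Fin n, HasGaussianLaw (fun G : Design n p => G i) (gaussDesign n p) := fun i => by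
    refine ⟨?_⟩
    have := (measurePreserving_eval (fun _ : Fin n => stdGaussian (Vec p)) i).map_eq
    change IsGaussian ((gaussDesign n p).map (Function.eval i))
    rw [this]
    infer_instance
  have h3 := (iIndepFun.hasGaussianLaw h2 h1).isGaussian_map
  have h4 : (gaussDesign n p).map (fun G i => G i) = gaussDesign n p := Measure.map_id
  rwa [h4] at h3

theorem polyGrowth_row {n p : ℕ} (i : Fin n) : PolyGrowth fun G : Design n p => ‖G i‖ :=
  PolyGrowth.norm.of_le (by fun_prop) fun G => by
    rw [abs_norm]
    exact norm_le_pi_norm G i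

theorem integral_norm_sq_stdGaussian (p : ℕ) : ∫ z, ‖z‖ ^ 2 ∂stdGaussian (Vec p) = p := by
  have h : ∀ z : Vec p, ‖z‖ ^ 2 = ∑ j, inner ℝ z (EuclideanSpace.single j 1) ^ 2 := fun z => by
    rw [EuclideanSpace.real_norm_sq_eq]
    simp [EuclideanSpace.inner_single_right]
  simp_rw [h]
  rw [integral_finsetSum]
  · simp_rw [integral_inner_sq]
    simp
  · intro j _
    exact ((PolyGrowth.inner PolyGrowth.norm (PolyGrowth.const _) continuous_id
      continuous_const).pow 2).integrable _

theorem integral_norm_pow_four_le (p : ℕ) :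
    ∫ z, ‖z‖ ^ 4 ∂stdGaussian (Vec p) ≤ p ^ 2 * fourthMoment := by
  have h : ∀ z : Vec p, ‖z‖ ^ 4 ≤ p * ∑ j, inner ℝ z (EuclideanSpace.single j 1) ^ 4 := fun z => by
    have h1 : ‖z‖ ^ 4 = (∑ j, inner ℝ z (EuclideanSpace.single j 1) ^ 2) ^ 2 := by
      have : ‖z‖ ^ 4 = (‖z‖ ^ 2) ^ 2 := by ring
      rw [this, EuclideanSpace.real_norm_sq_eq]
      simp [EuclideanSpace.inner_single_right]
    rw [h1]
    have := sq_sum_le_card_mul_sum_sq (s := Finset.univ)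
      (f := fun j : Fin p => inner ℝ z (EuclideanSpace.single j 1) ^ 2)
    simpa [← pow_mul] using this
  have hi : ∀ j : Fin p, Integrable (fun z : Vec p => inner ℝ z (EuclideanSpace.single j 1) ^ 4)
      (stdGaussian (Vec p)) := fun j =>
    ((PolyGrowth.inner PolyGrowth.norm (PolyGrowth.const _) continuous_id
      continuous_const).pow 4).integrable _
  refine (integral_mono ((PolyGrowth.norm.pow 4).integrable _)
    ((integrable_finsetSum _ fun j _ => hi j).const_mul _) h).trans ?_
  rw [integral_const_mul, integral_finsetSum _ fun j _ => hi j]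
  simp_rw [integral_inner_pow_four]
  simp
  apply le_of_eq
  ring

/-! ### Deleting rows -/

/-- The design in which the rows with index in `s` are replaced by zero. -/
def mask {n p : ℕ} (s : Finset (Fin n)) (G : Design n p) : Design n p :=
  fun i => if i ∈ s then 0 else G i

theorem mask_apply {n p : ℕ} (s : Finset (Fin n)) (G : Design n p) (i : Fin n) :
    mask s G i = if i ∈ s then 0 else G i := rfl

theorem mask_update {n p : ℕ} {s : Finset (Fin n)} {k : Fin n} (hk : k ∈ s) (G : Design n p)
    (z : Vec p) : mask s (Function.update G k z) = mask s G := by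
  ext1 i
  by_cases hi : i = k
  · subst hi; simp [mask, hk]
  · simp [mask, Function.update_of_ne hi]

theorem mask_mask {n p : ℕ} (s t : Finset (Fin n)) (G : Design n p) :
    mask s (mask t G) = mask (s ∪ t) G := by
  ext1 i
  by_cases hs : i ∈ s <;> by_cases ht : i ∈ t <;> simp [mask, hs, ht]

theorem mask_empty {n p : ℕ} (G : Design n p) : mask ∅ G = G := by
  ext1 i; simp [mask]

theorem mask_singleton_update {n p : ℕ} {i k : Fin n} (hik : i ≠ k) (G : Design n p) (z : Vec p) :
    mask {k} (Function.update G i z) = Function.update (mask {k} G) i z := by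
  ext1 j
  by_cases hj : j = i
  · subst hj; simp [mask, hik]
  · simp [mask, Function.update_of_ne hj]

theorem continuous_mask {n p : ℕ} (s : Finset (Fin n)) :
    Continuous (mask s : Design n p → Design n p) := by
  refine continuous_pi fun i => ?_
  by_cases hi : i ∈ s
  · simpa [mask, hi] using continuous_const
  · simpa [mask, hi] using continuous_apply i

theorem norm_mask_le {n p : ℕ} (s : Finset (Fin n)) (G : Design n p) : ‖mask s G‖ ≤ ‖G‖ := by
  refine (pi_norm_le_iff_of_nonneg (norm_nonneg _)).2 fun i => ?_
  by_cases hi : i ∈ s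
  · simp [mask, hi]
  · simpa [mask, hi] using norm_le_pi_norm G i

theorem PolyGrowth.mask {n p : ℕ} {F : Design n p → ℝ} (hF : PolyGrowth F) (s : Finset (Fin n)) :
    PolyGrowth fun G => F (mask s G) :=
  hF.comp (continuous_mask s) (norm_mask_le s)

theorem integral_eq_zero_of_resample {n p : ℕ} {F : Design n p → ℝ} (hF : PolyGrowth F) (i : Fin n)
    (h : ∀ G, ∫ z, F (Function.update G i z) ∂stdGaussian (Vec p) = 0) :
    ∫ G, F G ∂gaussDesign n p = 0 := by
  rw [integral_resample i (hF.integrable _)]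
  simp [h]

/-- A variance bound for a sum of variables `φ i`, each centered conditionally on the rows other
than the `i`-th: the covariance of `φ i` and `φ k` only involves the effect of row `k` on `φ i` and
the effect of row `i` on `φ k`. -/
theorem integral_sum_sq_le {n p : ℕ} {φ : Fin n → Design n p → ℝ} (hφ : ∀ i, PolyGrowth (φ i))
    (h0 : ∀ i G, ∫ z, φ i (Function.update G i z) ∂stdGaussian (Vec p) = 0) :
    ∫ G, (∑ i, φ i G) ^ 2 ∂gaussDesign n p
      ≤ ∑ i, ∫ G, φ i G ^ 2 ∂gaussDesign n p
        + ∑ i, ∑ k ∈ Finset.univ.erase i,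
          ∫ G, (φ i G - φ i (mask {k} G)) ^ 2 ∂gaussDesign n p := by
  have hint : ∀ i k, Integrable (fun G => φ i G * φ k G) (gaussDesign n p) := fun i k =>
    ((hφ i).mul (hφ k)).integrable _
  have hsq : ∀ i k, PolyGrowth fun G => (φ i G - φ i (mask {k} G)) ^ 2 := fun i k =>
    ((hφ i).sub ((hφ i).mask {k})).pow 2
  -- multiplying by a function that is free of row `i` preserves the centering
  have hz : ∀ i (f f' : Design n p → ℝ), PolyGrowth f → PolyGrowth f' →
      (∀ G, ∫ z, f (Function.update G i z) ∂stdGaussian (Vec p) = 0) →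
      (∀ G z, f' (Function.update G i z) = f' G) → ∫ G, f G * f' G ∂gaussDesign n p = 0 := by
    intro i f f' hf hf' h1 h2
    refine integral_eq_zero_of_resample (hf.mul hf') i fun G => ?_
    simp_rw [h2]
    rw [integral_mul_const, h1, zero_mul]
  have hcross : ∀ i k, i ≠ k → ∫ G, φ i G * φ k G ∂gaussDesign n p
      ≤ (∫ G, (φ i G - φ i (mask {k} G)) ^ 2 ∂gaussDesign n p) / 2
        + (∫ G, (φ k G - φ k (mask {i} G)) ^ 2 ∂gaussDesign n p) / 2 := by
    intro i k hik
    have z1 : ∫ G, φ i G * φ k (mask {i} G) ∂gaussDesign n p = 0 :=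
      hz i _ _ (hφ i) ((hφ k).mask {i}) (h0 i) fun G z => by rw [mask_update (by simp)]
    have z2 : ∫ G, φ k G * φ i (mask {k} G) ∂gaussDesign n p = 0 :=
      hz k _ _ (hφ k) ((hφ i).mask {k}) (h0 k) fun G z => by rw [mask_update (by simp)]
    have z3 : ∫ G, φ i (mask {k} G) * φ k (mask {i} G) ∂gaussDesign n p = 0 :=
      hz i _ _ ((hφ i).mask {k}) ((hφ k).mask {i})
        (fun G => by simp_rw [mask_singleton_update hik]; exact h0 i _)
        fun G z => by rw [mask_update (by simp)]
    -- the expectation of a product does not change when each factor is recentered by its value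
    -- with the other row deleted
    have e : ∫ G, φ i G * φ k G ∂gaussDesign n p
        = ∫ G, (φ i G - φ i (mask {k} G)) * (φ k G - φ k (mask {i} G)) ∂gaussDesign n p := by
      have i1 := ((hφ i).mul ((hφ k).mask {i})).integrable (gaussDesign n p)
      have i2 := ((hφ k).mul ((hφ i).mask {k})).integrable (gaussDesign n p)
      have i3 := (((hφ i).mask {k}).mul ((hφ k).mask {i})).integrable (gaussDesign n p)
      have : ∀ G, (φ i G - φ i (mask {k} G)) * (φ k G - φ k (mask {i} G))
          = φ i G * φ k G - φ i G * φ k (mask {i} G) - φ k G * φ i (mask {k} G)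
            + φ i (mask {k} G) * φ k (mask {i} G) := fun G => by ring
      simp_rw [this]
      have j1 : Integrable (fun G => φ i G * φ k G - φ i G * φ k (mask {i} G)) (gaussDesign n p) :=
        (hint i k).sub i1
      have j2 : Integrable (fun G => φ i G * φ k G - φ i G * φ k (mask {i} G)
          - φ k G * φ i (mask {k} G)) (gaussDesign n p) := j1.sub i2
      rw [integral_add j2 i3, integral_sub j1 i2, integral_sub (hint i k) i1, z1, z2, z3]
      ring
    rw [e, ← integral_div, ← integral_div, ← integral_add (((hsq i k).integrable _).div_const _)
      (((hsq k i).integrable _).div_const _)]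
    refine integral_mono ((((hφ i).sub ((hφ i).mask {k})).mul
      ((hφ k).sub ((hφ k).mask {i}))).integrable _)
      ((((hsq i k).integrable _).div_const _).add (((hsq k i).integrable _).div_const _))
      fun G => ?_
    change _ ≤ (φ i G - φ i (mask {k} G)) ^ 2 / 2 + (φ k G - φ k (mask {i} G)) ^ 2 / 2
    nlinarith [sq_nonneg ((φ i G - φ i (mask {k} G)) - (φ k G - φ k (mask {i} G)))]
  have hexp : ∫ G, (∑ i, φ i G) ^ 2 ∂gaussDesign n p
      = ∑ i, ∑ k, ∫ G, φ i G * φ k G ∂gaussDesign n p := by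
    simp_rw [sq, Finset.sum_mul_sum]
    rw [integral_finsetSum _ fun i _ => integrable_finsetSum _ fun k _ => hint i k]
    refine Finset.sum_congr rfl fun i _ => ?_
    rw [integral_finsetSum _ fun k _ => hint i k]
  set T : Fin n → Fin n → ℝ := fun i k =>
    ∫ G, (φ i G - φ i (mask {k} G)) ^ 2 ∂gaussDesign n p with hT
  have hsum : ∀ i, ∑ k, ∫ G, φ i G * φ k G ∂gaussDesign n p
      ≤ ∫ G, φ i G ^ 2 ∂gaussDesign n p + ∑ k ∈ Finset.univ.erase i, (T i k / 2 + T k i / 2) := by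
    intro i
    rw [← Finset.add_sum_erase _ _ (Finset.mem_univ i)]
    refine add_le_add (le_of_eq (by simp_rw [sq])) (Finset.sum_le_sum fun k hk => ?_)
    exact hcross i k (Finset.ne_of_mem_erase hk).symm
  rw [hexp]
  refine (Finset.sum_le_sum fun i _ => hsum i).trans (le_of_eq ?_)
  rw [Finset.sum_add_distrib]
  congr 1
  have hswap : ∑ i, ∑ k ∈ Finset.univ.erase i, T k i / 2
      = ∑ i, ∑ k ∈ Finset.univ.erase i, T i k / 2 := by
    refine Finset.sum_comm' fun i k => ?_
    simp only [Finset.mem_univ, Finset.mem_erase, true_and, and_true]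
    exact ne_comm
  simp_rw [Finset.sum_add_distrib]
  rw [hswap, ← Finset.sum_add_distrib]
  refine Finset.sum_congr rfl fun i _ => ?_
  rw [← Finset.sum_div]
  ring

/-! ### Moments of the estimator and of its leave-one-out versions -/

/-- A bound that holds on average over row `k`, for every value of the other rows, may be integrated. -/
theorem integral_resample_le {n p : ℕ} {F B : Design n p → ℝ} (hF : PolyGrowth F)
    (hF0 : ∀ G, 0 ≤ F G) (hB : PolyGrowth B) (k : Fin n)
    (h : ∀ G, ∫ z, F (Function.update G k z) ∂stdGaussian (Vec p) ≤ B G) :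
    ∫ G, F G ∂gaussDesign n p ≤ ∫ G, B G ∂gaussDesign n p := by
  rw [integral_resample k (hF.integrable _)]
  exact integral_mono_of_nonneg
    (Filter.Eventually.of_forall fun G => integral_nonneg fun z => hF0 _)
    (hB.integrable _) (Filter.Eventually.of_forall h)

/-- Jensen's inequality for the square. -/
theorem PolyGrowth.integral_le_of_sq {E : Type*} [NormedAddCommGroup E] [NormedSpace ℝ E]
    [CompleteSpace E] [SecondCountableTopology E] [MeasurableSpace E] [BorelSpace E] {F : E → ℝ}
    (hF : PolyGrowth F) (ν : Measure E) [IsGaussian ν] {K : ℝ} (hK : 0 ≤ K)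
    (h : ∫ x, F x ^ 2 ∂ν ≤ K ^ 2) : ∫ x, F x ∂ν ≤ K := by
  set m := ∫ x, F x ∂ν with hm
  have h1 : 0 ≤ ∫ x, (F x - m) ^ 2 ∂ν := integral_nonneg fun x => sq_nonneg _
  have i1 := (hF.pow 2).integrable ν
  have i2 : Integrable (fun x => 2 * m * F x) ν := (hF.integrable ν).const_mul _
  have i3 : Integrable (fun x => F x ^ 2 - 2 * m * F x) ν := i1.sub i2
  have h2 : ∫ x, (F x - m) ^ 2 ∂ν = ∫ x, F x ^ 2 ∂ν - 2 * m * m + m ^ 2 := by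
    have : ∀ x, (F x - m) ^ 2 = F x ^ 2 - 2 * m * F x + m ^ 2 := fun x => by ring
    simp_rw [this]
    rw [integral_add i3 (integrable_const _), integral_sub i1 i2, integral_const_mul, ← hm]
    simp
  rw [h2] at h1
  exact abs_le_of_sq_le_sq' (by linarith) hK |>.2

theorem polyGrowth_norm_sum_smul {n p : ℕ} (c : Fin n → ℝ) :
    PolyGrowth fun G : Design n p => ‖∑ i, c i • G i‖ := by
  refine (PolyGrowth.sum Finset.univ fun i _ => (polyGrowth_row i).const_mul |c i|).of_le
    (by fun_prop) fun G => ?_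
  rw [abs_norm]
  refine (norm_sum_le _ _).trans (le_of_eq ?_)
  simp_rw [norm_smul, Real.norm_eq_abs]

theorem polyGrowth_inner_row {n p : ℕ} (i : Fin n) (w : Vec p) :
    PolyGrowth fun G : Design n p => inner ℝ (G i) w :=
  PolyGrowth.inner (polyGrowth_row i) (PolyGrowth.const _) (by fun_prop) continuous_const

theorem integral_norm_sum_smul_pow_four_le {n p : ℕ} (c : Fin n → ℝ) :
    ∫ G : Design n p, ‖∑ i, c i • G i‖ ^ 4 ∂gaussDesign n p
      ≤ p ^ 2 * fourthMoment * (∑ i, c i ^ 2) ^ 2 := by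
  have h : ∀ G : Design n p, ‖∑ i, c i • G i‖ ^ 4
      ≤ p * ∑ j, (∑ i, inner ℝ (G i) (c i • EuclideanSpace.single j (1 : ℝ))) ^ 4 := fun G => by
    have h1 : ‖∑ i, c i • G i‖ ^ 4
        = (∑ j, (∑ i, inner ℝ (G i) (c i • EuclideanSpace.single j (1 : ℝ))) ^ 2) ^ 2 := by
      have : ‖∑ i, c i • G i‖ ^ 4 = (‖∑ i, c i • G i‖ ^ 2) ^ 2 := by ring
      rw [this, EuclideanSpace.real_norm_sq_eq]
      simp [EuclideanSpace.inner_single_right, inner_smul_right]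
    rw [h1]
    have := sq_sum_le_card_mul_sum_sq (s := Finset.univ)
      (f := fun j : Fin p => (∑ i, inner ℝ (G i) (c i • EuclideanSpace.single j (1 : ℝ))) ^ 2)
    simpa [← pow_mul] using this
  have hi : ∀ j : Fin p, Integrable (fun G : Design n p =>
      (∑ i, inner ℝ (G i) (c i • EuclideanSpace.single j (1 : ℝ))) ^ 4) (gaussDesign n p) :=
    fun j => ((PolyGrowth.sum _ fun i _ => polyGrowth_inner_row i _).pow 4).integrable _
  refine (integral_mono (((polyGrowth_norm_sum_smul c).pow 4).integrable _)
    ((integrable_finsetSum _ fun j _ => hi j).const_mul _) h).trans (le_of_eq ?_)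
  rw [integral_const_mul, integral_finsetSum _ fun j _ => hi j]
  simp_rw [integral_sum_inner_pow_four, norm_smul]
  simp
  ring

theorem integral_inner_row_pow {n p : ℕ} (i : Fin n) (w : Vec p) (k : ℕ) :
    ∫ G : Design n p, inner ℝ (G i) w ^ k ∂gaussDesign n p
      = ∫ z, inner ℝ z w ^ k ∂stdGaussian (Vec p) := by
  have := (measurePreserving_eval (fun _ : Fin n => stdGaussian (Vec p)) i).map_eq
  rw [← this, integral_map (measurable_pi_apply i).aemeasurable (by fun_prop)]

theorem integral_sum_inner_sq_sq_le {n p : ℕ} (w : Vec p) :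
    ∫ G : Design n p, (∑ i, inner ℝ (G i) w ^ 2) ^ 2 ∂gaussDesign n p
      ≤ n ^ 2 * fourthMoment * ‖w‖ ^ 4 := by
  have h : ∀ G : Design n p, (∑ i, inner ℝ (G i) w ^ 2) ^ 2 ≤ n * ∑ i, inner ℝ (G i) w ^ 4 :=
    fun G => by
      have := sq_sum_le_card_mul_sum_sq (s := Finset.univ) (f := fun i : Fin n => inner ℝ (G i) w ^ 2)
      simpa [← pow_mul] using this
  have hi : ∀ i : Fin n, Integrable (fun G : Design n p => inner ℝ (G i) w ^ 4)
      (gaussDesign n p) := fun i => ((polyGrowth_inner_row i w).pow 4).integrable _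
  refine (integral_mono (((PolyGrowth.sum _ fun i _ =>
    (polyGrowth_inner_row i w).pow 2).pow 2).integrable _)
    ((integrable_finsetSum _ fun j _ => hi j).const_mul _) h).trans (le_of_eq ?_)
  rw [integral_const_mul, integral_finsetSum _ fun j _ => hi j]
  simp_rw [integral_inner_row_pow, integral_inner_pow_four]
  simp
  ring

theorem integral_inner_sq_mul_inner_sq_le {p : ℕ} (v w : Vec p) :
    ∫ z, inner ℝ z v ^ 2 * inner ℝ z w ^ 2 ∂stdGaussian (Vec p)
      ≤ fourthMoment * ‖v‖ ^ 2 * ‖w‖ ^ 2 := by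
  by_cases hv : v = 0
  · simp [hv]
  by_cases hw : w = 0
  · simp [hw]
  have hv' : 0 < ‖v‖ ^ 2 := by positivity
  have hw' : 0 < ‖w‖ ^ 2 := by positivity
  have hP : ∀ u : Vec p, PolyGrowth fun z : Vec p => inner ℝ z u := fun u =>
    PolyGrowth.inner PolyGrowth.norm (PolyGrowth.const _) continuous_id continuous_const
  set a := ‖w‖ ^ 2 / ‖v‖ ^ 2 / 2 with ha
  set b := ‖v‖ ^ 2 / ‖w‖ ^ 2 / 2 with hb
  have hab : a * b = 1 / 4 := by rw [ha, hb]; field_simp; norm_num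
  have ha0 : 0 < a := by positivity
  have i1 : Integrable (fun z : Vec p => a * inner ℝ z v ^ 4) (stdGaussian (Vec p)) :=
    (((hP v).pow 4).integrable _).const_mul a
  have i2 : Integrable (fun z : Vec p => b * inner ℝ z w ^ 4) (stdGaussian (Vec p)) :=
    (((hP w).pow 4).integrable _).const_mul b
  have h : ∀ z : Vec p, inner ℝ z v ^ 2 * inner ℝ z w ^ 2
      ≤ a * inner ℝ z v ^ 4 + b * inner ℝ z w ^ 4 := fun z => by
    have hb' : b = 1 / (4 * a) := by rw [eq_div_iff (by positivity)]; linarith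
    have h1 : a * inner ℝ z v ^ 4 + b * inner ℝ z w ^ 4 - inner ℝ z v ^ 2 * inner ℝ z w ^ 2
        = (2 * a * inner ℝ z v ^ 2 - inner ℝ z w ^ 2) ^ 2 / (4 * a) := by
      rw [hb']; field_simp; ring
    have h2 : 0 ≤ (2 * a * inner ℝ z v ^ 2 - inner ℝ z w ^ 2) ^ 2 / (4 * a) := by positivity
    linarith
  refine (integral_mono ((((hP v).pow 2).mul ((hP w).pow 2)).integrable _) (i1.add i2) h).trans
    (le_of_eq ?_)
  have := integral_add i1 i2
  simp only [Pi.add_apply]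
  rw [this, integral_const_mul, integral_const_mul, integral_inner_pow_four,
    integral_inner_pow_four, ha, hb]
  field_simp
  ring

/-- The estimator computed without the observations in `s`. -/
noncomputable def maskedEstimator {n p : ℕ} (ρ : ℝ → ℝ) (g : Vec p → ℝ) (e : Vec n)
    (s : Finset (Fin n)) (G : Design n p) : Vec p :=
  mEstimator ρ g e (mask s G)

/-- The size of the problem with the design replaced by zero; it is the scale of all moment
bounds. -/
noncomputable def nullSize {n p : ℕ} (ρ : ℝ → ℝ) (g : Vec p → ℝ) (e : Vec n) : ℝ :=
  ‖mEstimator ρ g e (0 : Design n p)‖ ^ 2 + (∑ i, deriv ρ (e i) ^ 2) / n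

/-- A bound for the squared distance between the estimators with design `G` and with design `0`. -/
noncomputable def nullDistBound {n p : ℕ} (μ : ℝ) (ρ : ℝ → ℝ) (g : Vec p → ℝ) (e : Vec n)
    (s : Finset (Fin n)) (G : Design n p) : ℝ :=
  (∑ i, inner ℝ (G i) (mEstimator ρ g e (0 : Design n p)) ^ 2
    + ‖∑ i, (if i ∈ s then 0 else deriv ρ (e i)) • G i‖ ^ 2 / (n * μ)) / (n * μ)

/-- A bound for the squared effect on the estimator of deleting observation `k` in addition to the
observations in `s`. -/
noncomputable def looBound {n p : ℕ} (μ : ℝ) (ρ : ℝ → ℝ) (g : Vec p → ℝ) (e : Vec n)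
    (s : Finset (Fin n)) (k : Fin n) (G : Design n p) : ℝ :=
  (inner ℝ (G k) (maskedEstimator ρ g e (insert k s) G) ^ 2
    + deriv ρ (e k) ^ 2 * ‖G k‖ ^ 2 / (n * μ)) / (n * μ)

theorem score_zero_design {n p : ℕ} (ρ : ℝ → ℝ) (g : Vec p → ℝ) (e : Vec n) (i : Fin n) :
    score ρ g e (0 : Design n p) i = deriv ρ (e i) := by
  simp [score, residual_apply]

theorem maskedEstimator_update {n p : ℕ} (ρ : ℝ → ℝ) (g : Vec p → ℝ) (e : Vec n)
    {s : Finset (Fin n)} {k : Fin n} (hk : k ∈ s) (G : Design n p) (z : Vec p) :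
    maskedEstimator ρ g e s (Function.update G k z) = maskedEstimator ρ g e s G := by
  rw [maskedEstimator, mask_update hk, maskedEstimator]

theorem nullSize_nonneg {n p : ℕ} (ρ : ℝ → ℝ) (g : Vec p → ℝ) (e : Vec n) :
    0 ≤ nullSize ρ g e := by
  unfold nullSize; positivity

theorem sum_sq_le_nullSize {n p : ℕ} (hn : 1 ≤ n) (ρ : ℝ → ℝ) (g : Vec p → ℝ) (e : Vec n) :
    ∑ i, deriv ρ (e i) ^ 2 ≤ n * nullSize ρ g e := by
  have hn0 : (0 : ℝ) < n := by exact_mod_cast hn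
  unfold nullSize
  rw [mul_add, mul_div_cancel₀ _ hn0.ne']
  have : 0 ≤ n * ‖mEstimator ρ g e (0 : Design n p)‖ ^ 2 := by positivity
  linarith

theorem sq_norm_le_nullSize {n p : ℕ} (ρ : ℝ → ℝ) (g : Vec p → ℝ) (e : Vec n) :
    ‖mEstimator ρ g e (0 : Design n p)‖ ^ 2 ≤ nullSize ρ g e := by
  unfold nullSize
  have : 0 ≤ (∑ i, deriv ρ (e i) ^ 2) / n := by positivity
  linarith

namespace IsotropicProblem

variable {p : ℕ} {μ : ℝ} {ρ : ℝ → ℝ} {g : Vec p → ℝ} {n : ℕ}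

/-- The stability estimate, for the comparison with the zero design. -/
theorem stability_zero (H : IsotropicProblem μ ρ g) (hn : 1 ≤ n) (e : Vec n) (G : Design n p)
    (s : Finset (Fin n)) :
    n * μ * ‖maskedEstimator ρ g e s G - mEstimator ρ g e (0 : Design n p)‖ ^ 2
      + ∑ i, (score ρ g e (mask s G) i - deriv ρ (e i)) ^ 2
      ≤ n * μ * nullDistBound μ ρ g e s G := by
  have hn0 : (0 : ℝ) < n := by exact_mod_cast hn
  have hnμ : 0 < n * μ := mul_pos hn0 H.mu_pos
  have h := H.stability hn e e (mask s G) 0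
  simp only [score_zero_design] at h
  refine h.trans ?_
  rw [nullDistBound, mul_div_cancel₀ _ hnμ.ne']
  refine add_le_add (Finset.sum_le_sum fun i _ => ?_) (le_of_eq ?_)
  · by_cases hi : i ∈ s
    · simp [mask, hi]; positivity
    · simp [mask, hi]
  · congr 3
    refine Finset.sum_congr rfl fun i _ => ?_
    by_cases hi : i ∈ s <;> simp [mask, hi]

theorem norm_maskedEstimator_sq_le (H : IsotropicProblem μ ρ g) (hn : 1 ≤ n) (e : Vec n)
    (G : Design n p) (s : Finset (Fin n)) :
    ‖maskedEstimator ρ g e s G‖ ^ 2 ≤ 2 * nullSize ρ g e + 2 * nullDistBound μ ρ g e s G := by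
  have hn0 : (0 : ℝ) < n := by exact_mod_cast hn
  have hnμ : 0 < n * μ := mul_pos hn0 H.mu_pos
  have h := H.stability_zero hn e G s
  have h0 : 0 ≤ ∑ i, (score ρ g e (mask s G) i - deriv ρ (e i)) ^ 2 := by positivity
  have h1 : ‖maskedEstimator ρ g e s G - mEstimator ρ g e (0 : Design n p)‖ ^ 2
      ≤ nullDistBound μ ρ g e s G := le_of_mul_le_mul_left (by linarith) hnμ
  have h2 := sq_norm_le_nullSize (p := p) ρ g e
  have h3 : ‖maskedEstimator ρ g e s G‖
      ≤ ‖mEstimator ρ g e (0 : Design n p)‖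
        + ‖maskedEstimator ρ g e s G - mEstimator ρ g e (0 : Design n p)‖ := by
    have := norm_add_le (mEstimator ρ g e (0 : Design n p))
      (maskedEstimator ρ g e s G - mEstimator ρ g e (0 : Design n p))
    simpa using this
  have h4 : ‖maskedEstimator ρ g e s G‖ ^ 2 ≤ (‖mEstimator ρ g e (0 : Design n p)‖
        + ‖maskedEstimator ρ g e s G - mEstimator ρ g e (0 : Design n p)‖) ^ 2 := by gcongr
  nlinarith [sq_nonneg (‖mEstimator ρ g e (0 : Design n p)‖
    - ‖maskedEstimator ρ g e s G - mEstimator ρ g e (0 : Design n p)‖)]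

theorem polyGrowth_nullDistBound (μ : ℝ) (ρ : ℝ → ℝ) (g : Vec p → ℝ) (e : Vec n)
    (s : Finset (Fin n)) : PolyGrowth fun G : Design n p => nullDistBound μ ρ g e s G :=
  ((PolyGrowth.sum _ fun i _ => (polyGrowth_inner_row i _).pow 2).add
    (((polyGrowth_norm_sum_smul _).pow 2).div_const _)).div_const _

theorem continuous_comp_mask {F : Type*} [TopologicalSpace F] {f : Vec n × Design n p → F}
    (hf : Continuous f) (e : Vec n) (s : Finset (Fin n)) :
    Continuous fun G : Design n p => f (e, mask s G) := by
  have h : Continuous fun G : Design n p => ((e, mask s G) : Vec n × Design n p) :=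
    Continuous.prodMk continuous_const (continuous_mask s)
  exact hf.comp h

theorem continuous_maskedEstimator (H : IsotropicProblem μ ρ g) (hn : 1 ≤ n) (e : Vec n)
    (s : Finset (Fin n)) : Continuous fun G : Design n p => maskedEstimator ρ g e s G :=
  continuous_comp_mask (f := fun z : Vec n × Design n p => mEstimator ρ g z.1 z.2)
    (H.continuous_mEstimator hn) e s

theorem polyGrowth_maskedEstimator (H : IsotropicProblem μ ρ g) (hn : 1 ≤ n) (e : Vec n)
    (s : Finset (Fin n)) : PolyGrowth fun G : Design n p => ‖maskedEstimator ρ g e s G‖ := by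
  refine (((PolyGrowth.const (1 + 2 * nullSize ρ g e)).add
    ((polyGrowth_nullDistBound μ ρ g e s).const_mul 2))).of_le
    (H.continuous_maskedEstimator hn e s).norm fun G => ?_
  have := H.norm_maskedEstimator_sq_le hn e G s
  rw [abs_norm]
  nlinarith [sq_nonneg (‖maskedEstimator ρ g e s G‖ - 1), norm_nonneg (maskedEstimator ρ g e s G)]

theorem polyGrowth_inner_maskedEstimator (H : IsotropicProblem μ ρ g) (hn : 1 ≤ n) (e : Vec n)
    (s : Finset (Fin n)) (i : Fin n) :
    PolyGrowth fun G : Design n p => inner ℝ (G i) (maskedEstimator ρ g e s G) :=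
  PolyGrowth.inner (polyGrowth_row i) (H.polyGrowth_maskedEstimator hn e s) (by fun_prop)
    (H.continuous_maskedEstimator hn e s)

theorem polyGrowth_looBound (H : IsotropicProblem μ ρ g) (hn : 1 ≤ n) (e : Vec n)
    (s : Finset (Fin n)) (k : Fin n) :
    PolyGrowth fun G : Design n p => looBound μ ρ g e s k G :=
  (((H.polyGrowth_inner_maskedEstimator hn e _ k).pow 2).add
    ((((polyGrowth_row k).pow 2).const_mul _).div_const _)).div_const _

/-- The leave-one-out perturbation bound. -/
theorem norm_maskedEstimator_sub_sq_le (H : IsotropicProblem μ ρ g) (hn : 1 ≤ n) (e : Vec n)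
    (G : Design n p) {s : Finset (Fin n)} {k : Fin n} (hk : k ∉ s) :
    ‖maskedEstimator ρ g e s G - maskedEstimator ρ g e (insert k s) G‖ ^ 2
      ≤ looBound μ ρ g e s k G := by
  have hn0 : (0 : ℝ) < n := by exact_mod_cast hn
  have hnμ : 0 < n * μ := mul_pos hn0 H.mu_pos
  have h := H.stability hn e e (mask s G) (mask (insert k s) G)
  have h0 : 0 ≤ ∑ i, (score ρ g e (mask s G) i - score ρ g e (mask (insert k s) G) i) ^ 2 := by
    positivity
  have hrow : ∀ i, mask s G i - mask (insert k s) G i = if i = k then G k else 0 := fun i => by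
    by_cases hi : i = k
    · subst hi; simp [mask, hk]
    · simp [mask, hi]
  have hs : score ρ g e (mask (insert k s) G) k = deriv ρ (e k) := by
    simp [score, residual_apply, mask]
  rw [looBound, le_div_iff₀ hnμ]
  have e1 : ∑ i, (e i - e i - inner ℝ (mask s G i - mask (insert k s) G i)
      (mEstimator ρ g e (mask (insert k s) G))) ^ 2
      = inner ℝ (G k) (maskedEstimator ρ g e (insert k s) G) ^ 2 := by
    simp_rw [hrow]
    rw [Finset.sum_eq_single k]
    · simp [maskedEstimator]
    · intro i _ hi; simp [hi]
    · simp
  have e2 : ∑ i, score ρ g e (mask (insert k s) G) i • (mask s G i - mask (insert k s) G i)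
      = deriv ρ (e k) • G k := by
    simp_rw [hrow]
    rw [Finset.sum_eq_single k]
    · simp [hs]
    · intro i _ hi; simp [hi]
    · simp
  rw [e1, e2, norm_smul, mul_pow, Real.norm_eq_abs, sq_abs] at h
  unfold maskedEstimator at h ⊢
  linarith

end IsotropicProblem

/-- The constant in the fourth moment bound for the estimator. -/
noncomputable def momentConst (γ μ : ℝ) : ℝ :=
  8 * (1 + 2 * fourthMoment / μ ^ 2 * (1 + γ ^ 2 / μ ^ 2))

/-- The constant in the bound for the mean squared effect of deleting an observation. -/
noncomputable def looConst (γ μ : ℝ) : ℝ := (momentConst γ μ + γ / μ) / μ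

/-- The constant in the bound for the change of the squared norm of the estimator when an
observation is deleted. -/
noncomputable def looSqConst (γ μ : ℝ) : ℝ :=
  2 * (2 * fourthMoment / μ ^ 2 * (momentConst γ μ + γ ^ 2 / μ ^ 2))
    + 8 * (momentConst γ μ * (1 + γ / μ) / μ)

theorem one_le_momentConst (γ μ : ℝ) : 1 ≤ momentConst γ μ := by
  have h := fourthMoment_nonneg
  have : 0 ≤ 2 * fourthMoment / μ ^ 2 * (1 + γ ^ 2 / μ ^ 2) := by positivity
  unfold momentConst
  linarith

namespace IsotropicProblem

variable {p : ℕ} {γ μ : ℝ} {ρ : ℝ → ℝ} {g : Vec p → ℝ} {n : ℕ}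

theorem looConst_nonneg (H : IsotropicProblem μ ρ g) (hγ : 0 < γ) : 0 ≤ looConst γ μ := by
  have := H.mu_pos
  have := one_le_momentConst γ μ
  unfold looConst
  positivity

theorem looSqConst_nonneg (H : IsotropicProblem μ ρ g) (hγ : 0 < γ) : 0 ≤ looSqConst γ μ := by
  have := H.mu_pos
  have := one_le_momentConst γ μ
  have := fourthMoment_nonneg
  unfold looSqConst
  positivity

/-- The distance to the estimator for the zero design has bounded moments on the scale `nullSize`:
given `e`, the vector `h₀` is deterministic, so `∑ᵢ ⟨Gᵢ, h₀⟩²` and `∑ᵢ ψ(eᵢ) Gᵢ` have explicit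
Gaussian moments. -/
theorem integral_nullDistBound_sq_le (H : IsotropicProblem μ ρ g) (hn : 1 ≤ n)
    (hp : (p : ℝ) ≤ γ * n) (e : Vec n) (s : Finset (Fin n)) :
    ∫ G : Design n p, nullDistBound μ ρ g e s G ^ 2 ∂gaussDesign n p
      ≤ 2 * fourthMoment / μ ^ 2 * (1 + γ ^ 2 / μ ^ 2) * nullSize ρ g e ^ 2 := by
  have hn0 : (0 : ℝ) < n := by exact_mod_cast hn
  have hμ := H.mu_pos
  have hnμ : 0 < n * μ := mul_pos hn0 H.mu_pos
  set D := nullSize ρ g e with hD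
  have hD0 : 0 ≤ D := nullSize_nonneg ρ g e
  set h0 := mEstimator ρ g e (0 : Design n p) with hh0
  set c : Fin n → ℝ := fun i => if i ∈ s then 0 else deriv ρ (e i) with hc
  have hm4 := fourthMoment_nonneg
  have hpt : ∀ G : Design n p, nullDistBound μ ρ g e s G ^ 2
      ≤ 2 / (n * μ) ^ 2 * (∑ i, inner ℝ (G i) h0 ^ 2) ^ 2
        + 2 / (n * μ) ^ 4 * ‖∑ i, c i • G i‖ ^ 4 := fun G => by
    have e1 : nullDistBound μ ρ g e s G = (∑ i, inner ℝ (G i) h0 ^ 2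
      + ‖∑ i, c i • G i‖ ^ 2 / (n * μ)) / (n * μ) := rfl
    have e2 : 2 / (n * μ) ^ 2 * (∑ i, inner ℝ (G i) h0 ^ 2) ^ 2
        + 2 / (n * μ) ^ 4 * ‖∑ i, c i • G i‖ ^ 4
        = (2 * (∑ i, inner ℝ (G i) h0 ^ 2) ^ 2 + 2 * (‖∑ i, c i • G i‖ ^ 2 / (n * μ)) ^ 2)
          / (n * μ) ^ 2 := by
      field_simp
    rw [e1, e2, div_pow]
    gcongr
    nlinarith [sq_nonneg ((∑ i, inner ℝ (G i) h0 ^ 2) - ‖∑ i, c i • G i‖ ^ 2 / (n * μ))]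
  have i1 : Integrable (fun G : Design n p => 2 / (n * μ) ^ 2 * (∑ i, inner ℝ (G i) h0 ^ 2) ^ 2)
      (gaussDesign n p) := ((PolyGrowth.sum _ fun i _ =>
    (polyGrowth_inner_row i h0).pow 2).pow 2).integrable _ |>.const_mul _
  have i2 : Integrable (fun G : Design n p => 2 / (n * μ) ^ 4 * ‖∑ i, c i • G i‖ ^ 4)
      (gaussDesign n p) := ((polyGrowth_norm_sum_smul c).pow 4).integrable _ |>.const_mul _
  refine (integral_mono (((polyGrowth_nullDistBound μ ρ g e s).pow 2).integrable _)
    (i1.add i2) hpt).trans ?_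
  have h12 := integral_add i1 i2
  simp only [Pi.add_apply]
  rw [h12, integral_const_mul, integral_const_mul]
  have b1 := integral_sum_inner_sq_sq_le (n := n) h0
  have b2 := integral_norm_sum_smul_pow_four_le (p := p) c
  have b3 : ‖h0‖ ^ 4 ≤ D ^ 2 := by
    have := sq_norm_le_nullSize (p := p) ρ g e
    have h2 : (‖h0‖ ^ 2) ^ 2 ≤ D ^ 2 := by gcongr
    linarith [show ‖h0‖ ^ 4 = (‖h0‖ ^ 2) ^ 2 by ring]
  have b4 : ∑ i, c i ^ 2 ≤ n * D := by
    refine (Finset.sum_le_sum fun i _ => ?_).trans (sum_sq_le_nullSize hn ρ g e)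
    by_cases hi : i ∈ s
    · simp [hc, hi]; positivity
    · simp [hc, hi]
  have b5 : (∑ i, c i ^ 2) ^ 2 ≤ (n * D) ^ 2 := by gcongr
  have b6 : (p : ℝ) ^ 2 ≤ (γ * n) ^ 2 := by gcongr
  calc _ ≤ 2 / (n * μ) ^ 2 * (n ^ 2 * fourthMoment * D ^ 2)
        + 2 / (n * μ) ^ 4 * ((γ * n) ^ 2 * fourthMoment * (n * D) ^ 2) := by
        refine add_le_add ?_ ?_
        · gcongr; exact b1.trans (by gcongr)
        · gcongr; exact b2.trans (by gcongr)
    _ = _ := by field_simp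

theorem integral_norm_pow_four_le (H : IsotropicProblem μ ρ g) (hn : 1 ≤ n)
    (hp : (p : ℝ) ≤ γ * n) (e : Vec n) (s : Finset (Fin n)) :
    ∫ G : Design n p, ‖maskedEstimator ρ g e s G‖ ^ 4 ∂gaussDesign n p
      ≤ momentConst γ μ * nullSize ρ g e ^ 2 := by
  have hR := H.integral_nullDistBound_sq_le hn hp e s
  have hP := polyGrowth_nullDistBound μ ρ g e s
  set D := nullSize ρ g e with hD
  have hD0 : 0 ≤ D := nullSize_nonneg ρ g e
  have hpt : ∀ G : Design n p, ‖maskedEstimator ρ g e s G‖ ^ 4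
      ≤ 8 * D ^ 2 + 8 * nullDistBound μ ρ g e s G ^ 2 := fun G => by
    have h1 := H.norm_maskedEstimator_sq_le hn e G s
    have h2 : (‖maskedEstimator ρ g e s G‖ ^ 2) ^ 2
      ≤ (2 * D + 2 * nullDistBound μ ρ g e s G) ^ 2 := by gcongr
    nlinarith [sq_nonneg (D - nullDistBound μ ρ g e s G)]
  have i2 : Integrable (fun G : Design n p => 8 * nullDistBound μ ρ g e s G ^ 2)
      (gaussDesign n p) := ((hP.pow 2).integrable _).const_mul _
  refine (integral_mono (((H.polyGrowth_maskedEstimator hn e s).pow 4).integrable _)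
    ((integrable_const _).add i2) hpt).trans ?_
  have h12 := integral_add (integrable_const (μ := gaussDesign n p) (8 * D ^ 2)) i2
  simp only [Pi.add_apply]
  rw [h12]
  simp only [integral_const_mul, integral_const, probReal_univ, smul_eq_mul, one_mul]
  unfold momentConst
  nlinarith

theorem integral_norm_sq_le (H : IsotropicProblem μ ρ g) (hn : 1 ≤ n)
    (hp : (p : ℝ) ≤ γ * n) (e : Vec n) (s : Finset (Fin n)) :
    ∫ G : Design n p, ‖maskedEstimator ρ g e s G‖ ^ 2 ∂gaussDesign n p
      ≤ momentConst γ μ * nullSize ρ g e := by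
  have h1 := one_le_momentConst γ μ
  have hD0 : 0 ≤ nullSize ρ g e := nullSize_nonneg ρ g e
  refine ((H.polyGrowth_maskedEstimator hn e s).pow 2).integral_le_of_sq _ (by positivity) ?_
  simp_rw [← pow_mul]
  refine (H.integral_norm_pow_four_le hn hp e s).trans ?_
  rw [mul_pow]
  gcongr
  nlinarith

theorem integral_nullDistBound_le (H : IsotropicProblem μ ρ g) (hn : 1 ≤ n)
    (hp : (p : ℝ) ≤ γ * n) (e : Vec n) (s : Finset (Fin n)) :
    ∫ G : Design n p, nullDistBound μ ρ g e s G ∂gaussDesign n p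
      ≤ momentConst γ μ * nullSize ρ g e := by
  have h1 := one_le_momentConst γ μ
  have hD0 : 0 ≤ nullSize ρ g e := nullSize_nonneg ρ g e
  refine (polyGrowth_nullDistBound μ ρ g e s).integral_le_of_sq _ (by positivity) ?_
  refine (H.integral_nullDistBound_sq_le hn hp e s).trans ?_
  rw [mul_pow]
  gcongr
  have : 2 * fourthMoment / μ ^ 2 * (1 + γ ^ 2 / μ ^ 2) ≤ momentConst γ μ := by
    have h := fourthMoment_nonneg
    have : 0 ≤ 2 * fourthMoment / μ ^ 2 * (1 + γ ^ 2 / μ ^ 2) := by positivity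
    unfold momentConst
    linarith
  nlinarith

theorem polyGrowth_score (H : IsotropicProblem μ ρ g) (hn : 1 ≤ n) (e : Vec n) (i : Fin n) :
    PolyGrowth fun G : Design n p => score ρ g e G i := by
  have h1 : PolyGrowth fun G : Design n p => ‖G i‖ * ‖maskedEstimator ρ g e ∅ G‖ :=
    (polyGrowth_row i).mul (H.polyGrowth_maskedEstimator hn e ∅)
  have hc : Continuous fun G : Design n p => score ρ g e G i := by
    have h := continuous_comp_mask (f := fun z : Vec n × Design n p => score ρ g z.1 z.2 i)
      (H.continuous_score hn i) e ∅
    simpa only [mask_empty] using h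
  refine ((PolyGrowth.const |e i|).add h1).of_le hc fun G => ?_
  rw [maskedEstimator, mask_empty]
  refine (H.abs_deriv_le _).trans ?_
  rw [residual_apply]
  exact (abs_sub _ _).trans (add_le_add le_rfl (abs_real_inner_le_norm _ _))

theorem integral_sum_score_sq_le (H : IsotropicProblem μ ρ g) (hn : 1 ≤ n)
    (hp : (p : ℝ) ≤ γ * n) (e : Vec n) :
    ∫ G : Design n p, ∑ i, score ρ g e G i ^ 2 ∂gaussDesign n p
      ≤ n * ((2 + 2 * μ * momentConst γ μ) * nullSize ρ g e) := by
  have hn0 : (0 : ℝ) < n := by exact_mod_cast hn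
  have hμ := H.mu_pos
  set D := nullSize ρ g e with hD
  have hpt : ∀ G : Design n p, ∑ i, score ρ g e G i ^ 2
      ≤ 2 * (n * D) + 2 * (n * μ) * nullDistBound μ ρ g e ∅ G := fun G => by
    have h1 := H.stability_zero hn e G ∅
    have h2 := sum_sq_le_nullSize (p := p) hn ρ g e
    rw [mask_empty] at h1
    have h3 : ∑ i, score ρ g e G i ^ 2 ≤ 2 * ∑ i, (score ρ g e G i - deriv ρ (e i)) ^ 2
        + 2 * ∑ i, deriv ρ (e i) ^ 2 := by
      rw [Finset.mul_sum, Finset.mul_sum, ← Finset.sum_add_distrib]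
      refine Finset.sum_le_sum fun i _ => ?_
      nlinarith [sq_nonneg (score ρ g e G i - 2 * deriv ρ (e i))]
    have h4 : 0 ≤ n * μ * ‖maskedEstimator ρ g e ∅ G - mEstimator ρ g e (0 : Design n p)‖ ^ 2 := by
      positivity
    linarith
  have i2 : Integrable (fun G : Design n p => 2 * (n * μ) * nullDistBound μ ρ g e ∅ G)
      (gaussDesign n p) := ((polyGrowth_nullDistBound μ ρ g e ∅).integrable _).const_mul _
  refine (integral_mono ((PolyGrowth.sum _ fun i _ =>
    (H.polyGrowth_score hn e i).pow 2).integrable _)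
    ((integrable_const _).add i2) hpt).trans ?_
  have h12 := integral_add (integrable_const (μ := gaussDesign n p) (2 * (n * D))) i2
  simp only [Pi.add_apply]
  rw [h12]
  simp only [integral_const_mul, integral_const, probReal_univ, smul_eq_mul, one_mul]
  have hR := H.integral_nullDistBound_le hn hp e ∅
  have : 2 * (n * μ) * ∫ G : Design n p, nullDistBound μ ρ g e ∅ G ∂gaussDesign n p
      ≤ 2 * (n * μ) * (momentConst γ μ * D) := by gcongr
  linarith

theorem sq_deriv_le_nullSize (hn : 1 ≤ n) (e : Vec n) (k : Fin n) :
    deriv ρ (e k) ^ 2 ≤ n * nullSize ρ g e :=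
  (Finset.single_le_sum (f := fun i => deriv ρ (e i) ^ 2) (fun _ _ => sq_nonneg _)
    (Finset.mem_univ k)).trans (sum_sq_le_nullSize hn ρ g e)

theorem polyGrowth_inner_right (w : Vec p) : PolyGrowth fun z : Vec p => inner ℝ z w :=
  PolyGrowth.inner PolyGrowth.norm (PolyGrowth.const _) continuous_id continuous_const

/-- The expected effect of deleting row `k`: the remaining estimator is independent of row `k`, which
can be averaged out first. -/
theorem integral_looBound_le (H : IsotropicProblem μ ρ g) (hγ : 0 < γ) (hn : 1 ≤ n)
    (hp : (p : ℝ) ≤ γ * n) (e : Vec n) (s : Finset (Fin n)) (k : Fin n) :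
    ∫ G : Design n p, looBound μ ρ g e s k G ∂gaussDesign n p
      ≤ looConst γ μ * ((nullSize ρ g e + deriv ρ (e k) ^ 2) / n) := by
  have hn0 : (0 : ℝ) < n := by exact_mod_cast hn
  have hμ := H.mu_pos
  have hM := one_le_momentConst γ μ
  set D := nullSize ρ g e with hD
  have hD0 : 0 ≤ D := nullSize_nonneg ρ g e
  set t := deriv ρ (e k) with ht
  have hv := H.polyGrowth_maskedEstimator hn e (insert k s)
  have hres : ∀ G : Design n p, ∫ z, looBound μ ρ g e s k (Function.update G k z)
      ∂stdGaussian (Vec p) ≤ 1 / (n * μ) * ‖maskedEstimator ρ g e (insert k s) G‖ ^ 2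
        + t ^ 2 * p / (n * μ) ^ 2 := fun G => by
    simp_rw [looBound, maskedEstimator_update ρ g e (Finset.mem_insert_self k s),
      Function.update_self]
    have j1 := ((polyGrowth_inner_right (maskedEstimator ρ g e (insert k s) G)).pow 2).integrable
      (stdGaussian (Vec p))
    have j2 : Integrable (fun z : Vec p => t ^ 2 * ‖z‖ ^ 2 / (n * μ)) (stdGaussian (Vec p)) :=
      (((PolyGrowth.norm.pow 2).const_mul (t ^ 2)).div_const (n * μ)).integrable _
    rw [integral_div, integral_add j1 j2, integral_div, integral_const_mul, integral_inner_sq,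
      integral_norm_sq_stdGaussian]
    apply le_of_eq
    field_simp
  have hB : PolyGrowth fun G : Design n p => 1 / (n * μ)
      * ‖maskedEstimator ρ g e (insert k s) G‖ ^ 2 + t ^ 2 * p / (n * μ) ^ 2 :=
    ((hv.pow 2).const_mul _).add (PolyGrowth.const _)
  refine (integral_resample_le (H.polyGrowth_looBound hn e s k)
    (fun G => by unfold looBound; positivity) hB k hres).trans ?_
  rw [integral_add (((hv.pow 2).const_mul _).integrable _) (integrable_const _),
    integral_const_mul]
  simp only [integral_const, probReal_univ, smul_eq_mul, one_mul]
  have h1 := H.integral_norm_sq_le hn hp e (insert k s)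
  calc _ ≤ 1 / (n * μ) * (momentConst γ μ * D) + t ^ 2 * (γ * n) / (n * μ) ^ 2 := by gcongr
    _ = (momentConst γ μ * D + γ / μ * t ^ 2) / μ / n := by field_simp
    _ ≤ (momentConst γ μ * (D + t ^ 2) + γ / μ * (D + t ^ 2)) / μ / n := by
        gcongr
        · linarith [sq_nonneg t]
        · linarith
    _ = _ := by unfold looConst; ring

/-- The leave-one-out effects add up to the order of `nullSize`. -/
theorem sum_nullSize_add (hn : 1 ≤ n) (e : Vec n) :
    ∑ k, (nullSize ρ g e + deriv ρ (e k) ^ 2) / n ≤ 2 * nullSize ρ g e := by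
  have hn0 : (0 : ℝ) < n := by exact_mod_cast hn
  rw [← Finset.sum_div, div_le_iff₀ hn0, Finset.sum_add_distrib]
  have := sum_sq_le_nullSize (p := p) hn ρ g e
  simp only [Finset.sum_const, Finset.card_univ, Fintype.card_fin, nsmul_eq_mul]
  linarith

/-- A second-order leave-one-out bound. -/
theorem integral_looBound_sq_le (H : IsotropicProblem μ ρ g) (hγ : 0 < γ) (hn : 1 ≤ n)
    (hp : (p : ℝ) ≤ γ * n) (e : Vec n) (s : Finset (Fin n)) (k : Fin n) :
    ∫ G : Design n p, (2 * looBound μ ρ g e s k G ^ 2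
        + 8 * (looBound μ ρ g e s k G * ‖maskedEstimator ρ g e (insert k s) G‖ ^ 2))
          ∂gaussDesign n p
      ≤ looSqConst γ μ * (nullSize ρ g e * ((nullSize ρ g e + deriv ρ (e k) ^ 2) / n)) := by
  have hn0 : (0 : ℝ) < n := by exact_mod_cast hn
  have hn1 : (1 : ℝ) ≤ n := by exact_mod_cast hn
  have hμ := H.mu_pos
  have hm4 := fourthMoment_nonneg
  have hM := one_le_momentConst γ μ
  have hloo := H.polyGrowth_looBound hn e s k
  have hst := sq_deriv_le_nullSize (ρ := ρ) (g := g) hn e k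
  set D := nullSize ρ g e with hD
  have hD0 : 0 ≤ D := nullSize_nonneg ρ g e
  set t := deriv ρ (e k) with ht
  set m := fourthMoment with hm
  have hv := H.polyGrowth_maskedEstimator hn e (insert k s)
  set c := n * μ with hc
  have hc0 : 0 < c := mul_pos hn0 hμ
  have hp0 : (0 : ℝ) ≤ p := by positivity
  have hres : ∀ G : Design n p, ∫ z, (2 * looBound μ ρ g e s k (Function.update G k z) ^ 2
      + 8 * (looBound μ ρ g e s k (Function.update G k z)
        * ‖maskedEstimator ρ g e (insert k s) (Function.update G k z)‖ ^ 2)) ∂stdGaussian (Vec p)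
      ≤ (4 * m / c ^ 2 + 8 / c) * ‖maskedEstimator ρ g e (insert k s) G‖ ^ 4
        + 8 * t ^ 2 * p / c ^ 2 * ‖maskedEstimator ρ g e (insert k s) G‖ ^ 2
        + 4 * t ^ 4 * (p ^ 2 * m) / c ^ 4 := fun G => by
    simp_rw [looBound, maskedEstimator_update ρ g e (Finset.mem_insert_self k s),
      Function.update_self]
    rw [← hc, ← ht]
    set w := maskedEstimator ρ g e (insert k s) G with hw
    have hP := polyGrowth_inner_right w
    have hN : PolyGrowth fun z : Vec p => ‖z‖ := PolyGrowth.norm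
    have j4 := (((hP.pow 4).const_mul (4 / c ^ 2)).integrable (stdGaussian (Vec p)))
    have jn4 := (((hN.pow 4).const_mul (4 * t ^ 4 / c ^ 4)).integrable (stdGaussian (Vec p)))
    have j2 := (((hP.pow 2).const_mul (8 * ‖w‖ ^ 2 / c)).integrable (stdGaussian (Vec p)))
    have jn2 := (((hN.pow 2).const_mul (8 * ‖w‖ ^ 2 * t ^ 2 / c ^ 2)).integrable
      (stdGaussian (Vec p)))
    have k1 : Integrable (fun z : Vec p => 4 / c ^ 2 * inner ℝ z w ^ 4
        + 4 * t ^ 4 / c ^ 4 * ‖z‖ ^ 4) (stdGaussian (Vec p)) := j4.add jn4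
    have k2 : Integrable (fun z : Vec p => 8 * ‖w‖ ^ 2 / c * inner ℝ z w ^ 2
        + 8 * ‖w‖ ^ 2 * t ^ 2 / c ^ 2 * ‖z‖ ^ 2) (stdGaussian (Vec p)) := j2.add jn2
    have hQ : PolyGrowth fun z : Vec p => (inner ℝ z w ^ 2 + t ^ 2 * ‖z‖ ^ 2 / c) / c :=
      ((hP.pow 2).add (((hN.pow 2).const_mul _).div_const _)).div_const _
    refine (integral_mono ((((hQ.pow 2).const_mul 2).add
      ((hQ.mul (PolyGrowth.const _)).const_mul 8)).integrable _) (k1.add k2) fun z => ?_).trans ?_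
    · simp only [Pi.add_apply]
      have : 4 / c ^ 2 * inner ℝ z w ^ 4 + 4 * t ^ 4 / c ^ 4 * ‖z‖ ^ 4
          = (4 * (inner ℝ z w ^ 2) ^ 2 + 4 * (t ^ 2 * ‖z‖ ^ 2 / c) ^ 2) / c ^ 2 := by
        field_simp
      rw [this, div_pow]
      refine add_le_add ?_ (le_of_eq (by field_simp))
      rw [← mul_div_assoc]
      gcongr
      nlinarith [sq_nonneg (inner ℝ z w ^ 2 - t ^ 2 * ‖z‖ ^ 2 / c)]
    · have h12 := integral_add k1 k2
      simp only [Pi.add_apply]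
      rw [h12, integral_add j4 jn4, integral_add j2 jn2]
      simp only [integral_const_mul]
      rw [integral_inner_pow_four, integral_inner_sq, integral_norm_sq_stdGaussian, ← hm]
      have := RobustReg.integral_norm_pow_four_le p
      rw [← hm] at this
      calc _ ≤ 4 / c ^ 2 * (m * ‖w‖ ^ 4) + 4 * t ^ 4 / c ^ 4 * (p ^ 2 * m)
            + (8 * ‖w‖ ^ 2 / c * ‖w‖ ^ 2 + 8 * ‖w‖ ^ 2 * t ^ 2 / c ^ 2 * p) := by gcongr
        _ = _ := by ring
  have hB4 := (hv.pow 4).const_mul (4 * m / c ^ 2 + 8 / c)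
  have hB2 := (hv.pow 2).const_mul (8 * t ^ 2 * p / c ^ 2)
  have hB := (hB4.add hB2).add (PolyGrowth.const (4 * t ^ 4 * (p ^ 2 * m) / c ^ 4))
  have hq0 : ∀ G, 0 ≤ looBound μ ρ g e s k G := fun G => by unfold looBound; positivity
  refine (integral_resample_le (((hloo.pow 2).const_mul 2).add
      ((hloo.mul (hv.pow 2)).const_mul 8))
    (fun G => by have := hq0 G; positivity) hB k hres).trans ?_
  rw [integral_add ((hB4.add hB2).integrable _) (integrable_const _),
    integral_add (hB4.integrable _) (hB2.integrable _), integral_const_mul, integral_const_mul]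
  simp only [integral_const, probReal_univ, smul_eq_mul, one_mul]
  have h1 := H.integral_norm_sq_le hn hp e (insert k s)
  have h4 := H.integral_norm_pow_four_le hn hp e (insert k s)
  have hp2 : (p : ℝ) ^ 2 ≤ (γ * n) ^ 2 := by gcongr
  have ht4 : t ^ 4 ≤ t ^ 2 * (n * D) := by
    have : t ^ 4 = t ^ 2 * t ^ 2 := by ring
    rw [this]; gcongr
  set M := momentConst γ μ with hMdef
  calc _ ≤ (4 * m / c ^ 2 + 8 / c) * (M * D ^ 2) + 8 * t ^ 2 * (γ * n) / c ^ 2 * (M * D)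
        + 4 * (t ^ 2 * (n * D)) * ((γ * n) ^ 2 * m) / c ^ 4 := by gcongr
    _ = 4 * m * M / μ ^ 2 * (D ^ 2 / n) * (1 / n) + 8 * M / μ * (D ^ 2 / n)
        + 8 * γ * M / μ ^ 2 * (D * t ^ 2 / n) + 4 * m * γ ^ 2 / μ ^ 4 * (D * t ^ 2 / n) := by
        rw [hc]; field_simp
    _ ≤ 4 * m * M / μ ^ 2 * (D ^ 2 / n) * 1 + 8 * M / μ * (D ^ 2 / n)
        + 8 * γ * M / μ ^ 2 * (D * t ^ 2 / n) + 4 * m * γ ^ 2 / μ ^ 4 * (D * t ^ 2 / n) := by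
        gcongr
        rw [div_le_one hn0]; exact hn1
    _ ≤ (4 * m * M / μ ^ 2 * (D ^ 2 / n) * 1 + 8 * M / μ * (D ^ 2 / n)
        + 8 * γ * M / μ ^ 2 * (D * t ^ 2 / n) + 4 * m * γ ^ 2 / μ ^ 4 * (D * t ^ 2 / n))
        + (4 * m * M / μ ^ 2 * (D * t ^ 2 / n) + 8 * M / μ * (D * t ^ 2 / n)
        + 8 * γ * M / μ ^ 2 * (D ^ 2 / n) + 4 * m * γ ^ 2 / μ ^ 4 * (D ^ 2 / n)) := by
        have : 0 ≤ 4 * m * M / μ ^ 2 * (D * t ^ 2 / n) + 8 * M / μ * (D * t ^ 2 / n)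
          + 8 * γ * M / μ ^ 2 * (D ^ 2 / n) + 4 * m * γ ^ 2 / μ ^ 4 * (D ^ 2 / n) := by positivity
        linarith
    _ = _ := by
        unfold looSqConst
        rw [← hMdef, ← hm]
        field_simp
        ring

end IsotropicProblem

/-! ### Fluctuations of the leave-one-out predictions -/

theorem maskedEstimator_empty {n p : ℕ} (ρ : ℝ → ℝ) (g : Vec p → ℝ) (e : Vec n)
    (G : Design n p) : maskedEstimator ρ g e ∅ G = mEstimator ρ g e G := by
  rw [maskedEstimator, mask_empty]

theorem maskedEstimator_mask {n p : ℕ} (ρ : ℝ → ℝ) (g : Vec p → ℝ) (e : Vec n)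
    (s : Finset (Fin n)) (k : Fin n) (G : Design n p) :
    maskedEstimator ρ g e s (mask {k} G) = maskedEstimator ρ g e (insert k s) G := by
  rw [maskedEstimator, mask_mask, Finset.union_comm, ← Finset.insert_eq, maskedEstimator]

namespace IsotropicProblem

variable {p : ℕ} {γ μ : ℝ} {ρ : ℝ → ℝ} {g : Vec p → ℝ} {n : ℕ}

theorem polyGrowth_norm_maskedEstimator_sub (H : IsotropicProblem μ ρ g) (hn : 1 ≤ n) (e : Vec n)
    (s t : Finset (Fin n)) :
    PolyGrowth fun G : Design n p => ‖maskedEstimator ρ g e s G - maskedEstimator ρ g e t G‖ := by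
  refine ((H.polyGrowth_maskedEstimator hn e s).add (H.polyGrowth_maskedEstimator hn e t)).of_le
    ((H.continuous_maskedEstimator hn e s).sub (H.continuous_maskedEstimator hn e t)).norm
    fun G => ?_
  rw [abs_norm]
  exact norm_sub_le _ _

theorem integral_sum_norm_sub_sq_le (H : IsotropicProblem μ ρ g) (hγ : 0 < γ) (hn : 1 ≤ n)
    (hp : (p : ℝ) ≤ γ * n) (e : Vec n) :
    ∫ G : Design n p, ∑ i, ‖mEstimator ρ g e G - maskedEstimator ρ g e {i} G‖ ^ 2 ∂gaussDesign n p
      ≤ 2 * looConst γ μ * nullSize ρ g e := by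
  have hC := H.looConst_nonneg hγ
  have hi := fun i => ((H.polyGrowth_norm_maskedEstimator_sub hn e ∅ {i}).pow 2).integrable
    (gaussDesign n p)
  simp_rw [← maskedEstimator_empty]
  rw [integral_finsetSum _ fun i _ => hi i]
  have h1 : ∀ i, ∫ G : Design n p, ‖maskedEstimator ρ g e ∅ G - maskedEstimator ρ g e {i} G‖ ^ 2
      ∂gaussDesign n p ≤ looConst γ μ * ((nullSize ρ g e + deriv ρ (e i) ^ 2) / n) := fun i => by
    refine (integral_mono (hi i) ((H.polyGrowth_looBound hn e ∅ i).integrable _) fun G => ?_).trans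
      (H.integral_looBound_le hγ hn hp e ∅ i)
    have := H.norm_maskedEstimator_sub_sq_le hn e G (Finset.notMem_empty i)
    simpa using this
  refine (Finset.sum_le_sum fun i _ => h1 i).trans ?_
  rw [← Finset.mul_sum]
  have := sum_nullSize_add (ρ := ρ) (g := g) hn e
  have := mul_le_mul_of_nonneg_left this hC
  linarith

/-- The prediction for observation `i` by the estimator that does not use it has, conditionally on
the other observations, the variance of that estimator. -/
theorem integral_inner_maskedEstimator_sq (H : IsotropicProblem μ ρ g) (hn : 1 ≤ n) (e : Vec n)
    (i : Fin n) :
    ∫ G : Design n p, inner ℝ (G i) (maskedEstimator ρ g e {i} G) ^ 2 ∂gaussDesign n p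
      ≤ ∫ G : Design n p, ‖maskedEstimator ρ g e {i} G‖ ^ 2 ∂gaussDesign n p := by
  refine integral_resample_le ((H.polyGrowth_inner_maskedEstimator hn e {i} i).pow 2)
    (fun G => sq_nonneg _) ((H.polyGrowth_maskedEstimator hn e {i}).pow 2) i fun G => ?_
  simp_rw [maskedEstimator_update ρ g e (Finset.mem_singleton_self i), Function.update_self]
  exact (integral_inner_sq _).le

/-- The correlation of the frozen noise with the leave-one-out predictions is of the order of
`‖e‖` times the square root of `nullSize`, as it would be for independent predictions. -/
theorem integral_sum_mul_inner_sq_le (H : IsotropicProblem μ ρ g) (hγ : 0 < γ) (hn : 1 ≤ n)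
    (hp : (p : ℝ) ≤ γ * n) (e : Vec n) :
    ∫ G : Design n p, (∑ i, e i * inner ℝ (G i) (maskedEstimator ρ g e {i} G)) ^ 2
        ∂gaussDesign n p
      ≤ (momentConst γ μ + 2 * looConst γ μ) * (‖e‖ ^ 2 * nullSize ρ g e) := by
  have hC := H.looConst_nonneg hγ
  have hD0 := nullSize_nonneg ρ g e
  refine (integral_sum_sq_le
    (fun i => (H.polyGrowth_inner_maskedEstimator hn e {i} i).const_mul (e i)) ?_).trans ?_
  · intro i G
    simp_rw [maskedEstimator_update ρ g e (Finset.mem_singleton_self i), Function.update_self]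
    rw [integral_const_mul, integral_inner, mul_zero]
  have h1 : ∀ i, ∫ G : Design n p, (e i * inner ℝ (G i) (maskedEstimator ρ g e {i} G)) ^ 2
      ∂gaussDesign n p ≤ e i ^ 2 * (momentConst γ μ * nullSize ρ g e) := fun i => by
    simp_rw [mul_pow]
    rw [integral_const_mul]
    gcongr
    exact (H.integral_inner_maskedEstimator_sq hn e i).trans (H.integral_norm_sq_le hn hp e {i})
  have h2 : ∀ i, ∑ k ∈ Finset.univ.erase i, ∫ G : Design n p,
      (e i * inner ℝ (G i) (maskedEstimator ρ g e {i} G)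
        - e i * inner ℝ (mask {k} G i) (maskedEstimator ρ g e {i} (mask {k} G))) ^ 2
        ∂gaussDesign n p ≤ e i ^ 2 * (looConst γ μ * (2 * nullSize ρ g e)) := fun i => by
    have h3 : ∀ k ∈ Finset.univ.erase i, ∫ G : Design n p,
      (e i * inner ℝ (G i) (maskedEstimator ρ g e {i} G)
        - e i * inner ℝ (mask {k} G i) (maskedEstimator ρ g e {i} (mask {k} G))) ^ 2
        ∂gaussDesign n p
        ≤ e i ^ 2 * (looConst γ μ * ((nullSize ρ g e + deriv ρ (e k) ^ 2) / n)) := fun k hk => by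
      have hki : k ≠ i := Finset.ne_of_mem_erase hk
      have hkn : k ∉ ({i} : Finset (Fin n)) := by simpa using hki
      have e1 : ∀ G : Design n p, (e i * inner ℝ (G i) (maskedEstimator ρ g e {i} G)
        - e i * inner ℝ (mask {k} G i) (maskedEstimator ρ g e {i} (mask {k} G))) ^ 2
        = e i ^ 2 * inner ℝ (G i) (maskedEstimator ρ g e {i} G
          - maskedEstimator ρ g e (insert k {i}) G) ^ 2 := fun G => by
        rw [maskedEstimator_mask, mask_apply, if_neg (by simpa using hki.symm), inner_sub_right]
        ring
      simp_rw [e1]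
      rw [integral_const_mul]
      gcongr
      refine le_trans ?_ (H.integral_looBound_le hγ hn hp e {i} k)
      refine (integral_resample_le (k := i)
        (B := fun G => ‖maskedEstimator ρ g e {i} G - maskedEstimator ρ g e (insert k {i}) G‖ ^ 2)
        ((PolyGrowth.inner (polyGrowth_row i)
          (H.polyGrowth_norm_maskedEstimator_sub hn e {i} (insert k {i})) (by fun_prop)
          ((H.continuous_maskedEstimator hn e _).sub (H.continuous_maskedEstimator hn e _))).pow 2)
        (fun G => sq_nonneg _)
        ((H.polyGrowth_norm_maskedEstimator_sub hn e {i} (insert k {i})).pow 2)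
        fun G => ?_).trans ?_
      · simp_rw [maskedEstimator_update ρ g e (Finset.mem_singleton_self i),
          maskedEstimator_update ρ g e (Finset.mem_insert_of_mem (Finset.mem_singleton_self i)),
          Function.update_self]
        exact (integral_inner_sq _).le
      · exact integral_mono (((H.polyGrowth_norm_maskedEstimator_sub hn e _ _).pow 2).integrable _)
          ((H.polyGrowth_looBound hn e {i} k).integrable _)
          fun G => H.norm_maskedEstimator_sub_sq_le hn e G hkn
    refine (Finset.sum_le_sum h3).trans ?_
    rw [← Finset.mul_sum, ← Finset.mul_sum]
    gcongr
    exact (Finset.sum_le_sum_of_subset_of_nonneg (Finset.erase_subset _ _)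
        fun k _ _ => by positivity).trans (sum_nullSize_add hn e)
  refine (add_le_add (Finset.sum_le_sum fun i _ => h1 i) (Finset.sum_le_sum fun i _ => h2 i)).trans
    (le_of_eq ?_)
  rw [← Finset.sum_mul, ← Finset.sum_mul, ← EuclideanSpace.real_norm_sq_eq]
  ring

/-- Conditionally on the other observations, the difference of two centered quadratic forms
`⟨z, x⟩² - ‖x‖²` has variance controlled by `‖x - y‖² ‖x + y‖²`. -/
theorem integral_sq_sub_sq_le (x y : Vec p) :
    ∫ z, (inner ℝ z x ^ 2 - ‖x‖ ^ 2 - (inner ℝ z y ^ 2 - ‖y‖ ^ 2)) ^ 2 ∂stdGaussian (Vec p)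
      ≤ 2 * (fourthMoment + 1) * (‖x - y‖ ^ 2 * ‖x + y‖ ^ 2) := by
  have hd := polyGrowth_inner_right (x - y)
  have hs := polyGrowth_inner_right (x + y)
  have hx := polyGrowth_inner_right x
  have hy := polyGrowth_inner_right y
  have hpt : ∀ z : Vec p, (inner ℝ z x ^ 2 - ‖x‖ ^ 2 - (inner ℝ z y ^ 2 - ‖y‖ ^ 2)) ^ 2
      ≤ 2 * (inner ℝ z (x - y) ^ 2 * inner ℝ z (x + y) ^ 2)
        + 2 * (‖x - y‖ ^ 2 * ‖x + y‖ ^ 2) := fun z => by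
    have h1 : inner ℝ (x - y) (x + y) = ‖x‖ ^ 2 - ‖y‖ ^ 2 := by
      rw [inner_sub_left, inner_add_right, inner_add_right, real_inner_self_eq_norm_sq,
        real_inner_self_eq_norm_sq, real_inner_comm x y]
      ring
    have h2 := abs_le.1 (abs_real_inner_le_norm (x - y) (x + y))
    have h3 : inner ℝ (x - y) (x + y) ^ 2 ≤ ‖x - y‖ ^ 2 * ‖x + y‖ ^ 2 := by
      rw [← mul_pow]; exact sq_le_sq' h2.1 h2.2
    have h4 : inner ℝ z x ^ 2 - ‖x‖ ^ 2 - (inner ℝ z y ^ 2 - ‖y‖ ^ 2)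
        = inner ℝ z (x - y) * inner ℝ z (x + y) - inner ℝ (x - y) (x + y) := by
      rw [h1, inner_sub_right, inner_add_right]; ring
    rw [h4]
    nlinarith [sq_nonneg (inner ℝ z (x - y) * inner ℝ z (x + y) + inner ℝ (x - y) (x + y))]
  have i1 : Integrable (fun z : Vec p => 2 * (inner ℝ z (x - y) ^ 2 * inner ℝ z (x + y) ^ 2))
      (stdGaussian (Vec p)) := (((hd.pow 2).mul (hs.pow 2)).const_mul 2).integrable _
  refine (integral_mono (((((hx.pow 2).sub (PolyGrowth.const _)).sub
    ((hy.pow 2).sub (PolyGrowth.const _))).pow 2).integrable _)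
    (i1.add (integrable_const _)) hpt).trans ?_
  have h12 := integral_add i1
    (integrable_const (μ := stdGaussian (Vec p)) (2 * (‖x - y‖ ^ 2 * ‖x + y‖ ^ 2)))
  simp only [Pi.add_apply]
  rw [h12]
  rw [integral_const_mul]
  simp only [integral_const, probReal_univ, smul_eq_mul, one_mul]
  have := integral_inner_sq_mul_inner_sq_le (x - y) (x + y)
  linarith

/-- The sum of the squared leave-one-out predictions concentrates around the sum of their
conditional variances `‖h⁽ⁱ⁾‖²`. -/
theorem integral_sum_sq_sub_sq_le (H : IsotropicProblem μ ρ g) (hγ : 0 < γ) (hn : 1 ≤ n)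
    (hp : (p : ℝ) ≤ γ * n) (e : Vec n) :
    ∫ G : Design n p, (∑ i, (inner ℝ (G i) (maskedEstimator ρ g e {i} G) ^ 2
        - ‖maskedEstimator ρ g e {i} G‖ ^ 2)) ^ 2 ∂gaussDesign n p
      ≤ (fourthMoment + 1) * (momentConst γ μ + 4 * looSqConst γ μ) * (n * nullSize ρ g e ^ 2) := by
  have hC := H.looSqConst_nonneg hγ
  have hD0 := nullSize_nonneg ρ g e
  have hm4 := fourthMoment_nonneg
  have hb : ∀ i, PolyGrowth fun G : Design n p => inner ℝ (G i) (maskedEstimator ρ g e {i} G) ^ 2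
        - ‖maskedEstimator ρ g e {i} G‖ ^ 2 := fun i =>
    ((H.polyGrowth_inner_maskedEstimator hn e {i} i).pow 2).sub
      ((H.polyGrowth_maskedEstimator hn e {i}).pow 2)
  refine (integral_sum_sq_le hb ?_).trans ?_
  · intro i G
    simp_rw [maskedEstimator_update ρ g e (Finset.mem_singleton_self i), Function.update_self]
    rw [integral_sub (((polyGrowth_inner_right _).pow 2).integrable _) (integrable_const _),
      integral_inner_sq]
    simp
  have h1 : ∀ i, ∫ G : Design n p, (inner ℝ (G i) (maskedEstimator ρ g e {i} G) ^ 2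
      - ‖maskedEstimator ρ g e {i} G‖ ^ 2) ^ 2 ∂gaussDesign n p
      ≤ (fourthMoment + 1) * (momentConst γ μ * nullSize ρ g e ^ 2) := fun i => by
    refine (integral_resample_le (k := i)
      (B := fun G => (fourthMoment + 1) * ‖maskedEstimator ρ g e {i} G‖ ^ 4) ((hb i).pow 2)
      (fun G => sq_nonneg _) (((H.polyGrowth_maskedEstimator hn e {i}).pow 4).const_mul _)
      fun G => ?_).trans ?_
    · simp_rw [maskedEstimator_update ρ g e (Finset.mem_singleton_self i), Function.update_self]
      set w := maskedEstimator ρ g e {i} G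
      have i4 := ((polyGrowth_inner_right w).pow 4).integrable (stdGaussian (Vec p))
      refine (integral_mono ((((polyGrowth_inner_right w).pow 2).sub (PolyGrowth.const _)).pow
        2 |>.integrable _) (i4.add (integrable_const (‖w‖ ^ 4))) fun z => ?_).trans (le_of_eq ?_)
      · simp only [Pi.add_apply]
        have : 0 ≤ inner ℝ z w ^ 2 * ‖w‖ ^ 2 := by positivity
        nlinarith
      · have h12 := integral_add i4 (integrable_const (μ := stdGaussian (Vec p)) (‖w‖ ^ 4))
        simp only [Pi.add_apply]
        rw [h12, integral_inner_pow_four]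
        simp only [integral_const, probReal_univ, smul_eq_mul, one_mul]
        ring
    · rw [integral_const_mul]
      gcongr
      exact H.integral_norm_pow_four_le hn hp e {i}
  have h2 : ∀ i, ∑ k ∈ Finset.univ.erase i, ∫ G : Design n p,
      (inner ℝ (G i) (maskedEstimator ρ g e {i} G) ^ 2 - ‖maskedEstimator ρ g e {i} G‖ ^ 2
        - (inner ℝ (mask {k} G i) (maskedEstimator ρ g e {i} (mask {k} G)) ^ 2
          - ‖maskedEstimator ρ g e {i} (mask {k} G)‖ ^ 2)) ^ 2 ∂gaussDesign n p
      ≤ 2 * (fourthMoment + 1) * (looSqConst γ μ * (nullSize ρ g e * (2 * nullSize ρ g e))) :=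
    fun i => by
    have h3 : ∀ k ∈ Finset.univ.erase i, ∫ G : Design n p,
      (inner ℝ (G i) (maskedEstimator ρ g e {i} G) ^ 2 - ‖maskedEstimator ρ g e {i} G‖ ^ 2
        - (inner ℝ (mask {k} G i) (maskedEstimator ρ g e {i} (mask {k} G)) ^ 2
          - ‖maskedEstimator ρ g e {i} (mask {k} G)‖ ^ 2)) ^ 2 ∂gaussDesign n p
        ≤ 2 * (fourthMoment + 1) * (looSqConst γ μ * (nullSize ρ g e
          * ((nullSize ρ g e + deriv ρ (e k) ^ 2) / n))) := fun k hk => by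
      have hki : k ≠ i := Finset.ne_of_mem_erase hk
      have hkn : k ∉ ({i} : Finset (Fin n)) := by simpa using hki
      set q := fun G : Design n p => looBound μ ρ g e {i} k G with hq
      set v := fun G : Design n p => maskedEstimator ρ g e (insert k {i}) G with hv
      have hqP : PolyGrowth q := H.polyGrowth_looBound hn e {i} k
      have hvP : PolyGrowth fun G => ‖v G‖ := H.polyGrowth_maskedEstimator hn e (insert k {i})
      have hu := H.polyGrowth_maskedEstimator hn e {i}
      have huc := H.continuous_maskedEstimator hn e {i}
      have hvc := H.continuous_maskedEstimator hn e (insert k {i})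
      have hF := (hb i).sub ((hb i).mask {k})
      have hS : PolyGrowth fun G => ‖maskedEstimator ρ g e {i} G + v G‖ :=
        (hu.add hvP).of_le (huc.add hvc).norm fun G => by
          rw [abs_norm]; exact norm_add_le _ _
      refine (integral_resample_le (k := i)
        (B := fun G => 2 * (fourthMoment + 1) * (‖maskedEstimator ρ g e {i} G - v G‖ ^ 2
          * ‖maskedEstimator ρ g e {i} G + v G‖ ^ 2)) (hF.pow 2) (fun G => sq_nonneg _)
        ((((H.polyGrowth_norm_maskedEstimator_sub hn e {i} (insert k {i})).pow 2).mul
          (hS.pow 2)).const_mul _) fun G => ?_).trans ?_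
      · simp_rw [maskedEstimator_mask, mask_apply,
          if_neg (show i ∉ ({k} : Finset (Fin n)) by simpa using hki.symm),
          maskedEstimator_update ρ g e (Finset.mem_singleton_self i),
          maskedEstimator_update ρ g e (Finset.mem_insert_of_mem (Finset.mem_singleton_self i)),
          Function.update_self]
        exact integral_sq_sub_sq_le _ _
      · rw [integral_const_mul]
        refine mul_le_mul_of_nonneg_left ?_ (by positivity)
        refine le_trans ?_ (H.integral_looBound_sq_le hγ hn hp e {i} k)
        refine integral_mono
          ((((H.polyGrowth_norm_maskedEstimator_sub hn e {i} (insert k {i})).pow 2).mul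
            (hS.pow 2)).integrable _)
          ((((hqP.pow 2).const_mul 2).add ((hqP.mul (hvP.pow 2)).const_mul 8)).integrable _)
          fun G => ?_
        have hdq : ‖maskedEstimator ρ g e {i} G - v G‖ ^ 2 ≤ q G :=
          H.norm_maskedEstimator_sub_sq_le hn e G hkn
        have hsq : ‖maskedEstimator ρ g e {i} G + v G‖ ^ 2 ≤ 2 * q G + 8 * ‖v G‖ ^ 2 := by
          have e2 : maskedEstimator ρ g e {i} G + v G
              = (maskedEstimator ρ g e {i} G - v G) + (2 : ℝ) • v G := by module
          have e3 : ‖maskedEstimator ρ g e {i} G + v G‖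
              ≤ ‖maskedEstimator ρ g e {i} G - v G‖ + 2 * ‖v G‖ := by
            rw [e2]
            refine (norm_add_le _ _).trans (le_of_eq ?_)
            rw [norm_smul]; norm_num
          have e4 : ‖maskedEstimator ρ g e {i} G + v G‖ ^ 2
              ≤ (‖maskedEstimator ρ g e {i} G - v G‖ + 2 * ‖v G‖) ^ 2 := by gcongr
          nlinarith [sq_nonneg (‖maskedEstimator ρ g e {i} G - v G‖ - 2 * ‖v G‖)]
        have hq0 : 0 ≤ q G := (sq_nonneg _).trans hdq
        calc ‖maskedEstimator ρ g e {i} G - v G‖ ^ 2 * ‖maskedEstimator ρ g e {i} G + v G‖ ^ 2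
            ≤ q G * (2 * q G + 8 * ‖v G‖ ^ 2) := by gcongr
          _ = _ := by ring
    refine (Finset.sum_le_sum h3).trans ?_
    rw [← Finset.mul_sum, ← Finset.mul_sum, ← Finset.mul_sum]
    gcongr
    exact (Finset.sum_le_sum_of_subset_of_nonneg (Finset.erase_subset _ _)
        fun k _ _ => by positivity).trans (sum_nullSize_add hn e)
  refine (add_le_add (Finset.sum_le_sum fun i _ => h1 i) (Finset.sum_le_sum fun i _ => h2 i)).trans
    (le_of_eq ?_)
  simp only [Finset.sum_const, Finset.card_univ, Fintype.card_fin, nsmul_eq_mul]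
  ring

end IsotropicProblem

/-! ### Derivatives of the estimator in a row of the design -/

theorem norm_matMul_le {p : ℕ} (A : Matrix (Fin p) (Fin p) ℝ) (v : Vec p) :
    ‖matMul A v‖ ≤ ‖A‖ * ‖v‖ := by
  rw [← Matrix.l2_opNorm_toEuclideanCLM]
  exact (Matrix.toEuclideanCLM (𝕜 := ℝ) A).le_opNorm v

theorem matMul_single_apply {p : ℕ} (A : Matrix (Fin p) (Fin p) ℝ) (j k : Fin p) :
    matMul A (EuclideanSpace.single k 1) j = A j k := by
  simp [matMul]

theorem matMul_sub {p : ℕ} (A : Matrix (Fin p) (Fin p) ℝ) (v w : Vec p) :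
    matMul A (v - w) = matMul A v - matMul A w := map_sub _ _ _

theorem IsDerivMatrix.norm_le_of_isotropic {n p : ℕ} {μ : ℝ} {ρ : ℝ → ℝ} {g : Vec p → ℝ}
    {e : Vec n} {G : Design n p} {A : Matrix (Fin p) (Fin p) ℝ}
    (hA : IsDerivMatrix μ ρ g 1 e G A) : ‖A‖ ≤ ((n : ℝ) * μ)⁻¹ := by
  have := hA.norm_le
  rwa [CFC.sqrt_one, one_mul, mul_one] at this

/-- The divergence of `β̂` as a function of row `i` of the design. -/
noncomputable def rowDiv {n p : ℕ} (ρ : ℝ → ℝ) (g : Vec p → ℝ) (e : Vec n) (i : Fin n)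
    (G : Design n p) : ℝ :=
  ∑ j, pd j (fun z => mEstimator ρ g e (Function.update G i z) j) (G i)

section Derivatives

attribute [local irreducible] mEstimator

variable {n p : ℕ} {μ : ℝ} {ρ : ℝ → ℝ} {g : Vec p → ℝ} {e : Vec n} {G : Design n p}
  {A : Matrix (Fin p) (Fin p) ℝ}

/-- The partial derivatives of the estimator with respect to one row of the design. -/
theorem IsDerivMatrix.pd_row (hA : IsDerivMatrix μ ρ g 1 e G A) (i : Fin n) (j k : Fin p) :
    pd k (fun z => mEstimator ρ g e (Function.update G i z) j) (G i)
      = matMul A (score ρ g e G i • EuclideanSpace.single k 1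
        - (deriv (deriv ρ) (residual ρ g e G i) * mEstimator ρ g e G k) • G i) j := by
  have h1 : HasFDerivAt (fun z : Vec n × Design n p => mEstimator ρ g z.1 z.2)
      (fderiv ℝ (fun z : Vec n × Design n p => mEstimator ρ g z.1 z.2) (e, G))
      (e, Function.update G i (G i)) := by
    rw [Function.update_eq_self]
    exact hA.differentiableAt.hasFDerivAt
  have h2 : HasFDerivAt (fun z : Vec p => ((e, Function.update G i z) : Vec n × Design n p))
      ((0 : Vec p →L[ℝ] Vec n).prod (ContinuousLinearMap.pi (Pi.single i (.id ℝ (Vec p))))) (G i) :=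
    (hasFDerivAt_const e (G i)).prodMk (hasFDerivAt_update G (G i))
  have h3 := h1.comp (G i) h2
  have h4 := ((EuclideanSpace.proj j : Vec p →L[ℝ] ℝ).hasFDerivAt).comp (G i) h3
  have h5 : HasFDerivAt (fun z => mEstimator ρ g e (Function.update G i z) j) _ (G i) := h4
  rw [pd, h5.fderiv]
  have h6 : ((0 : Vec p →L[ℝ] Vec n).prod (ContinuousLinearMap.pi
      (Pi.single i (.id ℝ (Vec p))))) (EuclideanSpace.single k 1)
      = ((0, Pi.single i (EuclideanSpace.single k 1)) : Vec n × Design n p) := by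
    refine Prod.ext rfl ?_
    funext l
    by_cases hl : l = i
    · subst hl; simp
    · simp [hl]
  simp only [ContinuousLinearMap.comp_apply]
  rw [h6, hA.fderiv_eq, scoreDeriv_row, EuclideanSpace.inner_single_left]
  simp

theorem IsDerivMatrix.fderiv_noise (hA : IsDerivMatrix μ ρ g 1 e G A) (i : Fin n) :
    fderiv ℝ (fun e' : Vec n => mEstimator ρ g e' G) e (EuclideanSpace.single i 1)
      = deriv (deriv ρ) (residual ρ g e G i) • matMul A (G i) := by
  have h1 : HasFDerivAt (fun z : Vec n × Design n p => mEstimator ρ g z.1 z.2)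
      (fderiv ℝ (fun z : Vec n × Design n p => mEstimator ρ g z.1 z.2) (e, G)) (e, G) :=
    hA.differentiableAt.hasFDerivAt
  have h2 : HasFDerivAt (fun e' : Vec n => ((e', G) : Vec n × Design n p))
      ((ContinuousLinearMap.id ℝ (Vec n)).prod 0) e :=
    (hasFDerivAt_id e).prodMk (hasFDerivAt_const G e)
  have h3 := h1.comp e h2
  have h4 : HasFDerivAt (fun e' : Vec n => mEstimator ρ g e' G) _ e := h3
  rw [h4.fderiv, ← hA.deriv_y i]
  rfl

/-- The divergence in row `i` is the common trace times the score, up to the derivative of `β̂` with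
respect to the `i`-th response. -/
theorem IsDerivMatrix.rowDiv_eq (hA : IsDerivMatrix μ ρ g 1 e G A) (i : Fin n) :
    rowDiv ρ g e i G = A.trace * score ρ g e G i
      - inner ℝ (mEstimator ρ g e G)
        (fderiv ℝ (fun e' : Vec n => mEstimator ρ g e' G) e (EuclideanSpace.single i 1)) := by
  rw [rowDiv, hA.fderiv_noise]
  simp_rw [hA.pd_row, matMul_sub, matMul_smul, PiLp.sub_apply, PiLp.smul_apply,
    matMul_single_apply]
  rw [Finset.sum_sub_distrib, Matrix.trace, inner_smul_right, PiLp.inner_apply, Finset.sum_mul,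
    Finset.mul_sum]
  congr 1
  · refine Finset.sum_congr rfl fun j _ => ?_
    simp [mul_comm]
  · refine Finset.sum_congr rfl fun j _ => ?_
    simp
    ring

end Derivatives

namespace IsotropicProblem

attribute [local irreducible] mEstimator

variable {p : ℕ} {γ μ : ℝ} {ρ : ℝ → ℝ} {g : Vec p → ℝ} {n : ℕ}

/-- The estimator is Lipschitz in the response, uniformly in the design. -/
theorem lipschitz_noise (H : IsotropicProblem μ ρ g) (hn : 1 ≤ n) (G : Design n p) :
    LipschitzWith (Real.toNNReal (√(n * μ))⁻¹) fun e : Vec n => mEstimator ρ g e G := by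
  have hn0 : (0 : ℝ) < n := by exact_mod_cast hn
  have hnμ : 0 < n * μ := mul_pos hn0 H.mu_pos
  refine LipschitzWith.of_dist_le_mul fun e e' => ?_
  rw [dist_eq_norm, dist_eq_norm, Real.coe_toNNReal _ (by positivity)]
  have h := H.stability hn e e' G G
  have h0 : 0 ≤ ∑ i, (score ρ g e G i - score ρ g e' G i) ^ 2 := by positivity
  simp only [sub_self, inner_zero_left, sub_zero, smul_zero, Finset.sum_const_zero, norm_zero,
    ne_eq, OfNat.ofNat_ne_zero, not_false_eq_true, zero_pow, zero_div, add_zero] at h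
  have h1 : ∑ i, (e i - e' i) ^ 2 = ‖e - e'‖ ^ 2 := by
    rw [EuclideanSpace.real_norm_sq_eq]; rfl
  rw [h1] at h
  rw [← Real.sqrt_sq (norm_nonneg (e - e')), ← Real.sqrt_inv, ← Real.sqrt_mul (by positivity)]
  refine Real.le_sqrt_of_sq_le ?_
  rw [inv_mul_eq_div, le_div_iff₀ hnμ]
  linarith

theorem norm_fderiv_noise_sq_le (H : IsotropicProblem μ ρ g) (hn : 1 ≤ n) (e : Vec n)
    (G : Design n p) (i : Fin n) :
    ‖fderiv ℝ (fun e' : Vec n => mEstimator ρ g e' G) e (EuclideanSpace.single i 1)‖ ^ 2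
      ≤ 1 / (n * μ) := by
  have hn0 : (0 : ℝ) < n := by exact_mod_cast hn
  have hnμ : 0 < n * μ := mul_pos hn0 H.mu_pos
  have h1 := norm_fderiv_le_of_lipschitz ℝ (H.lipschitz_noise hn G) (x₀ := e)
  have h2 := (fderiv ℝ (fun e' : Vec n => mEstimator ρ g e' G) e).le_opNorm
    (EuclideanSpace.single i 1)
  rw [Real.coe_toNNReal _ (by positivity)] at h1
  have h3 : ‖(EuclideanSpace.single i 1 : Vec n)‖ = 1 := by simp
  rw [h3, mul_one] at h2
  calc _ ≤ ((√(n * μ))⁻¹) ^ 2 := by gcongr; exact h2.trans h1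
    _ = _ := by rw [inv_pow, Real.sq_sqrt hnμ.le, one_div]

/-- The term by which the divergence in row `i` differs from `tr(A) ψ(rᵢ)` is square summable over
`i` with a bound independent of `n`. -/
theorem sum_inner_fderiv_noise_sq_le (H : IsotropicProblem μ ρ g) (hn : 1 ≤ n) (e : Vec n)
    (G : Design n p) :
    ∑ i, inner ℝ (mEstimator ρ g e G)
        (fderiv ℝ (fun e' : Vec n => mEstimator ρ g e' G) e (EuclideanSpace.single i 1)) ^ 2
      ≤ ‖mEstimator ρ g e G‖ ^ 2 / μ := by
  have hn0 : (0 : ℝ) < n := by exact_mod_cast hn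
  have hμ := H.mu_pos
  have h1 : ∀ i ∈ Finset.univ, inner ℝ (mEstimator ρ g e G)
        (fderiv ℝ (fun e' : Vec n => mEstimator ρ g e' G) e (EuclideanSpace.single i 1)) ^ 2
      ≤ ‖mEstimator ρ g e G‖ ^ 2 * (1 / (n * μ)) := fun i _ => by
    have h2 := abs_real_inner_le_norm (mEstimator ρ g e G)
      (fderiv ℝ (fun e' : Vec n => mEstimator ρ g e' G) e (EuclideanSpace.single i 1))
    rw [← sq_abs]
    calc _ ≤ (‖mEstimator ρ g e G‖ * ‖fderiv ℝ (fun e' : Vec n => mEstimator ρ g e' G) e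
          (EuclideanSpace.single i 1)‖) ^ 2 := by gcongr
      _ = ‖mEstimator ρ g e G‖ ^ 2 * ‖fderiv ℝ (fun e' : Vec n => mEstimator ρ g e' G) e
          (EuclideanSpace.single i 1)‖ ^ 2 := by rw [mul_pow]
      _ ≤ _ := by gcongr; exact H.norm_fderiv_noise_sq_le hn e G i
  refine (Finset.sum_le_sum h1).trans (le_of_eq ?_)
  simp only [Finset.sum_const, Finset.card_univ, Fintype.card_fin, nsmul_eq_mul]
  field_simp

theorem sum_pd_row_sq_le (H : IsotropicProblem μ ρ g) (hn : 1 ≤ n) {e : Vec n} {G : Design n p}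
    {A : Matrix (Fin p) (Fin p) ℝ} (hA : IsDerivMatrix μ ρ g 1 e G A) (i : Fin n) :
    ∑ j, ∑ k, pd k (fun z => mEstimator ρ g e (Function.update G i z) j) (G i) ^ 2
      ≤ 2 * (score ρ g e G i ^ 2 * (p / (n * μ) ^ 2)) + 2 * (‖mEstimator ρ g e G‖ ^ 2 / (n * μ)) := by
  have hn0 : (0 : ℝ) < n := by exact_mod_cast hn
  have hnμ : 0 < n * μ := mul_pos hn0 H.mu_pos
  set h := mEstimator ρ g e G with hh
  set u := deriv (deriv ρ) (residual ρ g e G i) • matMul A (G i) with hu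
  have hu2 : ‖u‖ ^ 2 ≤ 1 / (n * μ) := by
    rw [hu, ← hA.fderiv_noise]
    exact H.norm_fderiv_noise_sq_le hn e G i
  rw [Finset.sum_comm]
  have h1 : ∀ k, ∑ j, pd k (fun z => mEstimator ρ g e (Function.update G i z) j) (G i) ^ 2
      ≤ 2 * (score ρ g e G i ^ 2 * (1 / (n * μ) ^ 2)) + 2 * (h k ^ 2 * (1 / (n * μ))) := fun k => by
    simp_rw [hA.pd_row]
    rw [← EuclideanSpace.real_norm_sq_eq, matMul_sub, matMul_smul, matMul_smul, mul_comm, mul_smul,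
      ← hu, ← hh]
    have e1 : ‖score ρ g e G i • matMul A (EuclideanSpace.single k 1)‖ ^ 2
        ≤ score ρ g e G i ^ 2 * (1 / (n * μ) ^ 2) := by
      rw [norm_smul, mul_pow, Real.norm_eq_abs, sq_abs]
      gcongr
      have := (norm_matMul_le A (EuclideanSpace.single k 1)).trans
        (mul_le_mul_of_nonneg_right hA.norm_le_of_isotropic (norm_nonneg _))
      rw [one_div, ← inv_pow]
      gcongr
      simpa using this
    have e2 : ‖h k • u‖ ^ 2 ≤ h k ^ 2 * (1 / (n * μ)) := by
      rw [norm_smul, mul_pow, Real.norm_eq_abs, sq_abs]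
      gcongr
    have e3 := norm_sub_le (score ρ g e G i • matMul A (EuclideanSpace.single k 1)) (h k • u)
    have e4 : ‖score ρ g e G i • matMul A (EuclideanSpace.single k 1) - h k • u‖ ^ 2
      ≤ (‖score ρ g e G i • matMul A (EuclideanSpace.single k 1)‖ + ‖h k • u‖) ^ 2 := by gcongr
    nlinarith [sq_nonneg (‖score ρ g e G i • matMul A (EuclideanSpace.single k 1)‖ - ‖h k • u‖)]
  refine (Finset.sum_le_sum fun k _ => h1 k).trans (le_of_eq ?_)
  rw [Finset.sum_add_distrib, ← Finset.mul_sum, ← Finset.mul_sum, ← Finset.mul_sum,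
    ← Finset.sum_mul, ← EuclideanSpace.real_norm_sq_eq]
  simp only [Finset.sum_const, Finset.card_univ, Fintype.card_fin, nsmul_eq_mul]
  ring

theorem lipschitzOn_row (H : IsotropicProblem μ ρ g) (hn : 1 ≤ n) (e : Vec n) (G : Design n p)
    (i : Fin n) (c : Vec p) (j : Fin p) (R : ℝ) : ∃ C : NNReal, LipschitzOnWith C
      (fun z => mEstimator ρ g e (Function.update G i z) j - c j) (Metric.closedBall 0 R) := by
  obtain ⟨C, hC, -⟩ := H.exists_lipschitzOn (n := n) hn (max ‖e‖ (max ‖G‖ R))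
  refine ⟨C, LipschitzOnWith.of_dist_le_mul fun z hz z' hz' => ?_⟩
  have hmem : ∀ z ∈ Metric.closedBall (0 : Vec p) R, ((e, Function.update G i z) :
      Vec n × Design n p) ∈ Metric.closedBall 0 (max ‖e‖ (max ‖G‖ R)) := fun z hz => by
    rw [mem_closedBall_zero_iff, Prod.norm_def]
    refine max_le_max le_rfl ?_
    refine (pi_norm_le_iff_of_nonneg ((norm_nonneg G).trans (le_max_left _ _))).2 fun l => ?_
    by_cases hl : l = i
    · subst hl
      simpa using Or.inr (by simpa using hz)
    · simp only [Function.update_of_ne hl]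
      exact (norm_le_pi_norm G l).trans (le_max_left _ _)
  have h1 := hC.dist_le_mul _ (hmem z hz) _ (hmem z' hz')
  have h2 : dist ((e, Function.update G i z) : Vec n × Design n p) (e, Function.update G i z')
      ≤ dist z z' := by
    rw [Prod.dist_eq, dist_self]
    refine max_le dist_nonneg ((dist_pi_le_iff dist_nonneg).2 fun l => ?_)
    by_cases hl : l = i
    · subst hl; simp
    · simp [Function.update_of_ne hl]
  have h3 : dist (mEstimator ρ g e (Function.update G i z) j - c j)
      (mEstimator ρ g e (Function.update G i z') j - c j)
      ≤ dist (mEstimator ρ g e (Function.update G i z))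
        (mEstimator ρ g e (Function.update G i z')) := by
    rw [dist_eq_norm, dist_eq_norm, sub_sub_sub_cancel_right, ← PiLp.sub_apply]
    exact PiLp.norm_apply_le _ _
  exact h3.trans (h1.trans (by gcongr))

theorem measurable_rowDiv (H : IsotropicProblem μ ρ g) (hn : 1 ≤ n) (i : Fin n) :
    Measurable fun x : Vec n × Design n p => rowDiv ρ g x.1 i x.2 := by
  refine Finset.measurable_sum _ fun j _ => ?_
  have hc : Continuous (Function.uncurry fun (x : Vec n × Design n p) (z : Vec p) =>
      mEstimator ρ g x.1 (Function.update x.2 i z) j) := by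
    have h1 := H.continuous_mEstimator (n := n) hn
    have h2 : Continuous fun y : (Vec n × Design n p) × Vec p =>
        ((y.1.1, Function.update y.1.2 i y.2) : Vec n × Design n p) := by
      refine Continuous.prodMk (by fun_prop) ?_
      exact Continuous.update (by fun_prop) i (by fun_prop)
    have h3 : Continuous fun v : Vec p => v j := by fun_prop
    exact h3.comp (h1.comp h2)
  have h := measurable_fderiv_apply_const_with_param ℝ hc (EuclideanSpace.single j 1)
  have h2 : Measurable fun x : Vec n × Design n p => (x, x.2 i) :=
    measurable_id.prodMk ((measurable_pi_apply i).comp measurable_snd)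
  exact h.comp h2

/-- The Gaussian divergence of the leave-one-out correction `β̂ - β̂⁽ⁱ⁾` in row `i` has second
moment controlled by the correction and its gradient. -/
theorem lintegral_inner_sub_rowDiv_sq_le (H : IsotropicProblem μ ρ g) (hn : 1 ≤ n) (e : Vec n)
    (hreg : ∀ᵐ G ∂gaussDesign n p, ∃ A, IsDerivMatrix μ ρ g 1 e G A) (i : Fin n) :
    ∫⁻ G : Design n p, ENNReal.ofReal ((inner ℝ (G i) (mEstimator ρ g e G
        - maskedEstimator ρ g e {i} G) - rowDiv ρ g e i G) ^ 2) ∂gaussDesign n p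
      ≤ ∫⁻ G : Design n p, ENNReal.ofReal (3 * ‖mEstimator ρ g e G
          - maskedEstimator ρ g e {i} G‖ ^ 2 + 2 * (2 * (score ρ g e G i ^ 2 * (p / (n * μ) ^ 2))
          + 2 * (‖mEstimator ρ g e G‖ ^ 2 / (n * μ)))) ∂gaussDesign n p := by
  -- subtracting the leave-one-out estimator, which is constant in row `i`, makes the field small
  -- without changing its divergence
  set f : Design n p → Fin p → Vec p → ℝ := fun G j z =>
    mEstimator ρ g e (Function.update G i z) j - maskedEstimator ρ g e {i} G j with hf
  have hpd : ∀ G j k x, pd k (f G j) x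
      = pd k (fun z => mEstimator ρ g e (Function.update G i z) j) x := fun G j k x => by
    rw [pd, pd, hf, fderiv_sub_const]
  have hfu : ∀ G z, f (Function.update G i z) = f G := fun G z => by
    simp only [hf, Function.update_idem,
      maskedEstimator_update ρ g e (Finset.mem_singleton_self i)]
  have hval : ∀ G j, f G j (G i) = (mEstimator ρ g e G - maskedEstimator ρ g e {i} G) j :=
    fun G j => by simp [hf]
  have hsk : ∀ G, skorohod (f G) (G i) = inner ℝ (G i) (mEstimator ρ g e G
        - maskedEstimator ρ g e {i} G) - rowDiv ρ g e i G := fun G => by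
    simp_rw [skorohod, hpd, hval]
    rw [Finset.sum_sub_distrib, rowDiv, PiLp.inner_apply]
    congr 1
    refine Finset.sum_congr rfl fun j _ => ?_
    simp [mul_comm]
  have hmd : Measurable fun G : Design n p => rowDiv ρ g e i G :=
    (H.measurable_rowDiv (n := n) hn i).comp measurable_prodMk_left
  have hcm := H.continuous_maskedEstimator (n := n) hn e {i}
  have hce := H.continuous_maskedEstimator (n := n) hn e ∅
  simp only [maskedEstimator_empty] at hce
  have hm1 : Measurable fun G : Design n p => skorohod (f G) (G i) := by
    simp_rw [hsk]
    refine Measurable.sub ?_ hmd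
    exact ((by fun_prop : Continuous fun G : Design n p => G i).inner (hce.sub hcm)).measurable
  have hm2 : ∀ j k, Measurable fun G : Design n p => pd k (f G j) (G i) := fun j k => by
    simp_rw [hpd]
    have hc : Continuous (Function.uncurry fun (G : Design n p) (z : Vec p) =>
        mEstimator ρ g e (Function.update G i z) j) := by
      have h2 : Continuous fun y : Design n p × Vec p => Function.update y.1 i y.2 :=
        Continuous.update (by fun_prop) i (by fun_prop)
      have h3 : Continuous fun v : Vec p => v j := by fun_prop
      exact h3.comp (hce.comp h2)
    have h := measurable_fderiv_apply_const_with_param ℝ hc (EuclideanSpace.single k 1)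
    exact h.comp (measurable_id.prodMk (measurable_pi_apply i))
  have hm3 : ∀ j, Measurable fun G : Design n p => f G j (G i) := fun j => by
    simp_rw [hval]
    exact ((by fun_prop : Continuous fun v : Vec p => v j).comp (hce.sub hcm)).measurable
  have hm4 : Measurable fun G : Design n p => 3 * ∑ j, f G j (G i) ^ 2
      + 2 * ∑ j, ∑ k, pd k (f G j) (G i) ^ 2 :=
    ((Finset.measurable_sum _ fun j _ => (hm3 j).pow_const 2).const_mul 3).add
      ((Finset.measurable_sum _ fun j _ => Finset.measurable_sum _ fun k _ =>
        (hm2 j k).pow_const 2).const_mul 2)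
  calc _ = ∫⁻ G : Design n p, ENNReal.ofReal (skorohod (f G) (G i) ^ 2) ∂gaussDesign n p := by
        simp_rw [hsk]
    _ = ∫⁻ G : Design n p, ∫⁻ z, ENNReal.ofReal (skorohod (f G) z ^ 2) ∂stdGaussian (Vec p)
          ∂gaussDesign n p := by
        rw [lintegral_resample i (hm1.pow_const 2).ennreal_ofReal.aemeasurable]
        simp_rw [hfu, Function.update_self]
    _ ≤ ∫⁻ G : Design n p, ∫⁻ z, ENNReal.ofReal (3 * ∑ j, f G j z ^ 2
          + 2 * ∑ j, ∑ k, pd k (f G j) z ^ 2) ∂stdGaussian (Vec p) ∂gaussDesign n p :=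
        lintegral_mono fun G => lintegral_skorohod_sq_le fun j R =>
          H.lipschitzOn_row hn e G i _ j R
    _ = ∫⁻ G : Design n p, ENNReal.ofReal (3 * ∑ j, f G j (G i) ^ 2
          + 2 * ∑ j, ∑ k, pd k (f G j) (G i) ^ 2) ∂gaussDesign n p := by
        rw [lintegral_resample i hm4.ennreal_ofReal.aemeasurable]
        simp_rw [hfu, Function.update_self]
    _ ≤ _ := by
        refine lintegral_mono_ae ?_
        filter_upwards [hreg] with G hG
        obtain ⟨A, hA⟩ := hG
        refine ENNReal.ofReal_le_ofReal ?_
        simp_rw [hval, hpd]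
        rw [← EuclideanSpace.real_norm_sq_eq]
        gcongr
        exact H.sum_pd_row_sq_le hn hA i

end IsotropicProblem

/-! ### The deterministic argument on a typical design -/

/-- The event, with level `M`, on which the comparison of the out-of-sample error with the proxy is
deterministic: every random quantity of the argument is at most `M` times the order of magnitude of
its expectation, and the linear form `G i ↦ eᵢ - ⟨G i, β̂(e, 0)⟩` is not too close to zero. -/
structure TypicalDesign {n p : ℕ} (ρ : ℝ → ℝ) (g : Vec p → ℝ) (e : Vec n) (M : ℝ)
    (G : Design n p) : Prop where
  norm_sq_le : ‖mEstimator ρ g e G‖ ^ 2 ≤ M * nullSize ρ g e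
  loo_le : ∑ i, ‖mEstimator ρ g e G - maskedEstimator ρ g e {i} G‖ ^ 2 ≤ M * nullSize ρ g e
  div_le : ∑ i, (inner ℝ (G i) (mEstimator ρ g e G - maskedEstimator ρ g e {i} G)
    - rowDiv ρ g e i G) ^ 2 ≤ M * nullSize ρ g e
  noise_le : (∑ i, e i * inner ℝ (G i) (maskedEstimator ρ g e {i} G)) ^ 2
    ≤ M * (‖e‖ ^ 2 * nullSize ρ g e)
  quad_le : (∑ i, (inner ℝ (G i) (maskedEstimator ρ g e {i} G) ^ 2
    - ‖maskedEstimator ρ g e {i} G‖ ^ 2)) ^ 2 ≤ M * (n * nullSize ρ g e ^ 2)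
  null_le : ∑ i, inner ℝ (G i) (mEstimator ρ g e (0 : Design n p)) ^ 2
    ≤ M * (n * ‖mEstimator ρ g e (0 : Design n p)‖ ^ 2)
  row_le : ∑ i, ‖G i‖ ^ 2 ≤ M * (n * p)
  small_ball : ∃ i, ‖mEstimator ρ g e (0 : Design n p)‖
    ≤ M * |e i - inner ℝ (G i) (mEstimator ρ g e (0 : Design n p))|

section Norms

variable {n p : ℕ}

theorem norm_sq_designMul (G : Design n p) (b : Vec p) :
    ‖designMul G b‖ ^ 2 = ∑ i, inner ℝ (G i) b ^ 2 := by
  rw [EuclideanSpace.real_norm_sq_eq]; rfl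

theorem norm_sq_score (ρ : ℝ → ℝ) (g : Vec p → ℝ) (e : Vec n) (G : Design n p) :
    ‖applyComp (deriv ρ) (residual ρ g e G)‖ ^ 2 = ∑ i, score ρ g e G i ^ 2 := by
  rw [EuclideanSpace.real_norm_sq_eq]; rfl

theorem norm_sq_designMul_le (G : Design n p) (b : Vec p) :
    ‖designMul G b‖ ^ 2 ≤ (∑ i, ‖G i‖ ^ 2) * ‖b‖ ^ 2 := by
  rw [norm_sq_designMul, Finset.sum_mul]
  refine Finset.sum_le_sum fun i _ => ?_
  have := abs_real_inner_le_norm (G i) b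
  rw [← sq_abs, ← mul_pow]
  gcongr

theorem designMul_sub (G : Design n p) (b c : Vec p) :
    designMul G (b - c) = designMul G b - designMul G c := by
  ext i
  simp [designMul, inner_sub_right]

theorem inner_score_designMul (ρ : ℝ → ℝ) (g : Vec p → ℝ) (e : Vec n) (G : Design n p)
    (b : Vec p) : inner ℝ (applyComp (deriv ρ) (residual ρ g e G)) (designMul G b)
      = ∑ i, score ρ g e G i * inner ℝ (G i) b := by
  rw [PiLp.inner_apply]
  refine Finset.sum_congr rfl fun i _ => ?_
  simp [applyComp, score, designMul, mul_comm]

end Norms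

theorem IsDerivMatrix.abs_trace_le {n p : ℕ} {μ : ℝ} {ρ : ℝ → ℝ} {g : Vec p → ℝ}
    {e : Vec n} {G : Design n p} {A : Matrix (Fin p) (Fin p) ℝ}
    (hA : IsDerivMatrix μ ρ g 1 e G A) : |A.trace| ≤ p * ((n : ℝ) * μ)⁻¹ := by
  have h1 : ∀ j, |A j j| ≤ ((n : ℝ) * μ)⁻¹ := fun j => by
    rw [← matMul_single_apply A j j, ← Real.norm_eq_abs]
    refine (PiLp.norm_apply_le _ j).trans ((norm_matMul_le A _).trans ?_)
    simpa using hA.norm_le_of_isotropic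
  refine (Finset.abs_sum_le_sum_abs _ _).trans ((Finset.sum_le_sum fun j _ => h1 j).trans ?_)
  simp

namespace IsotropicProblem

variable {p : ℕ} {γ μ : ℝ} {ρ : ℝ → ℝ} {g : Vec p → ℝ} {n : ℕ}

/-- The comparison of the estimator with the one for the zero design, in terms of the score. -/
theorem norm_sub_null_sq_le (H : IsotropicProblem μ ρ g) (hn : 1 ≤ n) (e : Vec n)
    (G : Design n p) :
    n * μ * ‖mEstimator ρ g e G - mEstimator ρ g e (0 : Design n p)‖ ^ 2
      ≤ inner ℝ (applyComp (deriv ρ) (residual ρ g e G))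
        (designMul G (mEstimator ρ g e G - mEstimator ρ g e (0 : Design n p))) := by
  have h1 := H.variational hn e G (H.mEstimator_isMin e G) (mEstimator ρ g e (0 : Design n p))
  have h2 := H.variational hn e 0 (H.mEstimator_isMin e (0 : Design n p)) (mEstimator ρ g e G)
  simp only [Pi.zero_apply, inner_zero_left, mul_zero, Finset.sum_const_zero, zero_add] at h2
  rw [norm_sub_rev] at h1
  rw [inner_score_designMul]
  have h3 : ∑ i, deriv ρ (e i - inner ℝ (G i) (mEstimator ρ g e G))
      * inner ℝ (G i) (mEstimator ρ g e (0 : Design n p) - mEstimator ρ g e G)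
      = - ∑ i, score ρ g e G i
        * inner ℝ (G i) (mEstimator ρ g e G - mEstimator ρ g e (0 : Design n p)) := by
    rw [← Finset.sum_neg_distrib]
    refine Finset.sum_congr rfl fun i _ => ?_
    rw [score, residual_apply, ← neg_sub (mEstimator ρ g e G), inner_neg_right]
    ring
  rw [h3] at h1
  linarith

theorem sum_deriv_sq_le (H : IsotropicProblem μ ρ g) (e : Vec n) (G : Design n p) :
    ∑ i, deriv ρ (e i) ^ 2 ≤ 2 * ‖applyComp (deriv ρ) (residual ρ g e G)‖ ^ 2
      + 2 * ‖designMul G (mEstimator ρ g e G)‖ ^ 2 := by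
  rw [norm_sq_score, norm_sq_designMul, Finset.mul_sum, Finset.mul_sum, ← Finset.sum_add_distrib]
  refine Finset.sum_le_sum fun i _ => ?_
  have h1 := H.abs_deriv_sub_le (e i) (residual ρ g e G i)
  have h2 : e i - residual ρ g e G i = inner ℝ (G i) (mEstimator ρ g e G) := by
    rw [residual_apply]; ring
  rw [h2] at h1
  have h3 : (deriv ρ (e i) - deriv ρ (residual ρ g e G i)) ^ 2
      ≤ inner ℝ (G i) (mEstimator ρ g e G) ^ 2 := sq_le_sq.2 h1
  unfold score
  nlinarith [sq_nonneg (deriv ρ (e i) - 2 * deriv ρ (residual ρ g e G i))]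

theorem norm_score_le (H : IsotropicProblem μ ρ g) (e : Vec n) (G : Design n p) :
    ‖applyComp (deriv ρ) (residual ρ g e G)‖ ≤ ‖residual ρ g e G‖ := by
  refine (sq_le_sq₀ (norm_nonneg _) (norm_nonneg _)).1 ?_
  rw [norm_sq_score, EuclideanSpace.real_norm_sq_eq]
  refine Finset.sum_le_sum fun i _ => ?_
  exact sq_le_sq.2 (H.abs_deriv_le _)

/-- Adding a nonnegative multiple of the score increases the residual vector, since `ψ(rᵢ)` has the
sign of `rᵢ`. -/
theorem norm_residual_le_norm_add (H : IsotropicProblem μ ρ g) (e : Vec n) (G : Design n p) {T : ℝ}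
    (hT : 0 ≤ T) : ‖residual ρ g e G‖
      ≤ ‖residual ρ g e G + T • applyComp (deriv ρ) (residual ρ g e G)‖ := by
  refine (sq_le_sq₀ (norm_nonneg _) (norm_nonneg _)).1 ?_
  rw [EuclideanSpace.real_norm_sq_eq, EuclideanSpace.real_norm_sq_eq]
  refine Finset.sum_le_sum fun i _ => ?_
  set r := residual ρ g e G i with hr
  have h1 : (residual ρ g e G + T • applyComp (deriv ρ) (residual ρ g e G)) i
      = r + T * deriv ρ r := rfl
  have h2 : 0 ≤ r * deriv ρ r := by
    have := H.sq_deriv_sub_le r 0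
    rw [H.deriv_zero, sub_zero, sub_zero] at this
    exact (sq_nonneg _).trans this
  rw [h1]
  nlinarith [mul_nonneg hT h2, sq_nonneg (T * deriv ρ r)]

/-- The trace is nonnegative as soon as the score does not vanish: the image of the score derivative
is then the whole space, and the derivative of the estimator is a monotone function of it. -/
theorem trace_nonneg (H : IsotropicProblem μ ρ g) (hn : 1 ≤ n) {e : Vec n} {G : Design n p}
    {A : Matrix (Fin p) (Fin p) ℝ} (hA : IsDerivMatrix μ ρ g 1 e G A)
    (hs : ∀ i, DifferentiableAt ℝ (fun z : Vec n × Design n p => score ρ g z.1 z.2 i) (e, G))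
    {i : Fin n} (hi : score ρ g e G i ≠ 0) : 0 ≤ A.trace := by
  have hn0 : (0 : ℝ) < n := by exact_mod_cast hn
  have hnμ : 0 < n * μ := mul_pos hn0 H.mu_pos
  refine Finset.sum_nonneg fun j _ => ?_
  set w : Vec p := EuclideanSpace.single j 1 with hw
  -- moving row `i` by `w` and `eᵢ` by `⟨w, β̂⟩` moves the residual only through the estimator
  set v : Vec n × Design n p :=
    (inner ℝ w (mEstimator ρ g e G) • EuclideanSpace.single i 1, 0) + (0, Pi.single i w) with hv
  have hU : scoreDeriv ρ g e G v = score ρ g e G i • w := by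
    have h1 : ((inner ℝ w (mEstimator ρ g e G) • EuclideanSpace.single i 1, 0) :
        Vec n × Design n p) = inner ℝ w (mEstimator ρ g e G) • (EuclideanSpace.single i 1, 0) := by
      simp
    rw [hv, map_add, h1, map_smul, scoreDeriv_noise, scoreDeriv_row]
    module
  have h1 := H.fderiv_inner_le hn hA.differentiableAt hs v
  rw [hA.fderiv_eq, hU, matMul_smul, inner_smul_left, inner_smul_right] at h1
  have h2 : inner ℝ (matMul A w) w = A j j := by
    rw [hw, EuclideanSpace.inner_single_right, matMul_single_apply]
    simp
  rw [h2] at h1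
  have h3 : 0 ≤ (score ρ g e G i * score ρ g e G i) * A j j := by
    refine le_trans (by positivity) (h1.trans (le_of_eq ?_))
    simp [mul_assoc]
  exact (mul_nonneg_iff_of_pos_left (mul_self_pos.2 hi)).1 h3

end IsotropicProblem

/-- The constant in the deterministic fluctuation bound. -/
noncomputable def fluctConst (μ M : ℝ) : ℝ := 9 * M + 4 * M * (1 + 1 / μ)

namespace TypicalDesign

variable {p : ℕ} {γ μ : ℝ} {ρ : ℝ → ℝ} {g : Vec p → ℝ} {n : ℕ} {e : Vec n} {M : ℝ}
  {G : Design n p} {A : Matrix (Fin p) (Fin p) ℝ}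

/-- The leave-one-out norms `‖h⁽ⁱ⁾‖²` average to `‖h‖²`. -/
theorem abs_sum_norm_sq_sub_le (hG : TypicalDesign ρ g e M G) (hn : 1 ≤ n) :
    |n * ‖mEstimator ρ g e G‖ ^ 2 - ∑ i, ‖maskedEstimator ρ g e {i} G‖ ^ 2|
      ≤ 3 * M * (√n * nullSize ρ g e) := by
  have hw1 : 1 ≤ √(n : ℝ) := Real.one_le_sqrt.2 (by exact_mod_cast hn)
  have hw2 : √(n : ℝ) ^ 2 = n := Real.sq_sqrt (by positivity)
  have hD0 := nullSize_nonneg ρ g e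
  have h1 := hG.norm_sq_le
  have h2 := hG.loo_le
  set w := √(n : ℝ) with hw
  set D := nullSize ρ g e
  set h := mEstimator ρ g e G
  have hw0 : 0 < w := by linarith
  have e1 : n * ‖h‖ ^ 2 - ∑ i, ‖maskedEstimator ρ g e {i} G‖ ^ 2
      = ∑ i, (‖h‖ ^ 2 - ‖maskedEstimator ρ g e {i} G‖ ^ 2) := by
    rw [Finset.sum_sub_distrib]; simp
  have h3 : ∀ i ∈ Finset.univ, |‖h‖ ^ 2 - ‖maskedEstimator ρ g e {i} G‖ ^ 2|
      ≤ ‖h‖ ^ 2 / w + (w + 1) * ‖h - maskedEstimator ρ g e {i} G‖ ^ 2 := fun i _ => by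
    set k := maskedEstimator ρ g e {i} G
    have t1 := abs_norm_sub_norm_le h k
    have t2 : ‖k‖ ≤ ‖h‖ + ‖h - k‖ := by
      have := norm_sub_le h (h - k)
      rwa [sub_sub_cancel] at this
    have t3 : |‖h‖ ^ 2 - ‖k‖ ^ 2| ≤ ‖h - k‖ * (2 * ‖h‖ + ‖h - k‖) := by
      rw [sq_sub_sq, abs_mul, mul_comm, abs_of_nonneg (by positivity : 0 ≤ ‖h‖ + ‖k‖)]
      exact mul_le_mul t1 (by linarith) (by positivity) (norm_nonneg _)
    have t4 : 2 * (‖h‖ * ‖h - k‖) ≤ ‖h‖ ^ 2 / w + w * ‖h - k‖ ^ 2 := by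
      have : ‖h‖ ^ 2 / w + w * ‖h - k‖ ^ 2 - 2 * (‖h‖ * ‖h - k‖)
          = (‖h‖ - w * ‖h - k‖) ^ 2 / w := by field_simp; ring
      have h0 : 0 ≤ (‖h‖ - w * ‖h - k‖) ^ 2 / w := by positivity
      linarith
    linarith
  rw [e1]
  refine (Finset.abs_sum_le_sum_abs _ _).trans ((Finset.sum_le_sum h3).trans ?_)
  rw [Finset.sum_add_distrib, ← Finset.mul_sum]
  simp only [Finset.sum_const, Finset.card_univ, Fintype.card_fin, nsmul_eq_mul]
  have e2 : (n : ℝ) * (‖h‖ ^ 2 / w) = w * ‖h‖ ^ 2 := by rw [← hw2]; field_simp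
  rw [e2]
  calc _ ≤ w * (M * D) + (w + w) * (M * D) := by gcongr
    _ = _ := by ring

/-- The vector `ξ = G β̂ - tr(A) ψ(r)` is close to the vector of leave-one-out predictions. -/
theorem norm_sub_loo_sq_le (hG : TypicalDesign ρ g e M G) (H : IsotropicProblem μ ρ g)
    (hn : 1 ≤ n) (hA : IsDerivMatrix μ ρ g 1 e G A) :
    ‖designMul G (mEstimator ρ g e G) - A.trace • applyComp (deriv ρ) (residual ρ g e G)
        - WithLp.toLp 2 (fun i => inner ℝ (G i) (maskedEstimator ρ g e {i} G))‖ ^ 2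
      ≤ 2 * M * (1 + 1 / μ) * nullSize ρ g e := by
  have hμ := H.mu_pos
  rw [EuclideanSpace.real_norm_sq_eq]
  have h1 : ∀ i ∈ Finset.univ, (designMul G (mEstimator ρ g e G)
        - A.trace • applyComp (deriv ρ) (residual ρ g e G)
        - WithLp.toLp 2 (fun i => inner ℝ (G i) (maskedEstimator ρ g e {i} G))) i ^ 2
      ≤ 2 * (inner ℝ (G i) (mEstimator ρ g e G - maskedEstimator ρ g e {i} G)
          - rowDiv ρ g e i G) ^ 2
        + 2 * inner ℝ (mEstimator ρ g e G) (fderiv ℝ (fun e' : Vec n => mEstimator ρ g e' G) e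
          (EuclideanSpace.single i 1)) ^ 2 := fun i _ => by
    have e1 : (designMul G (mEstimator ρ g e G)
        - A.trace • applyComp (deriv ρ) (residual ρ g e G)
        - WithLp.toLp 2 (fun i => inner ℝ (G i) (maskedEstimator ρ g e {i} G))) i
        = inner ℝ (G i) (mEstimator ρ g e G) - A.trace * score ρ g e G i
          - inner ℝ (G i) (maskedEstimator ρ g e {i} G) := rfl
    have e2 := hA.rowDiv_eq i
    set Y := inner ℝ (mEstimator ρ g e G) (fderiv ℝ (fun e' : Vec n => mEstimator ρ g e' G) e
          (EuclideanSpace.single i 1)) with hY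
    rw [e1, inner_sub_right]
    set X := inner ℝ (G i) (mEstimator ρ g e G) - inner ℝ (G i) (maskedEstimator ρ g e {i} G)
      - rowDiv ρ g e i G with hX
    have e3 : inner ℝ (G i) (mEstimator ρ g e G) - A.trace * score ρ g e G i
          - inner ℝ (G i) (maskedEstimator ρ g e {i} G) = X - Y := by
      rw [hX, e2]; ring
    rw [e3]
    nlinarith [sq_nonneg (X + Y)]
  refine (Finset.sum_le_sum h1).trans ?_
  rw [Finset.sum_add_distrib, ← Finset.mul_sum, ← Finset.mul_sum]
  have h2 := hG.div_le
  have h3 := H.sum_inner_fderiv_noise_sq_le hn e G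
  have h4 : ‖mEstimator ρ g e G‖ ^ 2 / μ ≤ M * nullSize ρ g e / μ := by
    have := hG.norm_sq_le
    gcongr
  have e4 : 2 * M * (1 + 1 / μ) * nullSize ρ g e
      = 2 * (M * nullSize ρ g e) + 2 * (M * nullSize ρ g e / μ) := by field_simp
  rw [e4]
  linarith

/-- The two terms of the expansion of the proxy, on a typical design. The vector
`ξ = G β̂ - tr(A) ψ(r)` is the vector `a` of leave-one-out predictions up to a perturbation `η` of
bounded size, and `‖a‖²` and `⟨e, a⟩` are controlled by typicality. -/
theorem abs_fluctuation_le (hG : TypicalDesign ρ g e M G) (H : IsotropicProblem μ ρ g)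
    (hn : 1 ≤ n) (hM : 1 ≤ M) (hA : IsDerivMatrix μ ρ g 1 e G A) :
    |n * ‖mEstimator ρ g e G‖ ^ 2 - ‖designMul G (mEstimator ρ g e G)
        - A.trace • applyComp (deriv ρ) (residual ρ g e G)‖ ^ 2|
        ≤ fluctConst μ M * (√n * nullSize ρ g e) ∧
      |inner ℝ e (designMul G (mEstimator ρ g e G)
        - A.trace • applyComp (deriv ρ) (residual ρ g e G))|
        ≤ (M + 2 * M * (1 + 1 / μ)) * (√(nullSize ρ g e) * ‖e‖) := by
  have hμ := H.mu_pos
  have hn1 : (1 : ℝ) ≤ n := by exact_mod_cast hn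
  have hw1 : 1 ≤ √(n : ℝ) := Real.one_le_sqrt.2 hn1
  have hw2 : √(n : ℝ) ^ 2 = n := Real.sq_sqrt (by positivity)
  have hD0 := nullSize_nonneg ρ g e
  have h1 := hG.abs_sum_norm_sq_sub_le hn
  have h2 := hG.norm_sub_loo_sq_le H hn hA
  have h3 := hG.quad_le
  have h4 := hG.noise_le
  have h5 := hG.norm_sq_le
  set w := √(n : ℝ) with hw
  have hw0 : 0 < w := by linarith
  set D := nullSize ρ g e
  set h := mEstimator ρ g e G
  set ξ := designMul G h - A.trace • applyComp (deriv ρ) (residual ρ g e G) with hξ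
  set a : Vec n := WithLp.toLp 2 (fun i => inner ℝ (G i) (maskedEstimator ρ g e {i} G)) with ha
  set M' := 2 * M * (1 + 1 / μ) with hM'
  have hM'1 : 1 ≤ M' := by
    have : 0 ≤ 1 / μ := by positivity
    have := mul_le_mul hM (le_add_of_nonneg_right this) zero_le_one (by linarith)
    rw [hM']; linarith
  set η := ξ - a with hη
  have hξa : ξ = a + η := by rw [hη]; abel
  have ha2 : ‖a‖ ^ 2 = ∑ i, inner ℝ (G i) (maskedEstimator ρ g e {i} G) ^ 2 := by
    rw [EuclideanSpace.real_norm_sq_eq]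
  have hb : |∑ i, (inner ℝ (G i) (maskedEstimator ρ g e {i} G) ^ 2
      - ‖maskedEstimator ρ g e {i} G‖ ^ 2)| ≤ M * (w * D) := by
    refine abs_le_of_sq_le_sq ?_ (by positivity)
    refine h3.trans ?_
    rw [← hw2]
    have : (M * (w * D)) ^ 2 = M * (M * (w ^ 2 * D ^ 2)) := by ring
    rw [this]
    exact le_mul_of_one_le_left (by positivity) hM
  rw [Finset.sum_sub_distrib, ← ha2] at hb
  set Q := ∑ i, ‖maskedEstimator ρ g e {i} G‖ ^ 2
  rw [abs_le] at h1 hb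
  have hwD : 0 ≤ w * D := by positivity
  have hnw : w ≤ n := by rw [← hw2, sq]; exact le_mul_of_one_le_left hw0.le hw1
  have hna : n * ‖h‖ ^ 2 ≤ n * (M * D) := by gcongr
  have hwn : M * (w * D) ≤ M * (n * D) := by gcongr
  have haD : ‖a‖ ^ 2 ≤ 5 * M * (n * D) := by linarith
  -- Cauchy–Schwarz with weight `√n`, since `‖a‖²` is of order `n` and `‖η‖²` of order one
  have haη : |2 * inner ℝ a η| ≤ 5 * M * (w * D) + M' * (w * D) := by
    have t1 := abs_real_inner_le_norm a η
    have t2 : 2 * (‖a‖ * ‖η‖) ≤ ‖a‖ ^ 2 / w + w * ‖η‖ ^ 2 := by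
      have e1 : ‖a‖ ^ 2 / w + w * ‖η‖ ^ 2 - 2 * (‖a‖ * ‖η‖) = (‖a‖ - w * ‖η‖) ^ 2 / w := by
        field_simp; ring
      have h0 : 0 ≤ (‖a‖ - w * ‖η‖) ^ 2 / w := by positivity
      linarith
    have t3 : ‖a‖ ^ 2 / w ≤ 5 * M * (w * D) := by
      rw [div_le_iff₀ hw0]
      have : 5 * M * (w * D) * w = 5 * M * (w ^ 2 * D) := by ring
      rw [this, hw2]; exact haD
    have t4 : w * ‖η‖ ^ 2 ≤ w * (M' * D) := by gcongr
    rw [abs_mul, abs_two]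
    linarith
  have hξ2 : ‖ξ‖ ^ 2 = ‖a‖ ^ 2 + 2 * inner ℝ a η + ‖η‖ ^ 2 := by
    rw [hξa, norm_add_sq_real]
  have hη2 : ‖η‖ ^ 2 ≤ M' * (w * D) := by
    refine h2.trans ?_
    have : D ≤ w * D := le_mul_of_one_le_left hD0 hw1
    gcongr
  rw [abs_le] at haη
  refine ⟨?_, ?_⟩
  · have hB : fluctConst μ M = 9 * M + 2 * M' := by rw [fluctConst, hM']; ring
    have hη0 := sq_nonneg ‖η‖
    rw [hB, hξ2, abs_le]
    constructor <;> linarith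
  · have hs := Real.sq_sqrt hD0
    have hs0 := Real.sqrt_nonneg D
    have t1 : |inner ℝ e a| ≤ M * (√D * ‖e‖) := by
      have e1 : inner ℝ e a = ∑ i, e i * inner ℝ (G i) (maskedEstimator ρ g e {i} G) := by
        rw [PiLp.inner_apply]
        refine Finset.sum_congr rfl fun i _ => ?_
        simp [ha, mul_comm]
      rw [e1]
      refine abs_le_of_sq_le_sq ?_ (by positivity)
      refine h4.trans ?_
      have e2 : (M * (√D * ‖e‖)) ^ 2 = M * (M * (‖e‖ ^ 2 * D)) := by
        rw [mul_pow, mul_pow, hs]; ring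
      rw [e2]
      exact le_mul_of_one_le_left (by positivity) hM
    have t2 : ‖η‖ ≤ M' * √D := by
      refine (sq_le_sq₀ (norm_nonneg _) (by positivity)).1 ?_
      rw [mul_pow, hs]
      refine h2.trans ?_
      rw [sq]
      exact mul_le_mul_of_nonneg_right (le_mul_of_one_le_left (by linarith) hM'1) hD0
    have t3 : |inner ℝ e η| ≤ ‖e‖ * (M' * √D) :=
      (abs_real_inner_le_norm e η).trans (by gcongr)
    rw [hξa, inner_add_right]
    refine (abs_add_le _ _).trans ?_
    linarith

/-- The error of the proxy, on the scale of the problem with zero design. -/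
theorem abs_sub_proxy_le (hG : TypicalDesign ρ g e M G) (H : IsotropicProblem μ ρ g)
    (hn : 1 ≤ n) (hM : 1 ≤ M) (hA : IsDerivMatrix μ ρ g 1 e G A) :
    |‖mEstimator ρ g e G‖ ^ 2 + ‖e‖ ^ 2 / n - ‖residual ρ g e G
        + A.trace • applyComp (deriv ρ) (residual ρ g e G)‖ ^ 2 / n|
      ≤ fluctConst μ M * ((√n)⁻¹ * (nullSize ρ g e + √(nullSize ρ g e) * (‖e‖ / √n))) := by
  have hμ := H.mu_pos
  have hn0 : (0 : ℝ) < n := by exact_mod_cast hn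
  have hw2 : √(n : ℝ) ^ 2 = n := Real.sq_sqrt (by positivity)
  have hw0 : 0 < √(n : ℝ) := Real.sqrt_pos.2 hn0
  obtain ⟨h1, h2⟩ := hG.abs_fluctuation_le H hn hM hA
  set ξ := designMul G (mEstimator ρ g e G)
    - A.trace • applyComp (deriv ρ) (residual ρ g e G) with hξ
  have e1 : residual ρ g e G + A.trace • applyComp (deriv ρ) (residual ρ g e G) = e - ξ := by
    rw [hξ, residual]; abel
  have e2 : ‖mEstimator ρ g e G‖ ^ 2 + ‖e‖ ^ 2 / n - ‖e - ξ‖ ^ 2 / n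
      = ((n * ‖mEstimator ρ g e G‖ ^ 2 - ‖ξ‖ ^ 2) + 2 * inner ℝ e ξ) / n := by
    rw [norm_sub_sq_real]; field_simp; ring
  rw [e1, e2, abs_div, abs_of_pos hn0, div_le_iff₀ hn0]
  refine (abs_add_le _ _).trans ?_
  rw [abs_mul, abs_two]
  set D := nullSize ρ g e
  have e3 : fluctConst μ M * ((√n)⁻¹ * (D + √D * (‖e‖ / √n))) * n
      = fluctConst μ M * (√n * D) + fluctConst μ M * (√D * ‖e‖) := by
    rw [← hw2]; field_simp; simp
  rw [e3]
  refine add_le_add h1 ?_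
  have h3 : 2 * (M + 2 * M * (1 + 1 / μ)) ≤ fluctConst μ M := by
    unfold fluctConst; linarith
  calc _ ≤ 2 * ((M + 2 * M * (1 + 1 / μ)) * (√D * ‖e‖)) := by gcongr
    _ = 2 * (M + 2 * M * (1 + 1 / μ)) * (√D * ‖e‖) := by ring
    _ ≤ _ := by gcongr

end TypicalDesign

/-- The sample size beyond which fluctuations are negligible in the comparison of the size of the
problem with that of the problem with zero design. -/
noncomputable def sampleThreshold (μ M : ℝ) : ℝ := (16 * fluctConst μ M * (1 + 1 / μ)) ^ 2

/-- The constant in the bound for the fitted values `G β̂`. -/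
noncomputable def fitConst (γ μ M : ℝ) : ℝ :=
  2 + 2 * (γ / μ) ^ 2 + M * γ * sampleThreshold μ M

/-- The constant in the bound for the size of the problem with zero design. -/
noncomputable def nullConst (γ μ M : ℝ) : ℝ :=
  2 * (4 + 2 / μ * (1 + 2 * M / μ) + 2 * (1 + 1 / μ) * fitConst γ μ M)

theorem fluctConst_nonneg {μ M : ℝ} (hμ : 0 < μ) (hM : 1 ≤ M) : 0 ≤ fluctConst μ M := by
  unfold fluctConst; positivity

theorem fitConst_nonneg {γ μ M : ℝ} (hγ : 0 < γ) (hM : 1 ≤ M) : 0 ≤ fitConst γ μ M := by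
  unfold fitConst sampleThreshold; positivity

theorem one_le_nullConst {γ μ M : ℝ} (hγ : 0 < γ) (hμ : 0 < μ) (hM : 1 ≤ M) :
    1 ≤ nullConst γ μ M := by
  have := fitConst_nonneg (μ := μ) hγ hM
  have h1 : 0 ≤ 2 / μ * (1 + 2 * M / μ) := by positivity
  have h2 : 0 ≤ 2 * (1 + 1 / μ) * fitConst γ μ M := by positivity
  unfold nullConst
  linarith

theorem abs_trace_le_div {n p : ℕ} {γ μ : ℝ} {ρ : ℝ → ℝ} {g : Vec p → ℝ}
    {e : Vec n} {G : Design n p} {A : Matrix (Fin p) (Fin p) ℝ} (hμ : 0 < μ) (hn : 1 ≤ n)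
    (hp : (p : ℝ) ≤ γ * n) (hA : IsDerivMatrix μ ρ g 1 e G A) : |A.trace| ≤ γ / μ := by
  have hn0 : (0 : ℝ) < n := by exact_mod_cast hn
  refine hA.abs_trace_le.trans ?_
  rw [← div_eq_mul_inv, div_le_div_iff₀ (by positivity) hμ]
  nlinarith

namespace TypicalDesign

variable {p : ℕ} {γ μ : ℝ} {ρ : ℝ → ℝ} {g : Vec p → ℝ} {n : ℕ} {e : Vec n} {M : ℝ}
  {G : Design n p} {A : Matrix (Fin p) (Fin p) ℝ}

/-- The fitted values are bounded by the size of the problem, up to a small multiple of the size of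
the problem with zero design. Large samples use the fluctuation bound for `G β̂ - tr(A) ψ(r)`, small
samples the Frobenius norm of the design. -/
theorem norm_sq_fit_le (hG : TypicalDesign ρ g e M G) (H : IsotropicProblem μ ρ g)
    (hγ : 0 < γ) (hn : 1 ≤ n) (hp : (p : ℝ) ≤ γ * n) (hM : 1 ≤ M)
    (hA : IsDerivMatrix μ ρ g 1 e G A) :
    ‖designMul G (mEstimator ρ g e G)‖ ^ 2 / n
      ≤ fitConst γ μ M * (‖mEstimator ρ g e G‖ ^ 2
          + ‖applyComp (deriv ρ) (residual ρ g e G)‖ ^ 2 / n)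
        + nullSize ρ g e / (8 * (1 + 1 / μ)) := by
  have hμ := H.mu_pos
  have hn0 : (0 : ℝ) < n := by exact_mod_cast hn
  have hw2 : √(n : ℝ) ^ 2 = n := Real.sq_sqrt (by positivity)
  have hw0 : 0 < √(n : ℝ) := Real.sqrt_pos.2 hn0
  have hD0 := nullSize_nonneg ρ g e
  have hB := fluctConst_nonneg hμ hM
  have hT := abs_trace_le_div hμ hn hp hA
  obtain ⟨h1, -⟩ := hG.abs_fluctuation_le H hn hM hA
  have hrow := hG.row_le
  have hfrob := norm_sq_designMul_le G (mEstimator ρ g e G)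
  set D := nullSize ρ g e
  set h := mEstimator ρ g e G
  set ψ := applyComp (deriv ρ) (residual ρ g e G)
  set T := A.trace
  set B := fluctConst μ M with hBdef
  have hψ0 : 0 ≤ ‖ψ‖ ^ 2 / n := by positivity
  have hh0 : 0 ≤ ‖h‖ ^ 2 := by positivity
  have hN0 : 0 ≤ M * γ * sampleThreshold μ M := by unfold sampleThreshold; positivity
  have hθ0 : 0 ≤ D / (8 * (1 + 1 / μ)) := by positivity
  by_cases hN : sampleThreshold μ M ≤ n
  · have hN' : 16 * B * (1 + 1 / μ) ≤ √n := by
      refine Real.le_sqrt_of_sq_le ?_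
      rwa [sampleThreshold, ← hBdef] at hN
    have e1 : designMul G h = (designMul G h - T • ψ) + T • ψ := by abel
    have e2 : ‖designMul G h‖ ≤ ‖designMul G h - T • ψ‖ + |T| * ‖ψ‖ := by
      conv_lhs => rw [e1]
      refine (norm_add_le _ _).trans (le_of_eq ?_)
      rw [norm_smul, Real.norm_eq_abs]
    have e3 : ‖designMul G h‖ ^ 2 ≤ 2 * ‖designMul G h - T • ψ‖ ^ 2 + 2 * (|T| * ‖ψ‖) ^ 2 := by
      have : ‖designMul G h‖ ^ 2 ≤ (‖designMul G h - T • ψ‖ + |T| * ‖ψ‖) ^ 2 := by gcongr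
      linarith [add_sq_le (a := ‖designMul G h - T • ψ‖) (b := |T| * ‖ψ‖)]
    have e4 : ‖designMul G h - T • ψ‖ ^ 2 ≤ n * ‖h‖ ^ 2 + B * (√n * D) := by
      have := (abs_le.1 h1).1
      linarith
    have e5 : (|T| * ‖ψ‖) ^ 2 ≤ (γ / μ) ^ 2 * ‖ψ‖ ^ 2 := by
      rw [mul_pow]; gcongr
    have e6 : ‖designMul G h‖ ^ 2 / n
        ≤ 2 * ‖h‖ ^ 2 + 2 * (γ / μ) ^ 2 * (‖ψ‖ ^ 2 / n) + 2 * B * D / √n := by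
      rw [div_le_iff₀ hn0]
      have : (2 * ‖h‖ ^ 2 + 2 * (γ / μ) ^ 2 * (‖ψ‖ ^ 2 / n) + 2 * B * D / √n) * n
          = 2 * (n * ‖h‖ ^ 2 + B * (√n * D)) + 2 * ((γ / μ) ^ 2 * ‖ψ‖ ^ 2) := by
        have h2 : 2 * B * D / √n * n = 2 * (B * (√n * D)) := by
          conv_lhs => rw [← hw2]
          field_simp
          simp
        have h3 : 2 * (γ / μ) ^ 2 * (‖ψ‖ ^ 2 / n) * n = 2 * ((γ / μ) ^ 2 * ‖ψ‖ ^ 2) := by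
          field_simp
        linear_combination h2 + h3
      rw [this]
      linarith
    -- the threshold on the sample size is what makes this term absorbable
    have e7 : 2 * B * D / √n ≤ D / (8 * (1 + 1 / μ)) := by
      rw [div_le_div_iff₀ hw0 (by positivity)]
      calc 2 * B * D * (8 * (1 + 1 / μ)) = D * (16 * B * (1 + 1 / μ)) := by ring
        _ ≤ D * √n := by gcongr
    have e8 : 2 * ‖h‖ ^ 2 + 2 * (γ / μ) ^ 2 * (‖ψ‖ ^ 2 / n)
        ≤ fitConst γ μ M * (‖h‖ ^ 2 + ‖ψ‖ ^ 2 / n) := by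
      rw [fitConst, mul_add]
      have h2 : 0 ≤ (γ / μ) ^ 2 := by positivity
      have h3 : 2 * ‖h‖ ^ 2 ≤ (2 + 2 * (γ / μ) ^ 2 + M * γ * sampleThreshold μ M) * ‖h‖ ^ 2 := by
        gcongr; linarith
      have h4 : 2 * (γ / μ) ^ 2 * (‖ψ‖ ^ 2 / n)
          ≤ (2 + 2 * (γ / μ) ^ 2 + M * γ * sampleThreshold μ M) * (‖ψ‖ ^ 2 / n) := by
        gcongr; linarith
      linarith
    linarith
  · push Not at hN
    have e1 : ‖designMul G h‖ ^ 2 / n ≤ M * γ * sampleThreshold μ M * ‖h‖ ^ 2 := by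
      rw [div_le_iff₀ hn0]
      calc ‖designMul G h‖ ^ 2 ≤ (∑ i, ‖G i‖ ^ 2) * ‖h‖ ^ 2 := hfrob
        _ ≤ (M * (n * (γ * n))) * ‖h‖ ^ 2 := by
            gcongr; exact hrow.trans (by gcongr)
        _ = M * γ * n * ‖h‖ ^ 2 * n := by ring
        _ ≤ _ := by gcongr
    have e2 : M * γ * sampleThreshold μ M * ‖h‖ ^ 2
        ≤ fitConst γ μ M * (‖h‖ ^ 2 + ‖ψ‖ ^ 2 / n) := by
      have h2 : 0 ≤ (γ / μ) ^ 2 := by positivity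
      rw [fitConst]
      gcongr
      · linarith
      · linarith
    linarith

/-- The size of the problem with zero design is at most a constant times the size of the problem. -/
theorem nullSize_le (hG : TypicalDesign ρ g e M G) (H : IsotropicProblem μ ρ g)
    (hγ : 0 < γ) (hn : 1 ≤ n) (hp : (p : ℝ) ≤ γ * n) (hM : 1 ≤ M)
    (hA : IsDerivMatrix μ ρ g 1 e G A) :
    nullSize ρ g e ≤ nullConst γ μ M * (‖mEstimator ρ g e G‖ ^ 2
          + ‖applyComp (deriv ρ) (residual ρ g e G)‖ ^ 2 / n) := by
  have hμ := H.mu_pos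
  have hn0 : (0 : ℝ) < n := by exact_mod_cast hn
  have hfit := hG.norm_sq_fit_le H hγ hn hp hM hA
  have hnull := hG.null_le
  have h1 := H.norm_sub_null_sq_le hn e G
  have h2 := H.sum_deriv_sq_le e G
  rw [← norm_sq_designMul] at hnull
  rw [designMul_sub, inner_sub_right] at h1
  have hD : nullSize ρ g e
      = ‖mEstimator ρ g e (0 : Design n p)‖ ^ 2 + (∑ i, deriv ρ (e i) ^ 2) / n := rfl
  set D := nullSize ρ g e
  set h := mEstimator ρ g e G
  set h0 := mEstimator ρ g e (0 : Design n p)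
  set ψ := applyComp (deriv ρ) (residual ρ g e G)
  set X := ‖designMul G h‖ ^ 2 / n with hX
  set Y := ‖ψ‖ ^ 2 / n with hY
  have hXn : ‖designMul G h‖ ^ 2 = n * X := by rw [hX]; field_simp
  have hYn : ‖ψ‖ ^ 2 = n * Y := by rw [hY]; field_simp
  have hX0 : 0 ≤ X := by positivity
  have hY0 : 0 ≤ Y := by positivity
  have i1 : inner ℝ ψ (designMul G h) ≤ n * (X + Y) := by
    have t1 := real_inner_le_norm ψ (designMul G h)
    have t2 : ‖ψ‖ * ‖designMul G h‖ ≤ ‖ψ‖ ^ 2 + ‖designMul G h‖ ^ 2 := by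
      nlinarith [sq_nonneg (‖ψ‖ - ‖designMul G h‖), sq_nonneg ‖ψ‖, sq_nonneg ‖designMul G h‖]
    rw [hXn, hYn] at t2
    linarith
  -- the weights leave a multiple of `‖h0‖²` that is small enough to be absorbed
  have i2 : -inner ℝ ψ (designMul G h0) ≤ n * (μ / 8 * ‖h0‖ ^ 2 + 2 * M / μ * Y) := by
    have t1 := (abs_le.1 (abs_real_inner_le_norm ψ (designMul G h0))).1
    have hM0 : 0 < M := by linarith
    have t2 : ‖ψ‖ * ‖designMul G h0‖
        ≤ 2 * M / μ * ‖ψ‖ ^ 2 + μ / (8 * M) * ‖designMul G h0‖ ^ 2 := by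
      have e1 : 2 * M / μ * ‖ψ‖ ^ 2 + μ / (8 * M) * ‖designMul G h0‖ ^ 2
          - ‖ψ‖ * ‖designMul G h0‖ = (4 * M * ‖ψ‖ - μ * ‖designMul G h0‖) ^ 2 / (8 * M * μ) := by
        field_simp; ring
      have e2 : 0 ≤ (4 * M * ‖ψ‖ - μ * ‖designMul G h0‖) ^ 2 / (8 * M * μ) := by positivity
      linarith
    have t3 : μ / (8 * M) * ‖designMul G h0‖ ^ 2 ≤ μ / (8 * M) * (M * (n * ‖h0‖ ^ 2)) := by gcongr
    have t4 : μ / (8 * M) * (M * (n * ‖h0‖ ^ 2)) = n * (μ / 8 * ‖h0‖ ^ 2) := by field_simp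
    rw [hYn] at t2
    linarith
  have i3 : μ * ‖h - h0‖ ^ 2 ≤ X + Y + μ / 8 * ‖h0‖ ^ 2 + 2 * M / μ * Y := by
    refine le_of_mul_le_mul_left ?_ hn0
    linarith
  have i4 : ‖h0‖ ^ 2 ≤ 2 * ‖h‖ ^ 2 + 2 * ‖h - h0‖ ^ 2 := by
    have t1 : ‖h0‖ ≤ ‖h‖ + ‖h - h0‖ := by
      have := norm_sub_le h (h - h0)
      rwa [sub_sub_cancel] at this
    have t2 : ‖h0‖ ^ 2 ≤ (‖h‖ + ‖h - h0‖) ^ 2 := by gcongr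
    linarith [add_sq_le (a := ‖h‖) (b := ‖h - h0‖)]
  have i5 : ‖h - h0‖ ^ 2 ≤ 1 / μ * (X + Y + 2 * M / μ * Y) + 1 / 8 * ‖h0‖ ^ 2 := by
    have : ‖h - h0‖ ^ 2 = 1 / μ * (μ * ‖h - h0‖ ^ 2) := by field_simp
    rw [this]
    have t1 : 1 / μ * (μ * ‖h - h0‖ ^ 2)
        ≤ 1 / μ * (X + Y + μ / 8 * ‖h0‖ ^ 2 + 2 * M / μ * Y) := by gcongr
    have t2 : 1 / μ * (X + Y + μ / 8 * ‖h0‖ ^ 2 + 2 * M / μ * Y)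
        = 1 / μ * (X + Y + 2 * M / μ * Y) + 1 / 8 * ‖h0‖ ^ 2 := by field_simp; ring
    linarith
  have i6 : (∑ i, deriv ρ (e i) ^ 2) / n ≤ 2 * Y + 2 * X := by
    rw [div_le_iff₀ hn0]
    rw [hXn, hYn] at h2
    linarith
  have i7 : 2 * (1 + 1 / μ) * X
      ≤ 2 * (1 + 1 / μ) * fitConst γ μ M * (‖h‖ ^ 2 + Y) + D / 4 := by
    have t1 : 2 * (1 + 1 / μ) * X
      ≤ 2 * (1 + 1 / μ) * (fitConst γ μ M * (‖h‖ ^ 2 + Y) + D / (8 * (1 + 1 / μ))) := by gcongr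
    have t2 : 2 * (1 + 1 / μ) * (D / (8 * (1 + 1 / μ))) = D / 4 := by
      field_simp; ring
    linarith
  have i8 : 2 / μ * (1 + 2 * M / μ) * Y ≤ 2 / μ * (1 + 2 * M / μ) * (‖h‖ ^ 2 + Y) := by
    gcongr
    linarith [sq_nonneg ‖h‖]
  have i9 : 0 ≤ (∑ i, deriv ρ (e i) ^ 2) / n := by positivity
  have j1 : 1 / μ * (X + Y + 2 * M / μ * Y)
      = 1 / μ * X + (2 / μ * (1 + 2 * M / μ) * Y) / 2 := by ring
  have j2 : 2 * (1 + 1 / μ) * X = 2 * X + 2 * (1 / μ * X) := by ring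
  have j3 : nullConst γ μ M * (‖h‖ ^ 2 + Y) = 2 * (4 * (‖h‖ ^ 2 + Y)
      + 2 / μ * (1 + 2 * M / μ) * (‖h‖ ^ 2 + Y)
      + 2 * (1 + 1 / μ) * fitConst γ μ M * (‖h‖ ^ 2 + Y)) := by rw [nullConst]; ring
  rw [j1] at i5
  rw [j2] at i7
  rw [j3]
  linarith [sq_nonneg ‖h‖]

/-- On a typical design the score does not vanish: otherwise the estimator would interpolate the data
and would agree with the one for the zero design, contradicting the small ball condition. -/
theorem exists_score_ne_zero (hG : TypicalDesign ρ g e M G) (H : IsotropicProblem μ ρ g)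
    (hn : 1 ≤ n) (he : e ≠ 0) : ∃ i, score ρ g e G i ≠ 0 := by
  by_contra hcon
  push Not at hcon
  have hn0 : (0 : ℝ) < n := by exact_mod_cast hn
  have hnμ : 0 < n * μ := mul_pos hn0 H.mu_pos
  have hr : ∀ i, e i = inner ℝ (G i) (mEstimator ρ g e G) := fun i => by
    have := H.deriv_eq_zero_iff.1 (hcon i)
    rw [residual_apply] at this
    linarith
  have h1 := H.norm_sub_null_sq_le hn e G
  rw [inner_score_designMul] at h1
  simp only [hcon, zero_mul, Finset.sum_const_zero] at h1
  have h2 : ‖mEstimator ρ g e G - mEstimator ρ g e (0 : Design n p)‖ ^ 2 ≤ 0 := by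
    by_contra hc
    push Not at hc
    linarith [mul_pos hnμ hc]
  have h3 : mEstimator ρ g e G = mEstimator ρ g e (0 : Design n p) := by
    have := pow_eq_zero_iff (two_ne_zero) |>.1 (le_antisymm h2 (sq_nonneg _))
    exact sub_eq_zero.1 (norm_eq_zero.1 this)
  obtain ⟨i, hi⟩ := hG.small_ball
  rw [← h3, hr i, sub_self, abs_zero, mul_zero] at hi
  have h4 : mEstimator ρ g e G = 0 := norm_eq_zero.1 (le_antisymm hi (norm_nonneg _))
  refine he ?_
  ext i
  rw [hr i, h4, inner_zero_right]
  rfl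

/-- For small samples, the target is bounded by the proxy: if the residual is small, then so is the
response vector of the problem, because `eᵢ - ⟨G i, β̂(e, 0)⟩` is bounded away from zero on the
scale of `β̂(e, 0)`. -/
theorem target_le_proxy_of_le (hG : TypicalDesign ρ g e M G) (H : IsotropicProblem μ ρ g)
    (hγ : 0 < γ) (hn : 1 ≤ n) (hp : (p : ℝ) ≤ γ * n) (hM : 1 ≤ M) {N : ℝ} (hN : n ≤ N) {P : ℝ}
    (hP : ‖residual ρ g e G‖ ^ 2 ≤ n * P) :
    ‖mEstimator ρ g e G‖ ^ 2 + ‖e‖ ^ 2 / n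
      ≤ (2 * (M * γ * N / μ ^ 2) + (2 * M ^ 2 + 2 + 2 * M ^ 3 * N)
        * (2 * N + 2 * (M * γ * N ^ 2) * (M * γ * N / μ ^ 2))) * P := by
  have hμ := H.mu_pos
  have hn1 : (1 : ℝ) ≤ n := by exact_mod_cast hn
  have hn0 : (0 : ℝ) < n := by linarith
  have hnμ : 0 < n * μ := mul_pos hn0 hμ
  have hN0 : 0 < N := by linarith
  have hP0 : 0 ≤ P := by
    have : 0 ≤ n * P := (sq_nonneg _).trans hP
    exact (mul_nonneg_iff_of_pos_left hn0).1 this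
  have hψ : ‖applyComp (deriv ρ) (residual ρ g e G)‖ ^ 2 ≤ n * P :=
    le_trans (by gcongr; exact H.norm_score_le e G) hP
  have hrow : ∑ i, ‖G i‖ ^ 2 ≤ M * γ * n ^ 2 := by
    refine hG.row_le.trans ?_
    calc M * (n * p) ≤ M * (n * (γ * n)) := by gcongr
      _ = _ := by ring
  have h1 := H.norm_sub_null_sq_le hn e G
  have hnull := hG.null_le
  rw [← norm_sq_designMul] at hnull
  obtain ⟨i, hi⟩ := hG.small_ball
  set h := mEstimator ρ g e G with hh
  set h0 := mEstimator ρ g e (0 : Design n p)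
  set ψ := applyComp (deriv ρ) (residual ρ g e G)
  have hfrob := norm_sq_designMul_le G (h - h0)
  set c1 := M * γ * N / μ ^ 2 with hc1
  set c2 := 2 * N + 2 * (M * γ * N ^ 2) * c1 with hc2
  have hc10 : 0 ≤ c1 := by positivity
  have hc20 : 0 ≤ c2 := by positivity
  -- a small score forces the estimator to be close to the one for the zero design
  have i1 : ‖h - h0‖ ^ 2 ≤ c1 * P := by
    have t1 := h1.trans (real_inner_le_norm _ _)
    have t2 : (n * μ * ‖h - h0‖ ^ 2) ^ 2 ≤ (‖ψ‖ * ‖designMul G (h - h0)‖) ^ 2 := by gcongr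
    have t3 : (‖ψ‖ * ‖designMul G (h - h0)‖) ^ 2
        ≤ (n * P) * (M * γ * n ^ 2 * ‖h - h0‖ ^ 2) := by
      rw [mul_pow]
      gcongr
      exact hfrob.trans (by gcongr)
    by_cases hz : ‖h - h0‖ ^ 2 = 0
    · rw [hz]; positivity
    · have hpos : 0 < ‖h - h0‖ ^ 2 := lt_of_le_of_ne (sq_nonneg _) (Ne.symm hz)
      have t4 : ‖h - h0‖ ^ 2 * ((n * μ) ^ 2 * ‖h - h0‖ ^ 2)
          ≤ ‖h - h0‖ ^ 2 * ((n * P) * (M * γ * n ^ 2)) := by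
        calc _ = (n * μ * ‖h - h0‖ ^ 2) ^ 2 := by ring
          _ ≤ _ := t2.trans t3
          _ = _ := by ring
      have t5 := le_of_mul_le_mul_left t4 hpos
      have t6 : (n * μ) ^ 2 * (c1 * P) = n ^ 2 * (P * (M * γ * N)) := by
        rw [hc1]; field_simp
      refine le_of_mul_le_mul_left ?_ (by positivity : 0 < (n * μ) ^ 2)
      rw [t6]
      calc _ ≤ (n * P) * (M * γ * n ^ 2) := t5
        _ = n ^ 2 * (P * (M * γ * n)) := by ring
        _ ≤ _ := by gcongr
  have i2 : ‖e - designMul G h0‖ ^ 2 ≤ c2 * P := by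
    have e1 : e - designMul G h0 = residual ρ g e G + designMul G (h - h0) := by
      rw [designMul_sub, residual, ← hh]; abel
    rw [e1]
    have t1 : ‖residual ρ g e G + designMul G (h - h0)‖ ^ 2
        ≤ (‖residual ρ g e G‖ + ‖designMul G (h - h0)‖) ^ 2 := by
      gcongr; exact norm_add_le _ _
    have t2 : ‖designMul G (h - h0)‖ ^ 2 ≤ M * γ * N ^ 2 * (c1 * P) := by
      refine hfrob.trans ?_
      gcongr
      exact hrow.trans (by gcongr)
    have t3 : ‖residual ρ g e G‖ ^ 2 ≤ N * P := hP.trans (by gcongr)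
    have t4 := add_sq_le (a := ‖residual ρ g e G‖) (b := ‖designMul G (h - h0)‖)
    rw [hc2]
    linarith
  have i3 : ‖h0‖ ^ 2 ≤ M ^ 2 * (c2 * P) := by
    have t1 : |e i - inner ℝ (G i) h0| ≤ ‖e - designMul G h0‖ :=
      PiLp.norm_apply_le (e - designMul G h0) i
    have t2 : ‖h0‖ ≤ M * ‖e - designMul G h0‖ := hi.trans (by gcongr)
    calc ‖h0‖ ^ 2 ≤ (M * ‖e - designMul G h0‖) ^ 2 := by gcongr
      _ = M ^ 2 * ‖e - designMul G h0‖ ^ 2 := by ring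
      _ ≤ _ := by gcongr
  have i4 : ‖e‖ ^ 2 ≤ 2 * (c2 * P) + 2 * (M * (N * (M ^ 2 * (c2 * P)))) := by
    have t1 : ‖e‖ ≤ ‖e - designMul G h0‖ + ‖designMul G h0‖ := by
      have := norm_add_le (e - designMul G h0) (designMul G h0)
      rwa [sub_add_cancel] at this
    have t2 : ‖e‖ ^ 2 ≤ (‖e - designMul G h0‖ + ‖designMul G h0‖) ^ 2 := by gcongr
    have t3 := add_sq_le (a := ‖e - designMul G h0‖) (b := ‖designMul G h0‖)
    have t4 : ‖designMul G h0‖ ^ 2 ≤ M * (N * (M ^ 2 * (c2 * P))) :=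
      hnull.trans (by gcongr)
    linarith
  have i5 : ‖h‖ ^ 2 ≤ 2 * ‖h0‖ ^ 2 + 2 * ‖h - h0‖ ^ 2 := by
    have t1 : ‖h‖ ≤ ‖h0‖ + ‖h - h0‖ := by
      have := norm_add_le h0 (h - h0)
      rwa [add_sub_cancel] at this
    have t2 : ‖h‖ ^ 2 ≤ (‖h0‖ + ‖h - h0‖) ^ 2 := by gcongr
    linarith [add_sq_le (a := ‖h0‖) (b := ‖h - h0‖)]
  have i6 : ‖e‖ ^ 2 / n ≤ ‖e‖ ^ 2 := div_le_self (sq_nonneg _) hn1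
  have j : (2 * c1 + (2 * M ^ 2 + 2 + 2 * M ^ 3 * N) * c2) * P
      = 2 * (c1 * P) + 2 * (M ^ 2 * (c2 * P)) + 2 * (c2 * P)
        + 2 * (M * (N * (M ^ 2 * (c2 * P)))) := by ring
  rw [j]
  linarith

end TypicalDesign

theorem rescale_bound {K w R L P c : ℝ} (hK : 0 ≤ K) (hw : 0 < w) (hR : R ≤ 2 * (L + P))
    (hL : L ≤ (c + 2) * P) : K * (w⁻¹ * R) ≤ K * (2 * (c + 3)) * (w⁻¹ * P) := by
  have h1 : R ≤ 2 * ((c + 3) * P) := by linarith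
  calc K * (w⁻¹ * R) ≤ K * (w⁻¹ * (2 * ((c + 3) * P))) := by gcongr
    _ = _ := by ring

/-- If the error is a small fraction of the remainder, which is itself at most twice the target `L`
plus the proxy `P`, then the target is bounded by the proxy. -/
theorem target_le_of_large {K w R L P c : ℝ} (hc : 0 ≤ c) (hP : 0 ≤ P) (hw : 0 < w)
    (hKw : 6 * K ≤ w) (hR0 : 0 ≤ R) (h : |L - P| ≤ K * (w⁻¹ * R))
    (hR : R ≤ 2 * (L + P)) : L ≤ (c + 2) * P := by
  have h1 : K * w⁻¹ ≤ 1 / 6 := by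
    rw [← div_eq_mul_inv, div_le_div_iff₀ hw (by norm_num)]; linarith
  have h2 : K * (w⁻¹ * R) ≤ (L + P) / 3 := by
    calc K * (w⁻¹ * R) = (K * w⁻¹) * R := by ring
      _ ≤ 1 / 6 * (2 * (L + P)) := by gcongr
      _ = _ := by ring
  have h3 := (abs_le.1 h).2
  have h4 : 0 ≤ c * P := mul_nonneg hc hP
  linarith

/-- On a typical design, the difference between the target and the proxy is of order `n^{-1/2}` both
on the scale of the remainder and on the scale of the proxy itself. -/
theorem exists_deterministic_const {γ μ M : ℝ} (hγ : 0 < γ) (hμ : 0 < μ) (hM : 1 ≤ M) :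
    ∃ K : ℝ, 0 ≤ K ∧ ∀ {n p : ℕ} {ρ : ℝ → ℝ} {g : Vec p → ℝ} {e : Vec n} {G : Design n p}
      {A : Matrix (Fin p) (Fin p) ℝ}, IsotropicProblem μ ρ g → 1 ≤ n → (p : ℝ) ≤ γ * n → e ≠ 0 →
      TypicalDesign ρ g e M G → IsDerivMatrix μ ρ g 1 e G A →
      (∀ i, DifferentiableAt ℝ (fun z : Vec n × Design n p => score ρ g z.1 z.2 i) (e, G)) →
      |‖mEstimator ρ g e G‖ ^ 2 + ‖e‖ ^ 2 / n - ‖residual ρ g e G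
          + A.trace • applyComp (deriv ρ) (residual ρ g e G)‖ ^ 2 / n|
        ≤ K * ((√n)⁻¹ * (‖mEstimator ρ g e G‖ ^ 2
            + ‖applyComp (deriv ρ) (residual ρ g e G)‖ ^ 2 / n
          + √(‖mEstimator ρ g e G‖ ^ 2
            + ‖applyComp (deriv ρ) (residual ρ g e G)‖ ^ 2 / n) * (‖e‖ / √n))) ∧
      |‖mEstimator ρ g e G‖ ^ 2 + ‖e‖ ^ 2 / n - ‖residual ρ g e G
          + A.trace • applyComp (deriv ρ) (residual ρ g e G)‖ ^ 2 / n|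
        ≤ K * ((√n)⁻¹ * (‖residual ρ g e G
          + A.trace • applyComp (deriv ρ) (residual ρ g e G)‖ ^ 2 / n)) := by
  set C := nullConst γ μ M with hC
  have hC1 : 1 ≤ C := one_le_nullConst hγ hμ hM
  have hB := fluctConst_nonneg hμ hM
  set K1 := fluctConst μ M * C with hK1
  have hK10 : 0 ≤ K1 := by positivity
  -- beyond the sample size `N` the error is at most a third of the target plus the proxy
  set N := (6 * K1) ^ 2 with hN
  obtain ⟨c4, hc4⟩ : ∃ c, c = 2 * (M * γ * N / μ ^ 2) + (2 * M ^ 2 + 2 + 2 * M ^ 3 * N)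
        * (2 * N + 2 * (M * γ * N ^ 2) * (M * γ * N / μ ^ 2)) := ⟨_, rfl⟩
  have hc40 : 0 ≤ c4 := by rw [hc4]; positivity
  refine ⟨K1 * (2 * (c4 + 3)), by positivity, ?_⟩
  intro n p ρ g e G A H hn hp he hG hA hs
  have hn0 : (0 : ℝ) < n := by exact_mod_cast hn
  have hw2 : √(n : ℝ) ^ 2 = n := Real.sq_sqrt (by positivity)
  have hw0 : 0 < √(n : ℝ) := Real.sqrt_pos.2 hn0
  have hD0 := nullSize_nonneg (p := p) ρ g e
  have h1 := hG.abs_sub_proxy_le H hn hM hA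
  have h2 := hG.nullSize_le H hγ hn hp hM hA
  rw [← hC] at h2
  obtain ⟨i, hi⟩ := hG.exists_score_ne_zero H hn he
  have hT := H.trace_nonneg hn hA hs hi
  have h3 := H.norm_residual_le_norm_add e G hT
  have h4 := H.norm_score_le e G
  have h5 := fun hnN => hG.target_le_proxy_of_le H hγ hn hp hM (N := N) hnN
    (P := ‖residual ρ g e G + A.trace • applyComp (deriv ρ) (residual ρ g e G)‖ ^ 2 / n)
    (by rw [mul_div_cancel₀ _ hn0.ne']; gcongr)
  set D0 := nullSize ρ g e
  set h := mEstimator ρ g e G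
  set ψ := applyComp (deriv ρ) (residual ρ g e G)
  set Px := ‖residual ρ g e G + A.trace • ψ‖ ^ 2 / n with hPx
  set D := ‖h‖ ^ 2 + ‖ψ‖ ^ 2 / n with hD
  have hDnn : 0 ≤ D := by positivity
  have hPx0 : 0 ≤ Px := by positivity
  set E := ‖e‖ / √n with hE
  have hE0 : 0 ≤ E := by positivity
  have hE2 : E ^ 2 = ‖e‖ ^ 2 / n := by rw [hE, div_pow, hw2]
  set L := ‖h‖ ^ 2 + ‖e‖ ^ 2 / n with hL
  set R := D + √D * E with hR
  have hR0 : 0 ≤ R := by positivity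
  have i1 : |L - Px| ≤ K1 * ((√n)⁻¹ * R) := by
    refine h1.trans ?_
    have t1 : √D0 ≤ C * √D := by
      rw [← Real.sqrt_sq (by linarith : (0 : ℝ) ≤ C), ← Real.sqrt_mul (sq_nonneg C)]
      refine Real.sqrt_le_sqrt (h2.trans ?_)
      rw [sq]
      exact mul_le_mul_of_nonneg_right (le_mul_of_one_le_left (by linarith) hC1) hDnn
    calc fluctConst μ M * ((√n)⁻¹ * (D0 + √D0 * E))
        ≤ fluctConst μ M * ((√n)⁻¹ * (C * D + C * √D * E)) := by gcongr
      _ = _ := by rw [hK1, hR]; ring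
  have i2 : R ≤ 2 * (L + Px) := by
    have t1 : ‖ψ‖ ^ 2 / n ≤ Px := by
      rw [hPx]; gcongr; exact h4.trans h3
    have t2 : D ≤ L + Px := by
      have : 0 ≤ ‖e‖ ^ 2 / n := by positivity
      rw [hD, hL]; linarith
    have t3 : E ^ 2 ≤ L := by rw [hE2, hL]; linarith [sq_nonneg ‖h‖]
    have t4 : √D * E ≤ (D + E ^ 2) / 2 := by
      have := Real.sq_sqrt hDnn
      nlinarith [sq_nonneg (√D - E)]
    rw [hR]
    have hL0 : 0 ≤ L := by positivity
    linarith
  have i3 : L ≤ (c4 + 2) * Px := by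
    by_cases hnN : (n : ℝ) ≤ N
    · have t1 := h5 hnN
      rw [← hc4] at t1
      linarith
    · push Not at hnN
      exact target_le_of_large hc40 hPx0 hw0 (Real.le_sqrt_of_sq_le hnN.le) hR0 i1 i2
  refine ⟨i1.trans ?_, i1.trans ?_⟩
  · exact mul_le_mul_of_nonneg_right (le_mul_of_one_le_right hK10 (by linarith))
      (mul_nonneg (inv_nonneg.2 hw0.le) hR0)
  · exact rescale_bound hK10 hw0 i2 i3

/-! ### The probability of a typical design -/

/-- The constant in the bound for the second moment of the Gaussian divergences. -/
noncomputable def divConst (γ μ : ℝ) : ℝ :=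
  6 * looConst γ μ + 4 * γ / μ ^ 2 * (2 + 2 * μ * momentConst γ μ) + 4 * momentConst γ μ / μ

/-- Markov's inequality, in normalized form. -/
theorem measure_lt_le {α : Type*} [MeasurableSpace α] {ν : Measure α} {f : α → ℝ} {K M : ℝ}
    (hf : AEMeasurable f ν) (hK : 0 < K) (hM : 0 < M) {C : ℝ}
    (h : ∫⁻ x, ENNReal.ofReal (f x) ∂ν ≤ ENNReal.ofReal (C * K)) :
    ν {x | M * K < f x} ≤ ENNReal.ofReal (C / M) := by
  have hMK : 0 < M * K := mul_pos hM hK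
  have h1 := mul_meas_ge_le_lintegral₀ (μ := ν) hf.ennreal_ofReal (ENNReal.ofReal (M * K))
  have h2 : ν {x | M * K < f x} ≤ ν {x | ENNReal.ofReal (M * K) ≤ ENNReal.ofReal (f x)} :=
    measure_mono fun x (hx : M * K < f x) => ENNReal.ofReal_le_ofReal hx.le
  have h3 : ENNReal.ofReal (M * K) * ν {x | M * K < f x} ≤ ENNReal.ofReal (C * K) :=
    (mul_le_mul_right h2 _).trans (h1.trans h)
  have h4 : ENNReal.ofReal (C * K) = ENNReal.ofReal (M * K) * ENNReal.ofReal (C / M) := by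
    rw [← ENNReal.ofReal_mul hMK.le]
    congr 1
    field_simp
  rw [h4] at h3
  exact (ENNReal.mul_le_mul_iff_right (by simpa using hMK) ENNReal.ofReal_ne_top).1 h3

theorem PolyGrowth.measure_lt_le {n p : ℕ} {f : Design n p → ℝ} (hf : PolyGrowth f)
    (h0 : ∀ x, 0 ≤ f x) {K M C : ℝ} (hK : 0 < K) (hM : 0 < M)
    (h : ∫ G, f G ∂gaussDesign n p ≤ C * K) :
    gaussDesign n p {G | M * K < f G} ≤ ENNReal.ofReal (C / M) := by
  refine RobustReg.measure_lt_le hf.continuous.measurable.aemeasurable hK hM ?_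
  rw [← ofReal_integral_eq_lintegral_ofReal (hf.integrable _) (Filter.Eventually.of_forall h0)]
  exact ENNReal.ofReal_le_ofReal h

/-- A Gaussian linear form is close to any given number with small probability only. -/
theorem gaussDesign_inner_close_le {n p : ℕ} (i : Fin n) (w : Vec p) (c : ℝ) {M : ℝ} (hM : 0 < M) :
    gaussDesign n p {G | M * |c - inner ℝ (G i) w| < ‖w‖} ≤ ENNReal.ofReal (1 / M) := by
  by_cases hw : w = 0
  · have : {G : Design n p | M * |c - inner ℝ (G i) w| < ‖w‖} = ∅ := by
      ext G
      simp only [hw, norm_zero, Set.mem_ofPred_eq, Set.mem_empty_iff_false, iff_false, not_lt]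
      positivity
    rw [this]; simp
  have hw0 : 0 < ‖w‖ := norm_pos_iff.2 hw
  have h1 : MeasurePreserving (Function.eval i) (gaussDesign n p) (stdGaussian (Vec p)) :=
    measurePreserving_eval (fun _ : Fin n => stdGaussian (Vec p)) i
  have hm : Measurable fun z : Vec p => inner ℝ z w := by fun_prop
  set S : Set ℝ := Set.Ioo (c - ‖w‖ / M) (c + ‖w‖ / M) with hS
  have e1 : {G : Design n p | M * |c - inner ℝ (G i) w| < ‖w‖}
      = Function.eval i ⁻¹' ((fun z : Vec p => inner ℝ z w) ⁻¹' S) := by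
    ext G
    simp only [Set.mem_ofPred_eq, Set.mem_preimage, hS, Set.mem_Ioo, Function.eval]
    rw [← lt_div_iff₀' hM, abs_lt]
    constructor <;> rintro ⟨h1, h2⟩ <;> constructor <;> linarith
  have hSm : MeasurableSet S := measurableSet_Ioo
  rw [e1, h1.measure_preimage (hm hSm).nullMeasurableSet, ← Measure.map_apply hm hSm,
    map_inner_stdGaussian, Measure.map_apply (by fun_prop) hSm]
  have e2 : (fun x => ‖w‖ * x) ⁻¹' S = Set.Ioo (c / ‖w‖ - 1 / M) (c / ‖w‖ + 1 / M) := by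
    ext x
    simp only [Set.mem_preimage, hS, Set.mem_Ioo]
    have a1 : c - ‖w‖ / M = ‖w‖ * (c / ‖w‖ - 1 / M) := by field_simp
    have a2 : c + ‖w‖ / M = ‖w‖ * (c / ‖w‖ + 1 / M) := by field_simp
    rw [a1, a2, mul_lt_mul_iff_right₀ hw0, mul_lt_mul_iff_right₀ hw0]
  rw [e2, gaussianReal_apply _ one_ne_zero]
  -- the interval has length `2 / M` and the Gaussian density is at most `1 / 2`
  have h2 : ∀ x, gaussianPDF 0 1 x ≤ ENNReal.ofReal (1 / 2) := fun x => by
    rw [gaussianPDF]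
    refine ENNReal.ofReal_le_ofReal ?_
    rw [gaussianPDFReal]
    have t1 : Real.exp (-(x - 0) ^ 2 / (2 * ((1 : NNReal) : ℝ))) ≤ 1 := by
      rw [Real.exp_le_one_iff]
      have := sq_nonneg (x - 0)
      simp only [NNReal.coe_one]
      linarith
    have t2 : (√(2 * Real.pi * ((1 : NNReal) : ℝ)))⁻¹ ≤ 1 / 2 := by
      rw [inv_le_comm₀ (Real.sqrt_pos.2 (by simp [Real.pi_pos])) (by norm_num)]
      refine Real.le_sqrt_of_sq_le ?_
      have := Real.pi_gt_three
      simp only [NNReal.coe_one]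
      norm_num
      linarith
    refine (mul_le_mul t2 t1 (Real.exp_pos _).le (by norm_num)).trans (le_of_eq (mul_one _))
  refine (lintegral_mono h2).trans ?_
  rw [lintegral_const, Measure.restrict_apply MeasurableSet.univ, Set.univ_inter, Real.volume_Ioo,
    ← ENNReal.ofReal_mul (by norm_num)]
  refine ENNReal.ofReal_le_ofReal (le_of_eq ?_)
  ring

/-- The constant in the bound for the probability that a design is not typical. -/
noncomputable def typicalConst (γ μ : ℝ) : ℝ :=
  momentConst γ μ + 2 * looConst γ μ + divConst γ μ + (momentConst γ μ + 2 * looConst γ μ)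
    + (fourthMoment + 1) * (momentConst γ μ + 4 * looSqConst γ μ) + 3

theorem measure_union_le_ofReal {α : Type*} [MeasurableSpace α] {m : Measure α} {s t : Set α}
    {a b : ℝ} (ha : 0 ≤ a) (hs : m s ≤ ENNReal.ofReal a) (ht : m t ≤ ENNReal.ofReal b)
    (hb : 0 ≤ b) : m (s ∪ t) ≤ ENNReal.ofReal (a + b) := by
  rw [ENNReal.ofReal_add ha hb]
  exact (measure_union_le _ _).trans (add_le_add hs ht)

namespace IsotropicProblem

attribute [local irreducible] mEstimator

variable {p : ℕ} {γ μ : ℝ} {ρ : ℝ → ℝ} {g : Vec p → ℝ} {n : ℕ}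

theorem nullSize_pos (H : IsotropicProblem μ ρ g) (hn : 1 ≤ n) {e : Vec n} (he : e ≠ 0) :
    0 < nullSize ρ g e := by
  have hn0 : (0 : ℝ) < n := by exact_mod_cast hn
  obtain ⟨i, hi⟩ : ∃ i, e i ≠ 0 := by
    by_contra hcon
    push Not at hcon
    exact he (by ext i; exact hcon i)
  have h1 : 0 < deriv ρ (e i) ^ 2 := by
    have := H.deriv_eq_zero_iff.not.2 hi
    positivity
  have h2 := sum_sq_le_nullSize (p := p) hn ρ g e
  have h3 : deriv ρ (e i) ^ 2 ≤ ∑ i, deriv ρ (e i) ^ 2 :=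
    Finset.single_le_sum (f := fun i => deriv ρ (e i) ^ 2) (fun _ _ => sq_nonneg _)
      (Finset.mem_univ i)
  exact (mul_pos_iff_of_pos_left hn0).1 (by linarith)

theorem measurable_inner_sub_rowDiv (H : IsotropicProblem μ ρ g) (hn : 1 ≤ n) (e : Vec n)
    (i : Fin n) : Measurable fun G : Design n p => (inner ℝ (G i)
      (mEstimator ρ g e G - maskedEstimator ρ g e {i} G) - rowDiv ρ g e i G) ^ 2 := by
  have hcm := H.continuous_maskedEstimator (n := n) hn e {i}
  have hce := H.continuous_maskedEstimator (n := n) hn e ∅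
  simp only [maskedEstimator_empty] at hce
  have hmd : Measurable fun G : Design n p => rowDiv ρ g e i G :=
    (H.measurable_rowDiv (n := n) hn i).comp measurable_prodMk_left
  have hrow : Continuous fun G : Design n p => G i := by fun_prop
  exact ((hrow.inner (hce.sub hcm)).measurable.sub hmd).pow_const 2

/-- The total mean squared error in the approximation of `⟨Gᵢ, h - h⁽ⁱ⁾⟩` by the divergence of `h` in
row `i`. -/
theorem lintegral_sum_inner_sub_rowDiv_sq_le (H : IsotropicProblem μ ρ g) (hγ : 0 < γ)
    (hn : 1 ≤ n) (hp : (p : ℝ) ≤ γ * n) (e : Vec n)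
    (hreg : ∀ᵐ G ∂gaussDesign n p, ∃ A, IsDerivMatrix μ ρ g 1 e G A) :
    ∫⁻ G : Design n p, ENNReal.ofReal (∑ i, (inner ℝ (G i) (mEstimator ρ g e G
        - maskedEstimator ρ g e {i} G) - rowDiv ρ g e i G) ^ 2) ∂gaussDesign n p
      ≤ ENNReal.ofReal (divConst γ μ * nullSize ρ g e) := by
  have hμ := H.mu_pos
  have hn0 : (0 : ℝ) < n := by exact_mod_cast hn
  have hD0 := nullSize_nonneg ρ g e
  have hM := one_le_momentConst γ μ
  have hb1 := fun i => (H.polyGrowth_norm_maskedEstimator_sub hn e ∅ {i}).pow 2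
  have hb2 := fun i => (H.polyGrowth_score hn e i).pow 2
  have hb3 := (H.polyGrowth_maskedEstimator hn e ∅).pow 2
  simp only [maskedEstimator_empty] at hb1 hb3
  have hP : ∀ i, PolyGrowth fun G : Design n p => 3 * ‖mEstimator ρ g e G
          - maskedEstimator ρ g e {i} G‖ ^ 2 + 2 * (2 * (score ρ g e G i ^ 2 * (p / (n * μ) ^ 2))
          + 2 * (‖mEstimator ρ g e G‖ ^ 2 / (n * μ))) := fun i =>
    ((hb1 i).const_mul 3).add (((((hb2 i).mul (PolyGrowth.const _)).const_mul 2).add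
      ((hb3.div_const _).const_mul 2)).const_mul 2)
  have hmeas : ∀ i, Measurable fun G : Design n p => ENNReal.ofReal ((inner ℝ (G i)
      (mEstimator ρ g e G - maskedEstimator ρ g e {i} G) - rowDiv ρ g e i G) ^ 2) := fun i =>
    (H.measurable_inner_sub_rowDiv hn e i).ennreal_ofReal
  have hF : ∀ G : Design n p, ∑ i, (3 * ‖mEstimator ρ g e G
          - maskedEstimator ρ g e {i} G‖ ^ 2 + 2 * (2 * (score ρ g e G i ^ 2 * (p / (n * μ) ^ 2))
          + 2 * (‖mEstimator ρ g e G‖ ^ 2 / (n * μ))))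
      = 3 * ∑ i, ‖mEstimator ρ g e G - maskedEstimator ρ g e {i} G‖ ^ 2
        + 4 * (p / (n * μ) ^ 2) * ∑ i, score ρ g e G i ^ 2
        + 4 / μ * ‖mEstimator ρ g e G‖ ^ 2 := fun G => by
    rw [Finset.sum_add_distrib, ← Finset.mul_sum, ← Finset.mul_sum, Finset.sum_add_distrib,
      ← Finset.mul_sum, ← Finset.sum_mul]
    simp only [Finset.sum_const, Finset.card_univ, Fintype.card_fin, nsmul_eq_mul]
    have : (n : ℝ) * (2 * (‖mEstimator ρ g e G‖ ^ 2 / (n * μ)))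
        = 2 / μ * ‖mEstimator ρ g e G‖ ^ 2 := by field_simp
    rw [this]
    ring
  calc _ = ∫⁻ G : Design n p, ∑ i, ENNReal.ofReal ((inner ℝ (G i) (mEstimator ρ g e G
        - maskedEstimator ρ g e {i} G) - rowDiv ρ g e i G) ^ 2) ∂gaussDesign n p := by
        refine lintegral_congr fun G => ?_
        rw [ENNReal.ofReal_sum_of_nonneg fun i _ => sq_nonneg _]
    _ = ∑ i, ∫⁻ G : Design n p, ENNReal.ofReal ((inner ℝ (G i) (mEstimator ρ g e G
        - maskedEstimator ρ g e {i} G) - rowDiv ρ g e i G) ^ 2) ∂gaussDesign n p :=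
        lintegral_finsetSum _ fun i _ => hmeas i
    _ ≤ ∑ i, ENNReal.ofReal (∫ G : Design n p, (3 * ‖mEstimator ρ g e G
          - maskedEstimator ρ g e {i} G‖ ^ 2 + 2 * (2 * (score ρ g e G i ^ 2 * (p / (n * μ) ^ 2))
          + 2 * (‖mEstimator ρ g e G‖ ^ 2 / (n * μ)))) ∂gaussDesign n p) := by
        refine Finset.sum_le_sum fun i _ => ?_
        refine (H.lintegral_inner_sub_rowDiv_sq_le hn e hreg i).trans (le_of_eq ?_)
        rw [ofReal_integral_eq_lintegral_ofReal ((hP i).integrable _)]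
        exact Filter.Eventually.of_forall fun G => by positivity
    _ = ENNReal.ofReal (∫ G : Design n p, ∑ i, (3 * ‖mEstimator ρ g e G
          - maskedEstimator ρ g e {i} G‖ ^ 2 + 2 * (2 * (score ρ g e G i ^ 2 * (p / (n * μ) ^ 2))
          + 2 * (‖mEstimator ρ g e G‖ ^ 2 / (n * μ)))) ∂gaussDesign n p) := by
        rw [integral_finsetSum _ fun i _ => (hP i).integrable _,
          ENNReal.ofReal_sum_of_nonneg]
        exact fun i _ => integral_nonneg fun G => by positivity
    _ ≤ _ := by
        refine ENNReal.ofReal_le_ofReal ?_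
        simp_rw [hF]
        have c1 := ((PolyGrowth.sum Finset.univ fun i _ => hb1 i).const_mul 3).integrable
          (gaussDesign n p)
        have c2 := ((PolyGrowth.sum Finset.univ fun i _ => hb2 i).const_mul
          (4 * (p / (n * μ) ^ 2))).integrable (gaussDesign n p)
        have c3 := (hb3.const_mul (4 / μ)).integrable (gaussDesign n p)
        have c12 : Integrable (fun G : Design n p => 3 * ∑ i, ‖mEstimator ρ g e G
          - maskedEstimator ρ g e {i} G‖ ^ 2 + 4 * (p / (n * μ) ^ 2) * ∑ i, score ρ g e G i ^ 2)
          (gaussDesign n p) := c1.add c2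
        rw [integral_add c12 c3, integral_add c1 c2]
        simp only [integral_const_mul]
        have b1 := H.integral_sum_norm_sub_sq_le hγ hn hp e
        have b2 := H.integral_sum_score_sq_le hn hp e
        have b3 := H.integral_norm_sq_le hn hp e ∅
        simp only [maskedEstimator_empty] at b3
        have hp2 : (p : ℝ) / (n * μ) ^ 2 ≤ γ * n / (n * μ) ^ 2 := by gcongr
        calc _ ≤ 3 * (2 * looConst γ μ * nullSize ρ g e) + 4 * (γ * n / (n * μ) ^ 2)
              * (n * ((2 + 2 * μ * momentConst γ μ) * nullSize ρ g e))
              + 4 / μ * (momentConst γ μ * nullSize ρ g e) := by gcongr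
          _ = _ := by rw [divConst]; field_simp; ring

set_option maxHeartbeats 1000000 in
/-- A design is typical at level `M` with probability `1 - O(1/M)`: Markov's inequality for seven
quantities, and anti-concentration of a Gaussian linear form for the last one. -/
theorem measure_not_typical_le (H : IsotropicProblem μ ρ g) (hγ : 0 < γ) (hn : 1 ≤ n)
    (hp : (p : ℝ) ≤ γ * n) {e : Vec n} (he : e ≠ 0)
    (hreg : ∀ᵐ G ∂gaussDesign n p, ∃ A, IsDerivMatrix μ ρ g 1 e G A) {M : ℝ} (hM : 0 < M) :
    gaussDesign n p {G | ¬ TypicalDesign ρ g e M G} ≤ ENNReal.ofReal (typicalConst γ μ / M) := by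
  have hμ := H.mu_pos
  have hn0 : (0 : ℝ) < n := by exact_mod_cast hn
  have hD := H.nullSize_pos hn he
  have hmc := one_le_momentConst γ μ
  have hlc := H.looConst_nonneg hγ
  have hlsc := H.looSqConst_nonneg hγ
  have hm4 := fourthMoment_nonneg
  have he0 : 0 < ‖e‖ ^ 2 := by positivity
  have hb1 := fun i => (H.polyGrowth_norm_maskedEstimator_sub hn e ∅ {i}).pow 2
  have hb3 := (H.polyGrowth_maskedEstimator hn e ∅).pow 2
  simp only [maskedEstimator_empty] at hb1 hb3
  have hin := fun i => H.polyGrowth_inner_maskedEstimator hn e {i} i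
  have m1 : gaussDesign n p {G | M * nullSize ρ g e < ‖mEstimator ρ g e G‖ ^ 2}
      ≤ ENNReal.ofReal (momentConst γ μ / M) := by
    refine hb3.measure_lt_le (fun _ => sq_nonneg _) hD hM ?_
    simpa only [maskedEstimator_empty] using H.integral_norm_sq_le hn hp e ∅
  have m2 : gaussDesign n p {G | M * nullSize ρ g e < ∑ i, ‖mEstimator ρ g e G
      - maskedEstimator ρ g e {i} G‖ ^ 2} ≤ ENNReal.ofReal (2 * looConst γ μ / M) :=
    (PolyGrowth.sum Finset.univ fun i _ => hb1 i).measure_lt_le (fun _ => by positivity) hD hM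
      (H.integral_sum_norm_sub_sq_le hγ hn hp e)
  have m3 : gaussDesign n p {G | M * nullSize ρ g e < ∑ i, (inner ℝ (G i) (mEstimator ρ g e G
      - maskedEstimator ρ g e {i} G) - rowDiv ρ g e i G) ^ 2}
      ≤ ENNReal.ofReal (divConst γ μ / M) := by
    exact measure_lt_le (Finset.measurable_sum _ fun i _ =>
      H.measurable_inner_sub_rowDiv hn e i).aemeasurable hD hM
      (H.lintegral_sum_inner_sub_rowDiv_sq_le hγ hn hp e hreg)
  have m4 : gaussDesign n p {G | M * (‖e‖ ^ 2 * nullSize ρ g e)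
      < (∑ i, e i * inner ℝ (G i) (maskedEstimator ρ g e {i} G)) ^ 2}
      ≤ ENNReal.ofReal ((momentConst γ μ + 2 * looConst γ μ) / M) :=
    ((PolyGrowth.sum Finset.univ fun i _ => (hin i).const_mul (e i)).pow 2).measure_lt_le
      (fun _ => sq_nonneg _) (mul_pos he0 hD) hM (H.integral_sum_mul_inner_sq_le hγ hn hp e)
  have m5 : gaussDesign n p {G | M * (n * nullSize ρ g e ^ 2)
      < (∑ i, (inner ℝ (G i) (maskedEstimator ρ g e {i} G) ^ 2
        - ‖maskedEstimator ρ g e {i} G‖ ^ 2)) ^ 2}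
      ≤ ENNReal.ofReal ((fourthMoment + 1) * (momentConst γ μ + 4 * looSqConst γ μ) / M) :=
    ((PolyGrowth.sum Finset.univ fun i _ => ((hin i).pow 2).sub
      ((H.polyGrowth_maskedEstimator hn e {i}).pow 2)).pow 2).measure_lt_le
      (fun _ => sq_nonneg _) (by positivity) hM (H.integral_sum_sq_sub_sq_le hγ hn hp e)
  set h0 := mEstimator ρ g e (0 : Design n p) with hh0
  have m6 : gaussDesign n p {G | M * (n * ‖h0‖ ^ 2) < ∑ i, inner ℝ (G i) h0 ^ 2}
      ≤ ENNReal.ofReal (1 / M) := by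
    by_cases hz : h0 = 0
    · simp [hz]
    · have : 0 < ‖h0‖ := norm_pos_iff.2 hz
      refine (PolyGrowth.sum Finset.univ fun i _ => (polyGrowth_inner_row i h0).pow 2).measure_lt_le
        (fun _ => by positivity) (by positivity) hM ?_
      rw [integral_finsetSum _ fun i _ => ((polyGrowth_inner_row i h0).pow 2).integrable _]
      simp_rw [integral_inner_row_pow, integral_inner_sq]
      simp
  have m7 : gaussDesign n p {G | M * (n * p) < ∑ i, ‖G i‖ ^ 2} ≤ ENNReal.ofReal (1 / M) := by
    by_cases hz : p = 0
    · subst hz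
      have : ∀ v : Vec 0, v = 0 := fun v => Subsingleton.elim _ _
      simp [this]
    · have hp0 : (0 : ℝ) < p := by exact_mod_cast Nat.pos_of_ne_zero hz
      refine (PolyGrowth.sum Finset.univ fun i _ =>
        (polyGrowth_row (p := p) i).pow 2).measure_lt_le
        (fun _ => by positivity) (by positivity) hM ?_
      rw [integral_finsetSum _ fun i _ => ((polyGrowth_row i).pow 2).integrable _]
      have h1 : ∀ i : Fin n, ∫ G : Design n p, ‖G i‖ ^ 2 ∂gaussDesign n p = p := fun i => by
        have := (measurePreserving_eval (fun _ : Fin n => stdGaussian (Vec p)) i).map_eq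
        rw [← integral_norm_sq_stdGaussian p, ← this,
          integral_map (measurable_pi_apply i).aemeasurable (by fun_prop)]
      simp_rw [h1]
      simp
  have m8 := gaussDesign_inner_close_le (p := p) (⟨0, hn⟩ : Fin n) h0 (e ⟨0, hn⟩) hM
  have hd : 0 ≤ divConst γ μ := by unfold divConst; positivity
  have q1 : 0 ≤ momentConst γ μ / M := by positivity
  have q2 : 0 ≤ 2 * looConst γ μ / M := by positivity
  have q3 : 0 ≤ divConst γ μ / M := by positivity
  have q4 : 0 ≤ (momentConst γ μ + 2 * looConst γ μ) / M := by positivity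
  have q5 : 0 ≤ (fourthMoment + 1) * (momentConst γ μ + 4 * looSqConst γ μ) / M := by positivity
  have q6 : 0 ≤ 1 / M := by positivity
  have hU := measure_union_le_ofReal q1 m1 (measure_union_le_ofReal q2 m2
    (measure_union_le_ofReal q3 m3 (measure_union_le_ofReal q4 m4 (measure_union_le_ofReal q5 m5
    (measure_union_le_ofReal q6 m6 (measure_union_le_ofReal q6 m7 m8 q6) (by positivity))
    (by positivity)) (by positivity)) (by positivity)) (by positivity)) (by positivity)
  refine (measure_mono fun G hG => ?_).trans (hU.trans
    (ENNReal.ofReal_le_ofReal (le_of_eq ?_)))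
  · by_contra hcon
    refine hG ?_
    simp only [Set.mem_union, not_or] at hcon
    obtain ⟨n1, n2, n3, n4, n5, n6, n7, n8⟩ := hcon
    exact ⟨not_lt.1 n1, not_lt.1 n2, not_lt.1 n3, not_lt.1 n4, not_lt.1 n5, not_lt.1 n6,
      not_lt.1 n7, ⟨⟨0, hn⟩, not_lt.1 n8⟩⟩
  · rw [typicalConst]
    ring

end IsotropicProblem

/-! ### The isotropic problem with random noise -/

/-- A measurable expression of the data that equals the trace of every derivative matrix as soon as
the score does not vanish. The derivative matrix itself is only known to exist, without any
measurability. -/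
noncomputable def traceFun {n p : ℕ} (ρ : ℝ → ℝ) (g : Vec p → ℝ) (e : Vec n) (G : Design n p) : ℝ :=
  (∑ i, score ρ g e G i * (rowDiv ρ g e i G + inner ℝ (mEstimator ρ g e G)
    (fderiv ℝ (fun e' : Vec n => mEstimator ρ g e' G) e (EuclideanSpace.single i 1))))
    / ∑ i, score ρ g e G i ^ 2

/-- The proxy of the isotropic problem, with `traceFun` in place of the trace. -/
noncomputable def proxyFun {n p : ℕ} (ρ : ℝ → ℝ) (g : Vec p → ℝ) (e : Vec n) (G : Design n p) : ℝ :=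
  ‖residual ρ g e G + traceFun ρ g e G • applyComp (deriv ρ) (residual ρ g e G)‖ ^ 2 / n

/-- The remainder of the isotropic problem. -/
noncomputable def remainderFun {n p : ℕ} (ρ : ℝ → ℝ) (g : Vec p → ℝ) (e : Vec n)
    (G : Design n p) : ℝ :=
  ‖mEstimator ρ g e G‖ ^ 2 + ‖applyComp (deriv ρ) (residual ρ g e G)‖ ^ 2 / n
    + √(‖mEstimator ρ g e G‖ ^ 2 + ‖applyComp (deriv ρ) (residual ρ g e G)‖ ^ 2 / n)
      * (‖e‖ / √n)

/-- The error of the proxy in the isotropic problem. -/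
noncomputable def gapFun {n p : ℕ} (ρ : ℝ → ℝ) (g : Vec p → ℝ) (e : Vec n) (G : Design n p) : ℝ :=
  ‖mEstimator ρ g e G‖ ^ 2 + ‖e‖ ^ 2 / n - proxyFun ρ g e G

theorem remainderFun_nonneg {n p : ℕ} (ρ : ℝ → ℝ) (g : Vec p → ℝ) (e : Vec n) (G : Design n p) :
    0 ≤ remainderFun ρ g e G := by
  unfold remainderFun; positivity

theorem proxyFun_nonneg {n p : ℕ} (ρ : ℝ → ℝ) (g : Vec p → ℝ) (e : Vec n) (G : Design n p) :
    0 ≤ proxyFun ρ g e G := by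
  unfold proxyFun; positivity

theorem IsDerivMatrix.traceFun_eq {n p : ℕ} {μ : ℝ} {ρ : ℝ → ℝ} {g : Vec p → ℝ} {e : Vec n}
    {G : Design n p} {A : Matrix (Fin p) (Fin p) ℝ} (hA : IsDerivMatrix μ ρ g 1 e G A)
    (hs : ∃ i, score ρ g e G i ≠ 0) : traceFun ρ g e G = A.trace := by
  obtain ⟨i, hi⟩ := hs
  have hpos : 0 < ∑ i, score ρ g e G i ^ 2 :=
    Finset.sum_pos' (fun _ _ => sq_nonneg _) ⟨i, Finset.mem_univ i, by positivity⟩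
  rw [traceFun, div_eq_iff hpos.ne', Finset.mul_sum]
  refine Finset.sum_congr rfl fun i _ => ?_
  rw [hA.rowDiv_eq i]
  ring

namespace IsotropicProblem

attribute [local irreducible] mEstimator

variable {p : ℕ} {γ μ : ℝ} {ρ : ℝ → ℝ} {g : Vec p → ℝ} {n : ℕ}

theorem measurable_score (H : IsotropicProblem μ ρ g) (hn : 1 ≤ n) (i : Fin n) :
    Measurable fun z : Vec n × Design n p => score ρ g z.1 z.2 i :=
  (H.continuous_score hn i).measurable

theorem measurable_fderiv_noise (H : IsotropicProblem μ ρ g) (hn : 1 ≤ n) (v : Vec n) :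
    Measurable fun z : Vec n × Design n p =>
      fderiv ℝ (fun e' : Vec n => mEstimator ρ g e' z.2) z.1 v := by
  have hc : Continuous (Function.uncurry fun (G : Design n p) (e : Vec n) =>
      mEstimator ρ g e G) := (H.continuous_mEstimator (n := n) hn).comp continuous_swap
  exact (measurable_fderiv_apply_const_with_param ℝ hc v).comp measurable_swap

theorem measurable_traceFun (H : IsotropicProblem μ ρ g) (hn : 1 ≤ n) :
    Measurable fun z : Vec n × Design n p => traceFun ρ g z.1 z.2 := by
  have hh := (H.continuous_mEstimator (n := n) hn).measurable
  exact (Finset.measurable_sum _ fun i _ => (H.measurable_score hn i).mul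
    ((H.measurable_rowDiv hn i).add (hh.inner (H.measurable_fderiv_noise hn _)))).div
    (Finset.measurable_sum _ fun i _ => (H.measurable_score hn i).pow_const 2)

theorem measurable_scoreVec (H : IsotropicProblem μ ρ g) (hn : 1 ≤ n) :
    Measurable fun z : Vec n × Design n p => applyComp (deriv ρ) (residual ρ g z.1 z.2) :=
  (WithLp.measurable_toLp 2 _).comp (measurable_pi_lambda _ fun i => H.measurable_score hn i)

theorem measurable_residual (H : IsotropicProblem μ ρ g) (hn : 1 ≤ n) :
    Measurable fun z : Vec n × Design n p => residual ρ g z.1 z.2 := by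
  have hh := H.continuous_mEstimator (n := n) hn
  have hd : Continuous fun z : Vec n × Design n p => designMul z.2 (mEstimator ρ g z.1 z.2) := by
    refine (PiLp.continuous_toLp 2 _).comp (continuous_pi fun i => ?_)
    exact ((continuous_apply i).comp continuous_snd).inner hh
  exact (continuous_fst.sub hd).measurable

theorem measurable_proxyFun (H : IsotropicProblem μ ρ g) (hn : 1 ≤ n) :
    Measurable fun z : Vec n × Design n p => proxyFun ρ g z.1 z.2 :=
  ((((H.measurable_residual hn).add ((H.measurable_traceFun hn).smul
    (H.measurable_scoreVec hn))).norm).pow_const 2).div_const _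

theorem measurable_remainderFun (H : IsotropicProblem μ ρ g) (hn : 1 ≤ n) :
    Measurable fun z : Vec n × Design n p => remainderFun ρ g z.1 z.2 := by
  have hh := (H.continuous_mEstimator (n := n) hn).measurable
  have hD := (hh.norm.pow_const 2).add (((H.measurable_scoreVec hn).norm.pow_const 2).div_const
    (n : ℝ))
  exact hD.add (hD.sqrt.mul (measurable_fst.norm.div_const _))

theorem measurable_gapFun (H : IsotropicProblem μ ρ g) (hn : 1 ≤ n) :
    Measurable fun z : Vec n × Design n p => gapFun ρ g z.1 z.2 := by
  have hh := (H.continuous_mEstimator (n := n) hn).measurable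
  exact ((hh.norm.pow_const 2).add ((measurable_fst.norm.pow_const 2).div_const _)).sub
    (H.measurable_proxyFun hn)

/-- Almost every design is typical at some level. -/
theorem ae_exists_typicalDesign (H : IsotropicProblem μ ρ g) (hγ : 0 < γ) (hn : 1 ≤ n)
    (hp : (p : ℝ) ≤ γ * n) {e : Vec n} (he : e ≠ 0)
    (hreg : ∀ᵐ G ∂gaussDesign n p, ∃ A, IsDerivMatrix μ ρ g 1 e G A) :
    ∀ᵐ G ∂gaussDesign n p, ∃ M, 1 ≤ M ∧ TypicalDesign ρ g e M G := by
  rw [ae_iff]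
  have h : ∀ k : ℕ, gaussDesign n p {G | ¬ ∃ M, 1 ≤ M ∧ TypicalDesign ρ g e M G}
      ≤ ENNReal.ofReal (typicalConst γ μ / (k + 1 : ℝ)) := fun k => by
    refine (measure_mono fun G hG => ?_).trans
      (H.measure_not_typical_le hγ hn hp he hreg (M := (k + 1 : ℝ)) (by positivity))
    exact fun hT => hG ⟨_, by simp, hT⟩
  have hlim : Filter.Tendsto (fun k : ℕ => ENNReal.ofReal (typicalConst γ μ / (k + 1 : ℝ)))
      Filter.atTop (nhds 0) := by
    rw [← ENNReal.ofReal_zero]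
    refine ENNReal.tendsto_ofReal ?_
    have := tendsto_one_div_add_atTop_nhds_zero_nat (𝕜 := ℝ)
    simpa [div_eq_mul_inv] using this.const_mul (typicalConst γ μ)
  exact le_antisymm (ge_of_tendsto' hlim h) (by simp)

end IsotropicProblem

theorem sqrt_inv_eq_rpow (n : ℕ) : (√(n : ℝ))⁻¹ = (n : ℝ) ^ (-(1 / 2) : ℝ) := by
  rw [Real.rpow_neg (by positivity), Real.sqrt_eq_rpow]

/-- If `F` is small compared with `R`, then so is the ratio `F / R`, which times `R` gives back `F`
even when `R = 0`, because then `F = 0`. -/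
theorem div_bounds {K w F R : ℝ} (hK : 0 ≤ K) (hw : 0 < w) (hR : 0 ≤ R)
    (h : |F| ≤ K * (w * R)) : |F / R| < (K + 1) * w ∧ F = F / R * R := by
  rcases hR.eq_or_lt with h0 | h0
  · subst h0
    have : F = 0 := by simpa using h
    subst this
    simp only [div_zero, abs_zero, mul_zero, and_true]
    positivity
  · refine ⟨?_, (div_mul_cancel₀ _ h0.ne').symm⟩
    rw [abs_div, abs_of_pos h0, div_lt_iff₀ h0]
    have : 0 < w * R := by positivity
    linarith

/-- The isotropic form of the theorem, for the joint law of the noise and of the whitened design.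
The two random variables are ratios of the error of the proxy, written with the measurable `traceFun`,
to the remainder and to the proxy. -/
theorem exists_isotropic_const {γ μ : ℝ} (hγ : 0 < γ) (hμ : 0 < μ) :
    ∃ K : ℝ → ℝ, ∀ {n p : ℕ} {ρ : ℝ → ℝ} {g : Vec p → ℝ} (ν : Measure (Vec n))
      [IsProbabilityMeasure ν], IsotropicProblem μ ρ g → 1 ≤ n → (p : ℝ) ≤ γ * n → ν ≪ volume →
      IsOP (ν.prod (gaussDesign n p)) K ((n : ℝ) ^ (-(1 / 2) : ℝ))
        (fun z => gapFun ρ g z.1 z.2 / remainderFun ρ g z.1 z.2) ∧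
      IsOP (ν.prod (gaussDesign n p)) K ((n : ℝ) ^ (-(1 / 2) : ℝ))
        (fun z => gapFun ρ g z.1 z.2 / proxyFun ρ g z.1 z.2) ∧
      ∀ᵐ z ∂ν.prod (gaussDesign n p), (∃ A, IsDerivMatrix μ ρ g 1 z.1 z.2 A) ∧
        (∃ i, score ρ g z.1 z.2 i ≠ 0) ∧
        gapFun ρ g z.1 z.2
          = gapFun ρ g z.1 z.2 / remainderFun ρ g z.1 z.2 * remainderFun ρ g z.1 z.2 ∧
        gapFun ρ g z.1 z.2
          = gapFun ρ g z.1 z.2 / proxyFun ρ g z.1 z.2 * proxyFun ρ g z.1 z.2 := by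
  choose! C hC0 hC using fun M (hM : (1 : ℝ) ≤ M) => exists_deterministic_const hγ hμ hM
  refine ⟨fun δ => C (max 1 (typicalConst γ μ / δ)) + 1, ?_⟩
  intro n p ρ g ν _ H hn hp hν
  have hn0 : (0 : ℝ) < n := by exact_mod_cast hn
  have hw0 : 0 < (√(n : ℝ))⁻¹ := by positivity
  have hprod : ν.prod (gaussDesign n p) ≪ volume :=
    hν.prod (gaussDesign_absolutelyContinuous n p)
  have hreg := hprod.ae_le (H.ae_differentiableAt hn)
  have hreg2 := Measure.ae_ae_of_ae_prod hreg
  have he : ∀ᵐ e ∂ν, e ≠ 0 := by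
    have : Nonempty (Fin n) := ⟨⟨0, hn⟩⟩
    have : Nontrivial (Vec n) := inferInstance
    have h0 : ∀ᵐ e : Vec n, e ≠ 0 := by simp [ae_iff]
    exact hν.ae_le h0
  -- the pointwise bounds, on a typical design at which the problem is regular
  have key : ∀ {M : ℝ} {e : Vec n} {G : Design n p}, 1 ≤ M → e ≠ 0 → TypicalDesign ρ g e M G →
      DifferentiableAt ℝ (fun z : Vec n × Design n p => mEstimator ρ g z.1 z.2) (e, G) →
      (∀ i, DifferentiableAt ℝ (fun z : Vec n × Design n p => score ρ g z.1 z.2 i) (e, G)) →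
      (∃ i, score ρ g e G i ≠ 0) ∧
      (|gapFun ρ g e G / remainderFun ρ g e G| < (C M + 1) * (√(n : ℝ))⁻¹ ∧
        gapFun ρ g e G = gapFun ρ g e G / remainderFun ρ g e G * remainderFun ρ g e G) ∧
      (|gapFun ρ g e G / proxyFun ρ g e G| < (C M + 1) * (√(n : ℝ))⁻¹ ∧
        gapFun ρ g e G = gapFun ρ g e G / proxyFun ρ g e G * proxyFun ρ g e G) := by
    intro M e G hM he hT hd hs
    obtain ⟨A, hA⟩ := H.exists_isDerivMatrix hn hd hs
    have hsc := hT.exists_score_ne_zero H hn he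
    have htr := hA.traceFun_eq hsc
    obtain ⟨b1, b2⟩ := hC M hM H hn hp he hT hA hs
    rw [← htr] at b1 b2
    exact ⟨hsc, div_bounds (hC0 M hM) hw0 (remainderFun_nonneg ρ g e G) b1,
      div_bounds (hC0 M hM) hw0 (proxyFun_nonneg ρ g e G) b2⟩
  have hex : ∀ᵐ e ∂ν, ∀ᵐ G ∂gaussDesign n p, ∃ A, IsDerivMatrix μ ρ g 1 e G A := by
    filter_upwards [hreg2] with e h
    filter_upwards [h] with G hG
    exact H.exists_isDerivMatrix hn hG.1 hG.2
  have hm1 : Measurable fun z : Vec n × Design n p =>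
      gapFun ρ g z.1 z.2 / remainderFun ρ g z.1 z.2 :=
    (H.measurable_gapFun hn).div (H.measurable_remainderFun hn)
  have hm2 : Measurable fun z : Vec n × Design n p =>
      gapFun ρ g z.1 z.2 / proxyFun ρ g z.1 z.2 :=
    (H.measurable_gapFun hn).div (H.measurable_proxyFun hn)
  have tail : ∀ (w : Vec n × Design n p → ℝ), Measurable w →
      (∀ {M : ℝ} {e : Vec n} {G : Design n p}, 1 ≤ M → e ≠ 0 → TypicalDesign ρ g e M G →
        DifferentiableAt ℝ (fun z : Vec n × Design n p => mEstimator ρ g z.1 z.2) (e, G) →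
        (∀ i, DifferentiableAt ℝ (fun z : Vec n × Design n p => score ρ g z.1 z.2 i) (e, G)) →
        |w (e, G)| < (C M + 1) * (√(n : ℝ))⁻¹) →
      IsOP (ν.prod (gaussDesign n p)) (fun δ => C (max 1 (typicalConst γ μ / δ)) + 1)
        ((n : ℝ) ^ (-(1 / 2) : ℝ)) w := by
    intro w hw hb
    refine ⟨hw, fun δ hδ => ?_⟩
    rw [← sqrt_inv_eq_rpow]
    set M := max 1 (typicalConst γ μ / δ) with hMdef
    have hM1 : 1 ≤ M := le_max_left _ _
    have hMδ : typicalConst γ μ / M ≤ δ := by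
      rw [div_le_iff₀ (by linarith), mul_comm, ← div_le_iff₀ hδ]
      exact le_max_right _ _
    rw [Measure.prod_apply (measurableSet_le measurable_const hw.abs)]
    calc _ ≤ ∫⁻ _ : Vec n, ENNReal.ofReal δ ∂ν := by
          refine lintegral_mono_ae ?_
          filter_upwards [he, hreg2, hex] with e he h hx
          refine le_trans ?_ ((H.measure_not_typical_le hγ hn hp he hx
            (M := M) (by linarith)).trans (ENNReal.ofReal_le_ofReal hMδ))
          refine measure_mono_ae ?_
          filter_upwards [h] with G hG hmem
          intro hT
          exact absurd (hb hM1 he hT hG.1 hG.2) (not_lt.2 hmem)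
      _ = ENNReal.ofReal δ := by simp
  refine ⟨tail _ hm1 fun hM he hT hd hs => (key hM he hT hd hs).2.1.1,
    tail _ hm2 fun hM he hT hd hs => (key hM he hT hd hs).2.2.1, ?_⟩
  have hmeas : MeasurableSet {z : Vec n × Design n p | (∃ i, score ρ g z.1 z.2 i ≠ 0) ∧
        gapFun ρ g z.1 z.2
          = gapFun ρ g z.1 z.2 / remainderFun ρ g z.1 z.2 * remainderFun ρ g z.1 z.2 ∧
        gapFun ρ g z.1 z.2
          = gapFun ρ g z.1 z.2 / proxyFun ρ g z.1 z.2 * proxyFun ρ g z.1 z.2} := by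
    refine MeasurableSet.inter ?_ (MeasurableSet.inter ?_ ?_)
    · have : {z : Vec n × Design n p | ∃ i, score ρ g z.1 z.2 i ≠ 0}
          = ⋃ i, {z : Vec n × Design n p | score ρ g z.1 z.2 i = 0}ᶜ := by ext; simp
      have h2 : MeasurableSet {z : Vec n × Design n p | ∃ i, score ρ g z.1 z.2 i ≠ 0} := by
        rw [this]
        exact MeasurableSet.iUnion fun i =>
          (measurableSet_eq_fun (H.measurable_score hn i) measurable_const).compl
      exact h2
    · exact measurableSet_eq_fun (H.measurable_gapFun hn) (hm1.mul (H.measurable_remainderFun hn))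
    · exact measurableSet_eq_fun (H.measurable_gapFun hn) (hm2.mul (H.measurable_proxyFun hn))
  have hae := (Measure.ae_prod_iff_ae_ae (μ := ν) (ν := gaussDesign n p) hmeas).2 (by
    filter_upwards [he, hreg2, hex] with e he h hx
    filter_upwards [h, H.ae_exists_typicalDesign hγ hn hp he hx] with G hG ⟨M, hM, hT⟩
    obtain ⟨k1, k2, k3⟩ := key hM he hT hG.1 hG.2
    exact ⟨k1, k2.2, k3.2⟩)
  filter_upwards [hreg, hae] with z h1 h2
  exact ⟨H.exists_isDerivMatrix hn h1.1 h1.2, h2⟩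

/-! ### Whitening -/

theorem matMul_mul {p : ℕ} (A B : Matrix (Fin p) (Fin p) ℝ) (v : Vec p) :
    matMul (A * B) v = matMul A (matMul B v) := by
  simp [matMul, map_mul]

theorem matMul_one {p : ℕ} (v : Vec p) : matMul 1 v = v := by
  simp [matMul]

theorem matMul_sum {p : ℕ} {ι : Type*} (s : Finset ι) (A : Matrix (Fin p) (Fin p) ℝ)
    (v : ι → Vec p) : matMul A (∑ i ∈ s, v i) = ∑ i ∈ s, matMul A (v i) := map_sum _ _ _

theorem continuous_matMul {p : ℕ} (A : Matrix (Fin p) (Fin p) ℝ) : Continuous (matMul A) :=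
  (Matrix.toEuclideanCLM (𝕜 := ℝ) A).continuous

theorem inner_matMul_left {p : ℕ} {A : Matrix (Fin p) (Fin p) ℝ} (hA : A.IsHermitian)
    (v w : Vec p) : inner ℝ (matMul A v) w = inner ℝ v (matMul A w) := by
  have h : ContinuousLinearMap.adjoint (Matrix.toEuclideanCLM (𝕜 := ℝ) A)
      = Matrix.toEuclideanCLM (𝕜 := ℝ) A := by
    rw [← ContinuousLinearMap.star_eq_adjoint, ← map_star, Matrix.star_eq_conjTranspose, hA.eq]
  rw [matMul, matMul]
  conv_lhs => rw [← h]
  exact ContinuousLinearMap.adjoint_inner_left _ _ _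

section Sqrt

variable {p : ℕ} {S : Matrix (Fin p) (Fin p) ℝ}

theorem sqrt_mul_self (hS : S.PosDef) : CFC.sqrt S * CFC.sqrt S = S :=
  CFC.sqrt_mul_sqrt_self S hS.posSemidef.nonneg

theorem isHermitian_sqrt (S : Matrix (Fin p) (Fin p) ℝ) : (CFC.sqrt S).IsHermitian :=
  (Matrix.nonneg_iff_posSemidef.1 (CFC.sqrt_nonneg S)).isHermitian

theorem isUnit_det_sqrt (hS : S.PosDef) : IsUnit (CFC.sqrt S).det :=
  (Matrix.isUnit_iff_isUnit_det _).1
    ((CFC.isUnit_sqrt_iff S hS.posSemidef.nonneg).2 hS.isUnit)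

theorem sqrt_mul_inv (hS : S.PosDef) : CFC.sqrt S * (CFC.sqrt S)⁻¹ = 1 :=
  Matrix.mul_nonsing_inv _ (isUnit_det_sqrt hS)

theorem inv_mul_sqrt (hS : S.PosDef) : (CFC.sqrt S)⁻¹ * CFC.sqrt S = 1 :=
  Matrix.nonsing_inv_mul _ (isUnit_det_sqrt hS)

theorem matMul_sqrt_inv (hS : S.PosDef) (v : Vec p) :
    matMul (CFC.sqrt S) (matMul (CFC.sqrt S)⁻¹ v) = v := by
  rw [← matMul_mul, sqrt_mul_inv hS, matMul_one]

theorem matMul_inv_sqrt (hS : S.PosDef) (v : Vec p) :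
    matMul (CFC.sqrt S)⁻¹ (matMul (CFC.sqrt S) v) = v := by
  rw [← matMul_mul, inv_mul_sqrt hS, matMul_one]

theorem inner_matMul_self (hS : S.PosDef) (b : Vec p) :
    inner ℝ b (matMul S b) = ‖matMul (CFC.sqrt S) b‖ ^ 2 := by
  rw [← real_inner_self_eq_norm_sq, inner_matMul_left (isHermitian_sqrt S), ← matMul_mul,
    sqrt_mul_self hS]

end Sqrt

/-- The penalty as a function of the whitened error `S^{1/2}(b - β*)`. -/
noncomputable def whitenPenalty {p : ℕ} (g : Vec p → ℝ) (S : Matrix (Fin p) (Fin p) ℝ)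
    (βstar : Vec p) (c : Vec p) : ℝ :=
  g (βstar + matMul (CFC.sqrt S)⁻¹ c)

/-- The design with rows `S^{-1/2} xᵢ`. -/
noncomputable def whitenDesign {n p : ℕ} (S : Matrix (Fin p) (Fin p) ℝ) (X : Design n p) :
    Design n p :=
  fun i => matMul (CFC.sqrt S)⁻¹ (X i)

theorem continuous_whitenDesign {n p : ℕ} (S : Matrix (Fin p) (Fin p) ℝ) :
    Continuous (whitenDesign (n := n) S) :=
  continuous_pi fun i => (continuous_matMul _).comp (continuous_apply i)

/-- The convexity assumption on the penalty, relative to the covariance, is strong convexity of the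
whitened penalty: the two quadratic forms differ by an affine function. -/
theorem strongConvexOn_whitenPenalty {p : ℕ} {μ : ℝ} {g : Vec p → ℝ}
    {S : Matrix (Fin p) (Fin p) ℝ} (hS : S.PosDef) (βstar : Vec p)
    (hg : ConvexOn ℝ Set.univ fun b : Vec p => g b - μ / 2 * inner ℝ b (matMul S b)) :
    StrongConvexOn Set.univ μ (whitenPenalty g S βstar) := by
  rw [strongConvexOn_iff_convex]
  let L : Vec p →ᵃ[ℝ] Vec p := AffineMap.const ℝ (Vec p) βstar
    + ((Matrix.toEuclideanCLM (𝕜 := ℝ) (CFC.sqrt S)⁻¹ : Vec p →L[ℝ] Vec p) :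
        Vec p →ₗ[ℝ] Vec p).toAffineMap
  have h1 := hg.comp_affineMap L
  have h2 : ConvexOn ℝ Set.univ fun c : Vec p =>
      (innerSL ℝ (μ • matMul (CFC.sqrt S) βstar) : Vec p →ₗ[ℝ] ℝ) c :=
    (LinearMap.convexOn _ convex_univ)
  have h3 := (h1.add h2).add_const (μ / 2 * ‖matMul (CFC.sqrt S) βstar‖ ^ 2)
  refine h3.congr fun c _ => ?_
  have hL : L c = βstar + matMul (CFC.sqrt S)⁻¹ c := rfl
  simp only [Pi.add_apply, Function.comp_apply, hL, inner_matMul_self hS, matMul_add,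
    matMul_sqrt_inv hS, norm_add_sq_real]
  simp only [whitenPenalty, ContinuousLinearMap.coe_coe, innerSL_apply_apply, inner_smul_left]
  simp
  ring

section Transfer

variable {n p : ℕ} {μ : ℝ} {ρ : ℝ → ℝ} {g : Vec p → ℝ} {S : Matrix (Fin p) (Fin p) ℝ}
  {βstar : Vec p}

theorem isHermitian_sqrt_inv (S : Matrix (Fin p) (Fin p) ℝ) : (CFC.sqrt S)⁻¹.IsHermitian :=
  (isHermitian_sqrt S).inv

theorem objective_whiten (y : Vec n) (X : Design n p) (c : Vec p) :
    objective ρ (whitenPenalty g S βstar) (y - designMul X βstar) (whitenDesign S X) c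
      = objective ρ g y X (βstar + matMul (CFC.sqrt S)⁻¹ c) := by
  rw [objective_eq, objective_eq, whitenPenalty]
  congr 3
  funext i
  rw [whitenDesign, inner_matMul_left (isHermitian_sqrt_inv S), inner_add_right]
  simp [designMul, sub_sub]

/-- The estimator in terms of the whitened one. The original problem inherits its minimizer from the
whitened problem, so that `mEstimator` is not a junk value there. -/
theorem mEstimator_eq_whiten (hS : S.PosDef)
    (H : IsotropicProblem μ ρ (whitenPenalty g S βstar)) (hn : 1 ≤ n) (y : Vec n)
    (X : Design n p) : mEstimator ρ g y X = βstar + matMul (CFC.sqrt S)⁻¹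
      (mEstimator ρ (whitenPenalty g S βstar) (y - designMul X βstar) (whitenDesign S X)) := by
  have hsurj : ∀ b, βstar + matMul (CFC.sqrt S)⁻¹ (matMul (CFC.sqrt S) (b - βstar)) = b :=
    fun b => by rw [matMul_inv_sqrt hS, add_sub_cancel]
  have hex : ∃ b, ∀ b', objective ρ g y X b ≤ objective ρ g y X b' := by
    refine ⟨βstar + matMul (CFC.sqrt S)⁻¹ (mEstimator ρ (whitenPenalty g S βstar)
      (y - designMul X βstar) (whitenDesign S X)), fun b' => ?_⟩
    rw [← hsurj b', ← objective_whiten, ← objective_whiten]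
    exact H.mEstimator_isMin _ _ _
  have hmin : ∀ b', objective ρ g y X (mEstimator ρ g y X) ≤ objective ρ g y X b' :=
    Classical.epsilon_spec hex
  rw [← H.isMin_unique hn (h := matMul (CFC.sqrt S) (mEstimator ρ g y X - βstar)), hsurj]
  intro b
  rw [objective_whiten, objective_whiten, hsurj]
  exact hmin _

theorem residual_eq_whiten (hS : S.PosDef)
    (H : IsotropicProblem μ ρ (whitenPenalty g S βstar)) (hn : 1 ≤ n) (y : Vec n)
    (X : Design n p) : residual ρ g y X
      = residual ρ (whitenPenalty g S βstar) (y - designMul X βstar) (whitenDesign S X) := by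
  ext i
  rw [residual_apply, residual_apply, mEstimator_eq_whiten hS H hn, whitenDesign,
    inner_matMul_left (isHermitian_sqrt_inv S), inner_add_right]
  simp [designMul, sub_sub]

theorem matMul_sqrt_sub_eq_whiten (hS : S.PosDef)
    (H : IsotropicProblem μ ρ (whitenPenalty g S βstar)) (hn : 1 ≤ n) (y : Vec n)
    (X : Design n p) : matMul (CFC.sqrt S) (mEstimator ρ g y X - βstar)
      = mEstimator ρ (whitenPenalty g S βstar) (y - designMul X βstar) (whitenDesign S X) := by
  rw [mEstimator_eq_whiten hS H hn, add_sub_cancel_left, matMul_sqrt_inv hS]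

/-- The change of data that whitens the problem, as a linear equivalence. -/
noncomputable def whitenEquiv (n : ℕ) (hS : S.PosDef) (βstar : Vec p) :
    (Vec n × Design n p) ≃L[ℝ] (Vec n × Design n p) :=
  LinearEquiv.toContinuousLinearEquiv
    { toFun := fun z => (z.1 - designMul z.2 βstar, whitenDesign S z.2)
      invFun := fun w => (w.1 + designMul (fun i => matMul (CFC.sqrt S) (w.2 i)) βstar,
        fun i => matMul (CFC.sqrt S) (w.2 i))
      map_add' := fun z w => by
        refine Prod.ext ?_ ?_
        · ext i
          simp [designMul, inner_add_left]
          ring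
        · funext i
          simp [whitenDesign, matMul_add]
      map_smul' := fun c z => by
        refine Prod.ext ?_ ?_
        · ext i
          simp [designMul, inner_smul_left]
          ring
        · funext i
          simp [whitenDesign, matMul_smul]
      left_inv := fun z => by
        simp [whitenDesign, matMul_sqrt_inv hS]
      right_inv := fun w => by
        refine Prod.ext (by simp) (funext fun i => ?_)
        exact matMul_inv_sqrt hS _ }

theorem whitenEquiv_apply (hS : S.PosDef) (z : Vec n × Design n p) :
    whitenEquiv n hS βstar z = (z.1 - designMul z.2 βstar, whitenDesign S z.2) := rfl

theorem scoreDeriv_whiten (hS : S.PosDef)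
    (H : IsotropicProblem μ ρ (whitenPenalty g S βstar)) (hn : 1 ≤ n) (y : Vec n)
    (X : Design n p) (v : Vec n × Design n p) :
    scoreDeriv ρ (whitenPenalty g S βstar) (y - designMul X βstar) (whitenDesign S X)
        (whitenEquiv n hS βstar v) = matMul (CFC.sqrt S)⁻¹ (scoreDeriv ρ g y X v) := by
  rw [scoreDeriv_apply, scoreDeriv_apply, matMul_sum]
  refine Finset.sum_congr rfl fun i _ => ?_
  rw [whitenEquiv_apply, matMul_add, matMul_smul, matMul_smul, score, score,
    ← residual_eq_whiten hS H hn, mEstimator_eq_whiten hS H hn y X]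
  simp only [whitenDesign]
  rw [inner_matMul_left (isHermitian_sqrt_inv S), inner_add_right]
  simp only [PiLp.sub_apply, designMul, sub_sub]

/-- The chain rule along the linear change of data `whitenEquiv`. -/
theorem fderiv_whiten (hS : S.PosDef)
    (H : IsotropicProblem μ ρ (whitenPenalty g S βstar)) (hn : 1 ≤ n) (y : Vec n)
    (X : Design n p) :
    (DifferentiableAt ℝ (fun z : Vec n × Design n p => mEstimator ρ g z.1 z.2) (y, X) ↔
      DifferentiableAt ℝ (fun z : Vec n × Design n p =>
        mEstimator ρ (whitenPenalty g S βstar) z.1 z.2)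
        (y - designMul X βstar, whitenDesign S X)) ∧
    (DifferentiableAt ℝ (fun z : Vec n × Design n p => mEstimator ρ g z.1 z.2) (y, X) →
      ∀ v, fderiv ℝ (fun z : Vec n × Design n p =>
        mEstimator ρ (whitenPenalty g S βstar) z.1 z.2)
        (y - designMul X βstar, whitenDesign S X) (whitenEquiv n hS βstar v)
      = matMul (CFC.sqrt S) (fderiv ℝ (fun z : Vec n × Design n p => mEstimator ρ g z.1 z.2)
        (y, X) v)) := by
  obtain ⟨f, hf⟩ : ∃ f : Vec n × Design n p → Vec p, f = fun z => mEstimator ρ g z.1 z.2 :=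
    ⟨_, rfl⟩
  obtain ⟨k, hk⟩ : ∃ k : Vec n × Design n p → Vec p,
    k = fun z => mEstimator ρ (whitenPenalty g S βstar) z.1 z.2 := ⟨_, rfl⟩
  have h1 : k ∘ whitenEquiv n hS βstar
      = fun z => Matrix.toEuclideanCLM (𝕜 := ℝ) (CFC.sqrt S) (f z - βstar) := by
    funext z
    rw [hk, hf]
    exact (matMul_sqrt_sub_eq_whiten hS H hn z.1 z.2).symm
  have h2 : f = fun z => βstar + Matrix.toEuclideanCLM (𝕜 := ℝ) (CFC.sqrt S)⁻¹
      ((k ∘ whitenEquiv n hS βstar) z) := by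
    funext z
    rw [hk, hf]
    exact mEstimator_eq_whiten hS H hn z.1 z.2
  have hz : (y - designMul X βstar, whitenDesign S X) = whitenEquiv n hS βstar (y, X) := rfl
  rw [← hf, ← hk, hz]
  have hfor : ∀ L, HasFDerivAt f L (y, X) → HasFDerivAt (k ∘ whitenEquiv n hS βstar)
      ((Matrix.toEuclideanCLM (𝕜 := ℝ) (CFC.sqrt S)).comp L) (y, X) := fun L hL => by
    rw [h1]
    exact (Matrix.toEuclideanCLM (𝕜 := ℝ) (CFC.sqrt S)).hasFDerivAt.comp _
      (hL.sub_const βstar)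
  refine ⟨?_, fun hd v => ?_⟩
  · rw [← (whitenEquiv n hS βstar).comp_right_differentiableAt_iff]
    refine ⟨fun hd => (hfor _ hd.hasFDerivAt).differentiableAt, fun hd => ?_⟩
    rw [h2]
    exact ((Matrix.toEuclideanCLM (𝕜 := ℝ) (CFC.sqrt S)⁻¹).differentiableAt.comp _
      hd).const_add βstar
  · have h3 := (hfor _ hd.hasFDerivAt).fderiv
    rw [(whitenEquiv n hS βstar).comp_right_fderiv] at h3
    exact DFunLike.congr_fun h3 v

/-- Derivative matrices of the original and of the whitened problem correspond to each other by
conjugation with `S^{1/2}`. -/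
theorem isDerivMatrix_whiten_iff (hS : S.PosDef)
    (H : IsotropicProblem μ ρ (whitenPenalty g S βstar)) (hn : 1 ≤ n) (y : Vec n)
    (X : Design n p) (A : Matrix (Fin p) (Fin p) ℝ) :
    IsDerivMatrix μ ρ g S y X A ↔ IsDerivMatrix μ ρ (whitenPenalty g S βstar) 1
      (y - designMul X βstar) (whitenDesign S X) (CFC.sqrt S * A * CFC.sqrt S) := by
  obtain ⟨hd, hf⟩ := fderiv_whiten (n := n) hS H hn y X
  constructor
  · intro hA
    refine isDerivMatrix_of_fderiv_eq (hd.1 hA.differentiableAt) (by simpa using hA.norm_le) ?_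
    intro w
    obtain ⟨v, rfl⟩ := (whitenEquiv n hS βstar).surjective w
    rw [hf hA.differentiableAt, scoreDeriv_whiten hS H hn, hA.fderiv_eq, matMul_mul, matMul_sqrt_inv hS, matMul_mul]
  · intro hA
    refine isDerivMatrix_of_fderiv_eq (hd.2 hA.differentiableAt) (by simpa using hA.norm_le) ?_
    intro v
    have h := hf (hd.2 hA.differentiableAt) v
    rw [hA.fderiv_eq, scoreDeriv_whiten hS H hn, matMul_mul, matMul_sqrt_inv hS, matMul_mul] at h
    have h2 := congrArg (matMul (CFC.sqrt S)⁻¹) h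
    rw [matMul_inv_sqrt hS, matMul_inv_sqrt hS] at h2
    exact h2.symm

end Transfer

/-! ### The joint law of the noise and of the whitened design -/

theorem map_whiten_multivariateGaussian {p : ℕ} {S : Matrix (Fin p) (Fin p) ℝ} (hS : S.PosDef) :
    (multivariateGaussian 0 S).map (matMul (CFC.sqrt S)⁻¹) = stdGaussian (Vec p) := by
  rw [multivariateGaussian, Measure.map_map (continuous_matMul _).measurable (by fun_prop)]
  have : (matMul (CFC.sqrt S)⁻¹ ∘ fun x => 0 + Matrix.toEuclideanCLM (𝕜 := ℝ) (CFC.sqrt S) x)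
      = id := by
    funext x
    rw [Function.comp_apply, zero_add]
    exact matMul_inv_sqrt hS x
  rw [this, Measure.map_id]

/-- The joint law of the noise and of the whitened design is a product. -/
theorem map_noise_whitenDesign {n p : ℕ} {Ω : Type*} [MeasurableSpace Ω] {P : Measure Ω}
    [IsProbabilityMeasure P] {S : Matrix (Fin p) (Fin p) ℝ} {X : Ω → Design n p} {ε : Ω → Vec n}
    (hS : S.PosDef) (hX : Measurable X)
    (hlaw : ∀ i, P.map (fun ω => X ω i) = multivariateGaussian 0 S)
    (hind : iIndepFun (fun i ω => X ω i) P) (hε : Measurable ε) (hεX : IndepFun ε X P) :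
    P.map (fun ω => (ε ω, whitenDesign S (X ω))) = (P.map ε).prod (gaussDesign n p) := by
  have hW : Measurable (whitenDesign (n := n) S) := (continuous_whitenDesign S).measurable
  have hQ : Measurable (matMul (CFC.sqrt S)⁻¹) := (continuous_matMul _).measurable
  have hXi : ∀ i, Measurable fun ω => X ω i := fun i => (measurable_pi_apply i).comp hX
  have h1 : IndepFun ε (whitenDesign S ∘ X) P := hεX.comp measurable_id hW
  have h2 := (indepFun_iff_map_prod_eq_prod_map_map hε.aemeasurable
    (hW.comp hX).aemeasurable).1 h1
  have h3 : iIndepFun (fun i ω => matMul (CFC.sqrt S)⁻¹ (X ω i)) P :=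
    hind.comp (fun _ => matMul (CFC.sqrt S)⁻¹) fun _ => hQ
  have h4 := (iIndepFun_iff_map_fun_eq_pi_map fun i => (hQ.comp (hXi i)).aemeasurable).1 h3
  have h5 : ∀ i, P.map (fun ω => matMul (CFC.sqrt S)⁻¹ (X ω i)) = stdGaussian (Vec p) := fun i => by
    rw [← map_whiten_multivariateGaussian hS, ← hlaw i, Measure.map_map hQ (hXi i)]
    rfl
  have h6 : P.map (whitenDesign S ∘ X) = gaussDesign n p :=
    h4.trans (congrArg Measure.pi (funext h5))
  rw [h6] at h2
  exact h2

theorem IsOP.comp {Ω Ω' : Type*} [MeasurableSpace Ω] [MeasurableSpace Ω'] {P : Measure Ω}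
    {Z : Ω → Ω'} {K : ℝ → ℝ} {a : ℝ} {W : Ω' → ℝ} (hZ : Measurable Z)
    (h : IsOP (P.map Z) K a W) : IsOP P K a fun ω => W (Z ω) := by
  refine ⟨h.1.comp hZ, fun δ hδ => ?_⟩
  have := h.2 δ hδ
  rwa [Measure.map_apply hZ (measurableSet_le measurable_const h.1.abs)] at this

section Transfer

variable {n p : ℕ} {μ : ℝ} {ρ : ℝ → ℝ} {g : Vec p → ℝ} {S : Matrix (Fin p) (Fin p) ℝ}
  {βstar : Vec p}

theorem remainder_eq_whiten (hS : S.PosDef)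
    (H : IsotropicProblem μ ρ (whitenPenalty g S βstar)) (hn : 1 ≤ n) (e : Vec n)
    (X : Design n p) : remainder ρ g S βstar e (designMul X βstar + e) X
      = remainderFun ρ (whitenPenalty g S βstar) e (whitenDesign S X) := by
  have h1 := matMul_sqrt_sub_eq_whiten hS H hn (designMul X βstar + e) X
  have h2 := residual_eq_whiten hS H hn (designMul X βstar + e) X
  rw [add_sub_cancel_left] at h1 h2
  rw [remainder, outOfSample, h1, h2, remainderFun, norm_smul, Real.norm_of_nonneg (by positivity)]
  simp only [one_div_mul_eq_div]

/-- The error of the proxy in the original problem, once the trace of the derivative matrix is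
identified with `traceFun`. -/
theorem gapFun_eq_of_isDerivMatrix (hS : S.PosDef)
    (H : IsotropicProblem μ ρ (whitenPenalty g S βstar)) (hn : 1 ≤ n) (e : Vec n)
    (X : Design n p) {A : Matrix (Fin p) (Fin p) ℝ}
    (hA : IsDerivMatrix μ ρ g S (designMul X βstar + e) X A)
    (hs : ∃ i, score ρ (whitenPenalty g S βstar) e (whitenDesign S X) i ≠ 0) :
    proxyFun ρ (whitenPenalty g S βstar) e (whitenDesign S X)
        = proxy ρ g S A (designMul X βstar + e) X ∧
      gapFun ρ (whitenPenalty g S βstar) e (whitenDesign S X)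
        = outOfSample ρ g S βstar (designMul X βstar + e) X + ‖e‖ ^ 2 / n
          - proxy ρ g S A (designMul X βstar + e) X := by
  have h1 := matMul_sqrt_sub_eq_whiten hS H hn (designMul X βstar + e) X
  have h2 := residual_eq_whiten hS H hn (designMul X βstar + e) X
  have h3 := (isDerivMatrix_whiten_iff hS H hn (designMul X βstar + e) X A).1 hA
  rw [add_sub_cancel_left] at h1 h2 h3
  have h4 := h3.traceFun_eq hs
  rw [Matrix.trace_mul_cycle, sqrt_mul_self hS] at h4
  have h5 : proxyFun ρ (whitenPenalty g S βstar) e (whitenDesign S X)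
      = proxy ρ g S A (designMul X βstar + e) X := by
    rw [proxyFun, proxy, h2, h4]
  exact ⟨h5, by rw [gapFun, h5, outOfSample, h1]⟩

end Transfer

end RobustReg

theorem mainTheorem5 (γ μ : ℝ) (hγ : 0 < γ) (hμ : 0 < μ) :
    ∃ K : ℝ → ℝ, ∀ (n p : ℕ) (_ : 1 ≤ n)
      (Ω : Type*) [MeasurableSpace Ω] (P : Measure Ω) [IsProbabilityMeasure P]
      (ρ : ℝ → ℝ) (g : RobustReg.Vec p → ℝ) (S : Matrix (Fin p) (Fin p) ℝ)
      (βstar : RobustReg.Vec p) (X : Ω → RobustReg.Design n p)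
      (ε y : Ω → RobustReg.Vec n),
      RobustReg.MainAssumption γ μ P ρ g S X ε →
      (∀ ω, y ω = RobustReg.designMul (X ω) βstar + ε ω) →
      (∀ᵐ ω ∂P, ∃ A, RobustReg.IsDerivMatrix μ ρ g S (y ω) (X ω) A) ∧
      ∀ A : Ω → Matrix (Fin p) (Fin p) ℝ,
        (∀ᵐ ω ∂P, RobustReg.IsDerivMatrix μ ρ g S (y ω) (X ω) (A ω)) →
        (∃ W : Ω → ℝ, RobustReg.IsOP P K ((n : ℝ) ^ (-(1 / 2) : ℝ)) W ∧
          ∀ᵐ ω ∂P,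
            RobustReg.outOfSample ρ g S βstar (y ω) (X ω) + ‖ε ω‖ ^ 2 / n
              = RobustReg.proxy ρ g S (A ω) (y ω) (X ω)
                + W ω * RobustReg.remainder ρ g S βstar (ε ω) (y ω) (X ω)) ∧
        (∃ W : Ω → ℝ, RobustReg.IsOP P K ((n : ℝ) ^ (-(1 / 2) : ℝ)) W ∧
          ∀ᵐ ω ∂P,
            RobustReg.outOfSample ρ g S βstar (y ω) (X ω) + ‖ε ω‖ ^ 2 / n
              = (1 + W ω) * RobustReg.proxy ρ g S (A ω) (y ω) (X ω)) := by
  open RobustReg in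
  obtain ⟨K, hK⟩ := exists_isotropic_const hγ hμ
  refine ⟨K, fun n p hn Ω _ P _ ρ g S βstar X ε y hM hy => ?_⟩
  obtain rfl : y = fun ω => designMul (X ω) βstar + ε ω := funext hy
  have hS := hM.cov_posDef
  have H : IsotropicProblem μ ρ (whitenPenalty g S βstar) :=
    ⟨hμ, hM.loss_convex, hM.loss_min, hM.loss_contDiff, hM.loss_lipschitz,
      strongConvexOn_whitenPenalty hS βstar hM.penalty_convex⟩
  have hp : (p : ℝ) ≤ γ * n := by
    have hn0 : (0 : ℝ) < n := by exact_mod_cast hn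
    exact (div_le_iff₀ hn0).1 hM.dim_le
  have hZ : Measurable fun ω => (ε ω, whitenDesign S (X ω)) :=
    hM.noise_measurable.prodMk ((continuous_whitenDesign S).measurable.comp hM.design_measurable)
  have hν : IsProbabilityMeasure (P.map ε) :=
    Measure.isProbabilityMeasure_map hM.noise_measurable.aemeasurable
  have hlaw := map_noise_whitenDesign hS hM.design_measurable hM.design_law hM.design_indep
    hM.noise_measurable hM.noise_indep
  obtain ⟨w1, w2, hae⟩ := hK (P.map ε) H hn hp hM.noise_continuous
  rw [← hlaw] at w1 w2 hae
  have hae' := ae_of_ae_map hZ.aemeasurable hae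
  refine ⟨?_, fun A hA => ⟨⟨_, w1.comp hZ, ?_⟩, ⟨_, w2.comp hZ, ?_⟩⟩⟩
  · filter_upwards [hae'] with ω h
    obtain ⟨A, hA⟩ := h.1
    refine ⟨(CFC.sqrt S)⁻¹ * A * (CFC.sqrt S)⁻¹, ?_⟩
    rw [isDerivMatrix_whiten_iff hS H hn, add_sub_cancel_left]
    have : CFC.sqrt S * ((CFC.sqrt S)⁻¹ * A * (CFC.sqrt S)⁻¹) * CFC.sqrt S = A := by
      rw [Matrix.mul_assoc, Matrix.mul_assoc _ _ (CFC.sqrt S), inv_mul_sqrt hS, Matrix.mul_one,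
        ← Matrix.mul_assoc, sqrt_mul_inv hS, Matrix.one_mul]
    rwa [this]
  · filter_upwards [hae', hA] with ω h hAω
    obtain ⟨-, hs, h1, -⟩ := h
    have h2 := (gapFun_eq_of_isDerivMatrix hS H hn (ε ω) (X ω) hAω hs).2
    rw [remainder_eq_whiten hS H hn]
    rw [← h1, h2]
    ring
  · filter_upwards [hae', hA] with ω h hAω
    obtain ⟨-, hs, -, h1⟩ := h
    obtain ⟨h2, h3⟩ := gapFun_eq_of_isDerivMatrix hS H hn (ε ω) (X ω) hAω hs
    rw [← h2, one_add_mul, ← h1, h3, h2]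
    ring
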